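/- Let $\mathcal P(3)$ be the space of real symmetric positive definite $3\times 3$ matrices of determinant $1$, with the topology induced from the space of matrices, on which $SL(3,\mathbb R)$ acts by $g.X=g^{T}Xg$. For $X,Y\in\mathcal P(3)$ put $s(X,Y)=\operatorname{tr}(X^{-1}Y)$. For a subgroup $\Gamma<SL(3,\mathbb R)$ and $X\in\mathcal P(3)$, the Dirichlet–Selberg domain is $$DS(X,\Gamma)=\{Y\in\mathcal P(3)\mid s(X,Y)\le s(g.X,Y)\ \text{for all } g\in\Gamma\}.$$ A hyperplane of $\mathcal P(3)$ is a non-empty set $\{Y\in\mathcal P(3)\mid\operatorname{tr}(AY)=0\}$ with $A\neq 0$ real symmetric; it bounds the closed half-spaces $\{Y\mid \pm\operatorname{tr}(AY)\ge 0\}$. A convex polyhedron is an intersection of closed half-spaces whose bounding hyperplanes form a locally finite family. A facet of a convex polyhedron $P$ is a maximal non-empty subset of the boundary $\partial P$ that is itself a convex polyhedron. A set is finitely-sided (respectively infinitely-sided) if it is a convex polyhedron with finitely (respectively infinitely) many facets. A subset of $\mathcal P(3)$ is Zariski open if its complement in $\mathcal P(3)$ is the common zero set of a set of real polynomials in the matrix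 entries. A cyclic subgroup of $SL(3,\mathbb R)$ is said to be of the following type if it is conjugate in $SL(3,\mathbb R)$ to the group generated by the matrix given: - type (1): $\begin{pmatrix}1&1&0\\0&1&0\\0&0&1\end{pmatrix}$; type (2): $\begin{pmatrix}1&1&0\\0&1&1\\0&0&1\end{pmatrix}$; - type (3): $\operatorname{diag}(e^r,e^s,e^t)$ with $r+s+t=0$ and $r,s,t$ all nonzero; type (3'): $\operatorname{diag}(e^s,e^{-s},1)$ with $s\ne0$; - type (4): $\begin{pmatrix}e^t&1&0\\0&e^t&0\\0&0&e^{-2t}\end{pmatrix}$ with $t\neq0$. A $2$-generated subgroup (generated by two elements, but not cyclic) is of the following type if it is conjugate in $SL(3,\mathbb R)$ to the group generated by the two matrices given: - type (1): $\begin{pmatrix}1&1&0\\0&1&0\\0&0&1\end{pmatrix},\ \begin{pmatrix}1&0&1\\0&1&0\\0&0&1\end{pmatrix}$; type (1'): $\begin{pmatrix}1&0&0\\0&1&1\\0&0&1\end{pmatrix},\ \begin{pmatrix}1&0&1\\0&1&0\\0&0&1\end{pmatrix}$; - type (2): $\begin{pmatrix}1&1&0\\0&1&1\\0&0&1\end{pmatrix},\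 \begin{pmatrix}1&a&b\\0&1&a\\0&0&1\end{pmatrix}$ with $a,b\in\mathbb R$, $b\neq a(a-1)/2$; - type (3): $\operatorname{diag}(e^r,e^s,e^t),\ \operatorname{diag}(e^{r'},e^{s'},e^{t'})$ with $r+s+t=r'+s'+t'=0$; - type (4): $\begin{pmatrix}e^t&1&0\\0&e^t&0\\0&0&e^{-2t}\end{pmatrix},\ \begin{pmatrix}e^s&a&0\\0&e^s&0\\0&0&e^{-2s}\end{pmatrix}$ with $a,s,t\in\mathbb R$, $(s,t)\ne(0,0)$. **Theorem.** Let $\Gamma$ be a discrete and free abelian subgroup of $SL(3,\mathbb R)$, generated by matrices all of whose (complex) eigenvalues are positive real numbers. 1. If $\Gamma$ is cyclic of type (1), (3) or (4), or $2$-generated of type (1) or (3), then $DS(X,\Gamma)$ is finitely-sided for every $X\in\mathcal P(3)$. 2. If $\Gamma$ is cyclic of type (2) or (3'), or $2$-generated of type (1'), (2) or (4), then there is a dense and Zariski open subset of $\mathcal P(3)$ such that $DS(X,\Gamma)$ is infinitely-sided for every $X$ in it. -/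

import Mathlib

open Matrix Topology
open scoped MatrixGroups

namespace DirichletSelberg

/-- The symmetric space `𝒫(n)` in its matrix model: positive definite real symmetric `n × n`
matrices of determinant one, with the topology induced from the space of matrices. -/
abbrev SymSpace (n : ℕ) : Type :=
  {X : Matrix (Fin n) (Fin n) ℝ // X.PosDef ∧ X.det = 1}

/-- The action of `SL(n, ℝ)` on `𝒫(n)` by congruence, `g.X = gᵀ X g`. -/
def act {n : ℕ} (g : SpecialLinearGroup (Fin n) ℝ) (X : SymSpace n) : SymSpace n :=
  ⟨(g : Matrix (Fin n) (Fin n) ℝ)ᵀ * X.1 * (g : Matrix (Fin n) (Fin n) ℝ), by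
    refine ⟨?_, by simp [Matrix.det_mul, X.2.2]⟩
    have h : Function.Injective (g : Matrix (Fin n) (Fin n) ℝ).mulVec :=
      Matrix.mulVec_injective_of_isUnit
        ((Matrix.isUnit_iff_isUnit_det _).2 (by simp))
    simpa [Matrix.conjTranspose_eq_transpose_of_trivial] using
      X.2.1.conjTranspose_mul_mul_same h⟩

/-- Selberg's invariant `s(X, Y) = tr(X⁻¹ Y)`. -/
noncomputable def selbergInv {n : ℕ} (X Y : SymSpace n) : ℝ :=
  Matrix.trace (X.1⁻¹ * Y.1)

/-- The Dirichlet–Selberg domain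
`DS(X, Γ) = {Y ∈ 𝒫(n) | s(X, Y) ≤ s(g.X, Y) for all g ∈ Γ}`. -/
def DS {n : ℕ} (X : SymSpace n) (Γ : Subgroup (SpecialLinearGroup (Fin n) ℝ)) :
    Set (SymSpace n) :=
  {Y | ∀ g ∈ Γ, selbergInv X Y ≤ selbergInv (act g X) Y}

/-- The normal space `A^⊥ = {Y ∈ 𝒫(n) | tr(A Y) = 0}` of a matrix `A`. -/
def normalSpace {n : ℕ} (A : Matrix (Fin n) (Fin n) ℝ) : Set (SymSpace n) :=
  {Y | Matrix.trace (A * Y.1) = 0}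

/-- The closed half-space `{Y ∈ 𝒫(n) | tr(A Y) ≥ 0}` bounded by `A^⊥`. -/
def halfSpace {n : ℕ} (A : Matrix (Fin n) (Fin n) ℝ) : Set (SymSpace n) :=
  {Y | 0 ≤ Matrix.trace (A * Y.1)}

/-- `A` is a normal vector of a hyperplane of `𝒫(n)`: a nonzero symmetric matrix whose normal
space meets `𝒫(n)`. -/
def IsNormalVector {n : ℕ} (A : Matrix (Fin n) (Fin n) ℝ) : Prop :=
  A.IsSymm ∧ A ≠ 0 ∧ (normalSpace A).Nonempty

/-- A closed convex polyhedron of `𝒫(n)`: the intersection of a collection of closed half-spaces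
whose bounding hyperplanes form a locally finite family. -/
def IsConvexPolyhedron {n : ℕ} (P : Set (SymSpace n)) : Prop :=
  ∃ 𝒜 : Set (Matrix (Fin n) (Fin n) ℝ),
    (∀ A ∈ 𝒜, IsNormalVector A) ∧
    LocallyFinite (fun A : 𝒜 => normalSpace (A : Matrix (Fin n) (Fin n) ℝ)) ∧
    P = ⋂ A ∈ 𝒜, halfSpace A

/-- A facet of `P`: a maximal nonempty subset of the boundary of `P` that is itself a convex
polyhedron. -/
def IsFacet {n : ℕ} (P F : Set (SymSpace n)) : Prop :=
  Maximal (fun G : Set (SymSpace n) => G.Nonempty ∧ G ⊆ frontier P ∧ IsConvexPolyhedron G) F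

/-- `P` is a convex polyhedron with finitely many facets. -/
def FinitelySided {n : ℕ} (P : Set (SymSpace n)) : Prop :=
  IsConvexPolyhedron P ∧ {F | IsFacet P F}.Finite

/-- `P` is a convex polyhedron with infinitely many facets. -/
def InfinitelySided {n : ℕ} (P : Set (SymSpace n)) : Prop :=
  IsConvexPolyhedron P ∧ {F | IsFacet P F}.Infinite

/-- `U` is Zariski open in `𝒫(n)`: its complement is the common zero set in `𝒫(n)` of a set of
real polynomials in the matrix entries. -/
def IsZariskiOpen {n : ℕ} (U : Set (SymSpace n)) : Prop :=
  ∃ S : Set (MvPolynomial (Fin n × Fin n) ℝ),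
    Uᶜ = {X | ∀ p ∈ S, MvPolynomial.eval (fun ij : Fin n × Fin n => X.1 ij.1 ij.2) p = 0}

/-- All complex eigenvalues of `g` are positive real numbers. -/
def HasPositiveEigenvalues {n : ℕ} (g : SpecialLinearGroup (Fin n) ℝ) : Prop :=
  ∀ z ∈ spectrum ℂ ((g : Matrix (Fin n) (Fin n) ℝ).map (fun x : ℝ => (x : ℂ))),
    ∃ r : ℝ, 0 < r ∧ z = (r : ℂ)

/-- `Γ` is generated by matrices with exclusively positive eigenvalues. -/
def GeneratedByPositive {n : ℕ} (Γ : Subgroup (SpecialLinearGroup (Fin n) ℝ)) : Prop :=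
  ∃ S : Set (SpecialLinearGroup (Fin n) ℝ),
    (∀ g ∈ S, HasPositiveEigenvalues g) ∧ Subgroup.closure S = Γ

/-- `G` is a free abelian group. -/
def IsFreeAbelian (G : Type) [Group G] : Prop :=
  ∃ ι : Type, Nonempty (Additive G ≃+ FreeAbelianGroup ι)

/-- `Γ` is generated by two elements, but not by fewer. -/
def IsTwoGenerated {G : Type*} [Group G] (Γ : Subgroup G) : Prop :=
  (∃ a b : G, Γ = Subgroup.closure {a, b}) ∧ ¬ IsCyclic Γ

/-- Some conjugate of `Γ` in `SL(3, ℝ)` is the subgroup generated by the (determinant one)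
matrices in `S`. -/
def IsConjugateToSpan (Γ : Subgroup SL(3, ℝ)) (S : Set (Matrix (Fin 3) (Fin 3) ℝ)) : Prop :=
  ∃ g : SL(3, ℝ), Γ.map (MulAut.conj g).toMonoidHom =
    Subgroup.closure {γ : SL(3, ℝ) | (γ : Matrix (Fin 3) (Fin 3) ℝ) ∈ S}

/-- The diagonal matrix `diag(e^r, e^s, e^t)`. -/
noncomputable def expDiag (r s t : ℝ) : Matrix (Fin 3) (Fin 3) ℝ :=
  !![Real.exp r, 0, 0; 0, Real.exp s, 0; 0, 0, Real.exp t]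

/-- The matrix with upper left block `(e^t, a; 0, e^t)` and last diagonal entry `e^{-2t}`. -/
noncomputable def expBlock (t a : ℝ) : Matrix (Fin 3) (Fin 3) ℝ :=
  !![Real.exp t, a, 0; 0, Real.exp t, 0; 0, 0, Real.exp (-2 * t)]

/-- Cyclic groups of type (1). -/
def CyclicType1 (Γ : Subgroup SL(3, ℝ)) : Prop :=
  IsConjugateToSpan Γ {!![1, 1, 0; 0, 1, 0; 0, 0, 1]}

/-- Cyclic groups of type (2). -/
def CyclicType2 (Γ : Subgroup SL(3, ℝ)) : Prop :=
  IsConjugateToSpan Γ {!![1, 1, 0; 0, 1, 1; 0, 0, 1]}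

/-- Cyclic groups of type (3). -/
def CyclicType3 (Γ : Subgroup SL(3, ℝ)) : Prop :=
  ∃ r s t : ℝ, r + s + t = 0 ∧ r ≠ 0 ∧ s ≠ 0 ∧ t ≠ 0 ∧
    IsConjugateToSpan Γ {expDiag r s t}

/-- Cyclic groups of type (3'). -/
def CyclicType3' (Γ : Subgroup SL(3, ℝ)) : Prop :=
  ∃ s : ℝ, s ≠ 0 ∧ IsConjugateToSpan Γ {expDiag s (-s) 0}

/-- Cyclic groups of type (4). -/
def CyclicType4 (Γ : Subgroup SL(3, ℝ)) : Prop :=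
  ∃ t : ℝ, t ≠ 0 ∧ IsConjugateToSpan Γ {expBlock t 1}

/-- `2`-generated groups of type (1). -/
def TwoGenType1 (Γ : Subgroup SL(3, ℝ)) : Prop :=
  IsConjugateToSpan Γ
    {!![1, 1, 0; 0, 1, 0; 0, 0, 1], !![1, 0, 1; 0, 1, 0; 0, 0, 1]}

/-- `2`-generated groups of type (1'). -/
def TwoGenType1' (Γ : Subgroup SL(3, ℝ)) : Prop :=
  IsConjugateToSpan Γ
    {!![1, 0, 0; 0, 1, 1; 0, 0, 1], !![1, 0, 1; 0, 1, 0; 0, 0, 1]}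

/-- `2`-generated groups of type (2). -/
def TwoGenType2 (Γ : Subgroup SL(3, ℝ)) : Prop :=
  ∃ a b : ℝ, b ≠ a * (a - 1) / 2 ∧
    IsConjugateToSpan Γ
      {!![1, 1, 0; 0, 1, 1; 0, 0, 1], !![1, a, b; 0, 1, a; 0, 0, 1]}

/-- `2`-generated groups of type (3). -/
def TwoGenType3 (Γ : Subgroup SL(3, ℝ)) : Prop :=
  ∃ r s t r' s' t' : ℝ, r + s + t = 0 ∧ r' + s' + t' = 0 ∧
    IsConjugateToSpan Γ {expDiag r s t, expDiag r' s' t'}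

/-- `2`-generated groups of type (4). -/
def TwoGenType4 (Γ : Subgroup SL(3, ℝ)) : Prop :=
  ∃ s t a : ℝ, (s, t) ≠ (0, 0) ∧
    IsConjugateToSpan Γ {expBlock t 1, expBlock s a}

end DirichletSelberg

namespace DirichletSelberg

/-! Signs of traces against a fixed matrix do not change under positive scaling, so the problem
lives on the cone of positive definite matrices. With `W = X⁻¹`, and `g` replaced by its inverse,
the domain is cut out by the inequalities `tr(W Y) ≤ tr(g W gᵀ Y)` for `g ∈ Γ`. By the
arithmetic-geometric mean inequality the point `X` is strictly inside every half-space with nonzero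
normal `g W gᵀ - W`. Discreteness makes the hyperplanes locally finite, because `tr(g W gᵀ Y)`
bounds the entries of `g`.

Counting facets then becomes a question about implications between inequalities. If finitely many of
them imply the rest, there are finitely many facets (`finitelySided_of_finite`). Conversely, a point
outside the polyhedron is separated from a generic interior point by a hyperplane carrying a facet
(`mem_of_forall_facet`), so the facets alone cut out the polyhedron; if no finite set of
inequalities suffices, there are infinitely many facets (`infinitelySided_of_forall_finite`). The
properties `FinitelyCut` and `InfinitelyCut` pass through conjugation at the cost of changing `W`,
so `Γ` may be taken in normal form, as the image of a subgroup of `ℝ²` under an explicit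
homomorphism into `SL(3, ℝ)`.

Finite types. For diagonal and block groups, the inequality of one element that contracts some
directions strongly bounds the part of `Y` in those directions by the complementary part; any
element that stretches the complementary part enough then satisfies its own inequality
(`exists_domination`). Type (3') escapes this argument because one weight is zero. For row
unipotents the inequality is a quadratic polynomial in the parameters, whose quadratic part is a
fixed definite form times `Y 0 0`, so the inequality of a large element follows from those of its
two halves.

Infinite types. A triangular decomposition of `Y` gives enough freedom to prescribe `v ↦ tr(r(v) W
r(v)ᵀ Y) - tr(W Y)` within a suitable family. One arranges that it vanishes at the identity and at
one chosen element and is positive at all others, for infinitely many choices of that element. If a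
two-generated group has dense first coordinates, one instead makes the function positive on a given
finite set and negative at an element with tiny first coordinate (`exists_small_fst`). Types (3')
and two-generated (4) need `W 0 2` or `W 1 2` to be nonzero; this is the source of the dense Zariski
open set. -/

/-- Real `3 × 3` matrices. -/
abbrev Mat3 : Type := Matrix (Fin 3) (Fin 3) ℝ

/-! ### Positive definite matrices: openness, traces of products, arithmetic-geometric mean -/

section PositiveDefinite

theorem posDef_iff_isSymm {M : Mat3} :
    M.PosDef ↔ M.IsSymm ∧ ∀ x : Fin 3 → ℝ, x ≠ 0 → 0 < x ⬝ᵥ (M *ᵥ x) := by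
  rw [Matrix.posDef_iff_dotProduct_mulVec]
  simp [Matrix.IsHermitian, Matrix.IsSymm]

theorem _root_.Matrix.PosDef.isSymm {M : Mat3} (h : M.PosDef) : M.IsSymm :=
  (posDef_iff_isSymm.1 h).1

theorem posDef_of_sphere {M : Mat3} (hM : M.IsSymm)
    (h : ∀ x ∈ Metric.sphere (0 : Fin 3 → ℝ) 1, 0 < x ⬝ᵥ (M *ᵥ x)) : M.PosDef := by
  refine posDef_iff_isSymm.2 ⟨hM, fun x hx => ?_⟩
  have hn : 0 < ‖x‖ := norm_pos_iff.2 hx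
  have h1 := h (‖x‖⁻¹ • x) (by simp [norm_smul, hn.ne'])
  rw [Matrix.mulVec_smul, dotProduct_smul, smul_dotProduct, smul_eq_mul, smul_eq_mul] at h1
  have h2 : 0 < ‖x‖⁻¹ := inv_pos.2 hn
  exact (mul_pos_iff_of_pos_left h2).1 ((mul_pos_iff_of_pos_left h2).1 h1)

/-- Positive definiteness is an open condition on symmetric matrices, with a locally uniform lower
bound. -/
theorem exists_eventually_posDef_sub {M : Mat3} (hM : M.PosDef) :
    ∃ c : ℝ, 0 < c ∧ ∀ᶠ N in 𝓝 M, N.IsSymm → (N - c • (1 : Mat3)).PosDef := by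
  have hq := (posDef_iff_isSymm.1 hM).2
  have hK : IsCompact (Metric.sphere (0 : Fin 3 → ℝ) 1) := isCompact_sphere _ _
  have hne : (Metric.sphere (0 : Fin 3 → ℝ) 1).Nonempty :=
    NormedSpace.sphere_nonempty.2 zero_le_one
  have hc : Continuous fun x : Fin 3 → ℝ => x ⬝ᵥ (M *ᵥ x) := by fun_prop
  obtain ⟨x0, hx0, hmin⟩ := hK.exists_isMinOn hne hc.continuousOn
  have hx0' : x0 ≠ 0 := by
    rintro rfl; simp at hx0
  have hm := hq x0 hx0'
  set m := x0 ⬝ᵥ (M *ᵥ x0) with hmdef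
  -- The sphere is that of the sup norm, so `x ⬝ᵥ x ≤ 3` there, and subtracting `m / 6` times the
  -- identity still leaves at least `m / 2`.
  refine ⟨m / 6, by positivity, ?_⟩
  have key : ∀ᶠ N in 𝓝 M, ∀ x ∈ Metric.sphere (0 : Fin 3 → ℝ) 1,
      0 < x ⬝ᵥ ((N - (m / 6) • (1 : Mat3)) *ᵥ x) := by
    refine hK.eventually_forall_of_forall_eventually fun x hx => ?_
    have hcont : Continuous fun z : Mat3 × (Fin 3 → ℝ) =>
        z.2 ⬝ᵥ ((z.1 - (m / 6) • (1 : Mat3)) *ᵥ z.2) := by fun_prop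
    refine hcont.continuousAt.eventually (lt_mem_nhds ?_)
    have h1 : m ≤ x ⬝ᵥ (M *ᵥ x) := hmin hx
    have h2 : x ⬝ᵥ x ≤ 3 := by
      have hx1 : ‖x‖ = 1 := by simpa using hx
      have hi : ∀ i, x i * x i ≤ 1 := fun i => by
        have := norm_le_pi_norm x i
        rw [hx1, Real.norm_eq_abs] at this
        nlinarith [abs_mul_abs_self (x i), abs_nonneg (x i)]
      rw [dotProduct, Fin.sum_univ_three]
      linarith [hi 0, hi 1, hi 2]
    change 0 < x ⬝ᵥ ((M - (m / 6) • (1 : Mat3)) *ᵥ x)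
    rw [Matrix.sub_mulVec, dotProduct_sub, Matrix.smul_mulVec, Matrix.one_mulVec, dotProduct_smul,
      smul_eq_mul]
    nlinarith
  filter_upwards [key] with N hN hs
  exact posDef_of_sphere (hs.sub (by simp [Matrix.IsSymm])) hN

theorem eventually_posDef {α : Type*} {l : Filter α} {F : α → Mat3} {M : Mat3} (hM : M.PosDef)
    (hF : Filter.Tendsto F l (𝓝 M)) (hs : ∀ᶠ a in l, (F a).IsSymm) : ∀ᶠ a in l, (F a).PosDef := by
  obtain ⟨c, hc, h⟩ := exists_eventually_posDef_sub hM
  filter_upwards [hF.eventually h, hs] with a ha hsa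
  have := (ha hsa).add (Matrix.PosDef.one.smul hc)
  simpa using this

theorem exists_posDef_sub {M : Mat3} (hM : M.PosDef) :
    ∃ c : ℝ, 0 < c ∧ (M - c • (1 : Mat3)).PosDef := by
  obtain ⟨c, hc, h⟩ := exists_eventually_posDef_sub hM
  exact ⟨c, hc, h.self_of_nhds hM.isSymm⟩

/-- For small `e > 0` the matrix `1 - e • M` is still positive definite; divide by `e`. -/
theorem exists_sub_posDef {M : Mat3} (hM : M.IsSymm) :
    ∃ C : ℝ, 0 < C ∧ (C • (1 : Mat3) - M).PosDef := by
  have ht : Filter.Tendsto (fun e : ℝ => (1 : Mat3) - e • M) (𝓝[>] 0) (𝓝 1) := by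
    have : Continuous fun e : ℝ => (1 : Mat3) - e • M := by fun_prop
    have h := this.tendsto 0
    simp only [zero_smul, sub_zero] at h
    exact h.mono_left nhdsWithin_le_nhds
  have h := eventually_posDef Matrix.PosDef.one ht
    (Filter.Eventually.of_forall fun e => by simp [Matrix.IsSymm, hM.eq])
  obtain ⟨e, he, hpos⟩ := (h.and self_mem_nhdsWithin).exists
  have hpos : 0 < e := hpos
  refine ⟨e⁻¹, inv_pos.2 hpos, ?_⟩
  have := he.smul (inv_pos.2 hpos)
  rwa [smul_sub, smul_smul, inv_mul_cancel₀ hpos.ne', one_smul] at this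

theorem exists_eq_transpose_mul_self {M : Mat3} (hM : M.PosSemidef) : ∃ B : Mat3, M = Bᵀ * B := by
  open scoped MatrixOrder in
  obtain ⟨B, hB⟩ := CStarAlgebra.nonneg_iff_eq_star_mul_self.mp hM.nonneg
  exact ⟨B, by simpa [Matrix.star_eq_conjTranspose] using hB⟩

theorem trace_mul_nonneg {P Q : Mat3} (hP : P.PosSemidef) (hQ : Q.PosSemidef) :
    0 ≤ (P * Q).trace := by
  obtain ⟨B, rfl⟩ := exists_eq_transpose_mul_self hP
  have := (hQ.mul_mul_conjTranspose_same B).trace_nonneg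
  rw [Matrix.conjTranspose_eq_transpose_of_trivial] at this
  rwa [Matrix.mul_assoc, Matrix.trace_mul_comm]

/-- The arithmetic-geometric mean inequality for a positive definite matrix of determinant one,
with its equality case. -/
theorem three_le_trace {M : Mat3} (hM : M.PosDef) (hdet : M.det = 1) :
    3 ≤ M.trace ∧ (M.trace = 3 → M = 1) := by
  have hH := hM.isHermitian
  have hpos := hM.eigenvalues_pos
  have htr : M.trace = hH.eigenvalues 0 + hH.eigenvalues 1 + hH.eigenvalues 2 := by
    have := hH.trace_eq_sum_eigenvalues
    simpa [Fin.sum_univ_three] using this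
  have hd : hH.eigenvalues 0 * hH.eigenvalues 1 * hH.eigenvalues 2 = 1 := by
    have := hH.det_eq_prod_eigenvalues
    rw [hdet] at this
    simpa [Fin.prod_univ_three] using this.symm
  -- The logarithms of the eigenvalues sum to zero, so summing `log x ≤ x - 1`, strict unless `x =
  -- 1`, gives both claims.
  have hl := Real.log_mul (mul_pos (hpos 0) (hpos 1)).ne' (hpos 2).ne'
  rw [hd, Real.log_mul (hpos 0).ne' (hpos 1).ne', Real.log_one] at hl
  have h0 := Real.log_le_sub_one_of_pos (hpos 0)
  have h1 := Real.log_le_sub_one_of_pos (hpos 1)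
  have h2 := Real.log_le_sub_one_of_pos (hpos 2)
  refine ⟨by rw [htr]; linarith, fun h3 => ?_⟩
  rw [htr] at h3
  have he : ∀ i, hH.eigenvalues i = 1 := by
    intro i
    by_contra hne
    have := Real.log_lt_sub_one_of_pos (hpos i) hne
    fin_cases i <;> simp at this <;> linarith
  rw [hH.spectral_theorem]
  have : (Matrix.diagonal ((RCLike.ofReal : ℝ → ℝ) ∘ hH.eigenvalues) : Mat3) = 1 := by
    rw [← Matrix.diagonal_one]
    congr 1
    funext i
    simp [he i]
  rw [this, map_one]

end PositiveDefinite

/-! ### Passing between the cone of positive definite matrices and its determinant-one slice -/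

section Projection

/-- The point of `𝒫(3)` on the ray through a positive definite matrix (and the identity matrix
for other arguments). -/
noncomputable def rayPoint (M : Mat3) : SymSpace 3 :=
  open Classical in
  if h : M.PosDef then
    ⟨(M.det ^ (-(1 / 3) : ℝ)) • M, h.smul (Real.rpow_pos_of_pos h.det_pos _), by
      rw [Matrix.det_smul, Fintype.card_fin, ← Real.rpow_natCast, ← Real.rpow_mul h.det_pos.le]
      norm_num [Real.rpow_neg_one, h.det_pos.ne']⟩
  else ⟨1, Matrix.PosDef.one, Matrix.det_one⟩

theorem rayPoint_coe {M : Mat3} (h : M.PosDef) :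
    (rayPoint M).1 = (M.det ^ (-(1 / 3) : ℝ)) • M := by
  simp [rayPoint, h]

theorem exists_rayPoint_eq {M : Mat3} (h : M.PosDef) :
    ∃ c : ℝ, 0 < c ∧ (rayPoint M).1 = c • M :=
  ⟨_, Real.rpow_pos_of_pos h.det_pos _, rayPoint_coe h⟩

theorem rayPoint_self (Y : SymSpace 3) : rayPoint Y.1 = Y := by
  apply Subtype.ext
  rw [rayPoint_coe Y.2.1, Y.2.2]
  simp

theorem tendsto_rayPoint {α : Type*} {l : Filter α} {F : α → Mat3} {M : Mat3} (hM : M.PosDef)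
    (hF : Filter.Tendsto F l (𝓝 M)) (hs : ∀ᶠ a in l, (F a).IsSymm) :
    Filter.Tendsto (fun a => rayPoint (F a)) l (𝓝 (rayPoint M)) := by
  rw [tendsto_subtype_rng, rayPoint_coe hM]
  have hev := eventually_posDef hM hF hs
  have hdet : Filter.Tendsto (fun a => (F a).det) l (𝓝 M.det) :=
    ((continuous_id.matrix_det).tendsto M).comp hF
  have := ((hdet.rpow_const (p := (-(1 / 3) : ℝ)) (Or.inl hM.det_pos.ne')).smul hF)
  refine this.congr' ?_
  filter_upwards [hev] with a ha
  rw [rayPoint_coe ha]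

theorem trace_rayPoint_pos {A M : Mat3} (h : M.PosDef) :
    0 < (A * (rayPoint M).1).trace ↔ 0 < (A * M).trace := by
  obtain ⟨c, hc, he⟩ := exists_rayPoint_eq h
  rw [he, Matrix.mul_smul, Matrix.trace_smul, smul_eq_mul, mul_pos_iff_of_pos_left hc]

theorem trace_rayPoint_eq_zero {A M : Mat3} (h : M.PosDef) :
    (A * (rayPoint M).1).trace = 0 ↔ (A * M).trace = 0 := by
  obtain ⟨c, hc, he⟩ := exists_rayPoint_eq h
  rw [he, Matrix.mul_smul, Matrix.trace_smul, smul_eq_mul, mul_eq_zero, or_iff_right hc.ne']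

theorem trace_rayPoint_nonneg {A M : Mat3} (h : M.PosDef) :
    0 ≤ (A * (rayPoint M).1).trace ↔ 0 ≤ (A * M).trace := by
  obtain ⟨c, hc, he⟩ := exists_rayPoint_eq h
  rw [he, Matrix.mul_smul, Matrix.trace_smul, smul_eq_mul, mul_nonneg_iff_of_pos_left hc]

theorem continuous_trace_mul (A : Mat3) : Continuous fun Y : SymSpace 3 => (A * Y.1).trace := by
  fun_prop

/-- At determinant one, positive definite and positive semidefinite agree, and the latter is a
closed condition. Local compactness of `𝒫(3)` follows. -/
theorem isClosed_posDef_det : IsClosed {X : Mat3 | X.PosDef ∧ X.det = 1} := by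
  have : {X : Mat3 | X.PosDef ∧ X.det = 1} =
      {X : Mat3 | Xᵀ = X} ∩ (⋂ x : Fin 3 → ℝ, {X : Mat3 | 0 ≤ x ⬝ᵥ (X *ᵥ x)}) ∩
        {X : Mat3 | X.det = 1} := by
    ext X
    simp only [Set.mem_inter_iff, Set.mem_ofPred_eq, Set.mem_iInter]
    constructor
    · rintro ⟨h, hd⟩
      exact ⟨⟨h.isSymm, fun x => by simpa using h.posSemidef.dotProduct_mulVec_nonneg x⟩, hd⟩
    · rintro ⟨⟨hs, hx⟩, hd⟩
      refine ⟨?_, hd⟩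
      have : X.PosSemidef := .of_dotProduct_mulVec_nonneg (by simpa [Matrix.IsHermitian] using hs)
        (by simpa using hx)
      exact this.posDef_iff_det_ne_zero.2 (by simp [hd])
  rw [this]
  refine ((isClosed_eq (by fun_prop) (by fun_prop)).inter
    (isClosed_iInter fun x => isClosed_le (by fun_prop) (by fun_prop))).inter
    (isClosed_eq (by fun_prop) (by fun_prop))

instance : LocallyCompactSpace (SymSpace 3) := by
  have : LocallyCompactSpace Mat3 := inferInstanceAs (LocallyCompactSpace (Fin 3 → Fin 3 → ℝ))
  exact isClosed_posDef_det.isClosedEmbedding_subtypeVal.locallyCompactSpace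

end Projection

end DirichletSelberg

namespace DirichletSelberg

/-! ### Facets of locally finite intersections of half-spaces -/

section Polyhedra

theorem mem_biInter_halfSpace {𝒜 : Set Mat3} {Y : SymSpace 3} :
    (Y ∈ ⋂ A ∈ 𝒜, halfSpace A) ↔ ∀ A ∈ 𝒜, 0 ≤ (A * Y.1).trace := by
  simp [halfSpace]

theorem isClosed_biInter_halfSpace (𝒜 : Set Mat3) :
    IsClosed (⋂ A ∈ 𝒜, halfSpace A : Set (SymSpace 3)) :=
  isClosed_biInter fun A _ => isClosed_le continuous_const (continuous_trace_mul A)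

theorem locallyFinite_normalSpace_iff {𝒜 : Set Mat3} :
    LocallyFinite (fun A : 𝒜 => normalSpace (A : Mat3)) ↔
      ∀ Y : SymSpace 3, ∃ t ∈ 𝓝 Y, {A ∈ 𝒜 | (normalSpace A ∩ t).Nonempty}.Finite := by
  refine forall_congr' fun Y => exists_congr fun t => and_congr_right fun _ => ?_
  rw [← Set.finite_image_iff (Subtype.val_injective.injOn)]
  refine iff_of_eq (congrArg _ ?_)
  ext A
  simp only [Set.mem_image, Subtype.exists, Set.mem_ofPred_eq]
  constructor
  · rintro ⟨B, hB, h, rfl⟩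
    exact ⟨hB, h⟩
  · rintro ⟨hA, h⟩
    exact ⟨A, hA, h, rfl⟩

/-- Nearby points are joined to the base point by segments that stay nearby. -/
theorem eventually_segment_mem {Z : SymSpace 3} {t : Set (SymSpace 3)} (ht : t ∈ 𝓝 Z) :
    ∀ᶠ Z' : SymSpace 3 in 𝓝 Z, ∀ s ∈ Set.Icc (0 : ℝ) 1,
      rayPoint ((1 - s) • Z.1 + s • Z'.1) ∈ t := by
  refine isCompact_Icc.eventually_forall_of_forall_eventually fun s _ => ?_
  have hc : Continuous fun z : SymSpace 3 × ℝ => (1 - z.2) • Z.1 + z.2 • z.1.1 := by fun_prop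
  have h1 := hc.tendsto (Z, s)
  simp only at h1
  rw [← add_smul, sub_add_cancel, one_smul] at h1
  have h2 := tendsto_rayPoint Z.2.1 h1 (Filter.Eventually.of_forall fun z => by
    have h3 := Z.2.1.isSymm.eq
    have h4 := z.1.2.1.isSymm.eq
    simp [Matrix.IsSymm, h3, h4])
  rw [rayPoint_self] at h2
  exact h2.eventually ht

theorem posDef_segment {Y Z : Mat3} (hY : Y.PosDef) (hZ : Z.PosDef) {s : ℝ}
    (hs : s ∈ Set.Icc (0 : ℝ) 1) : ((1 - s) • Y + s • Z).PosDef := by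
  rcases eq_or_lt_of_le hs.1 with rfl | h0
  · simpa using hY
  · exact Matrix.PosDef.posSemidef_add (hY.posSemidef.smul (sub_nonneg.2 hs.2)) (hZ.smul h0)

/-- Only finitely many hyperplanes meet a small neighbourhood of `Z`, and their strict inequalities
persist nearby. Any other inequality that failed at a nearby point would make its hyperplane cross
the short segment from `Z`, hence meet the neighbourhood after all. -/
theorem isOpen_forall_trace_pos {𝒜 : Set Mat3}
    (hlf : LocallyFinite (fun A : 𝒜 => normalSpace (A : Mat3))) :
    IsOpen {Z : SymSpace 3 | ∀ A ∈ 𝒜, 0 < (A * Z.1).trace} := by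
  rw [isOpen_iff_mem_nhds]
  intro Z hZ
  obtain ⟨t, ht, hfin⟩ := locallyFinite_normalSpace_iff.1 hlf Z
  have h1 : ∀ᶠ Z' : SymSpace 3 in 𝓝 Z,
      ∀ A ∈ {A ∈ 𝒜 | (normalSpace A ∩ t).Nonempty}, 0 < (A * Z'.1).trace :=
    (Filter.eventually_all_finite hfin).2 fun A hA =>
      (continuous_trace_mul A).continuousAt.eventually (lt_mem_nhds (hZ A hA.1))
  filter_upwards [h1, eventually_segment_mem ht] with Z' h1 h2 A hA
  by_contra hneg
  rw [not_lt] at hneg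
  have hA0 := hZ A hA
  set a := (A * Z.1).trace
  set b := (A * Z'.1).trace with hb
  have hab : 0 < a - b := by linarith
  -- The parameter at which the trace, affine along the segment with end values `a` and `b`,
  -- vanishes.
  have hs : a / (a - b) ∈ Set.Icc (0 : ℝ) 1 :=
    ⟨by positivity, by rw [div_le_one hab]; linarith⟩
  have hmem : rayPoint ((1 - a / (a - b)) • Z.1 + (a / (a - b)) • Z'.1) ∈ normalSpace A := by
    change (A * _).trace = 0
    rw [trace_rayPoint_eq_zero (posDef_segment Z.2.1 Z'.2.1 hs), Matrix.mul_add, Matrix.trace_add,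
      Matrix.mul_smul, Matrix.mul_smul, Matrix.trace_smul, Matrix.trace_smul]
    change (1 - a / (a - b)) * a + a / (a - b) * b = 0
    field_simp
    ring
  have := h1 A ⟨hA, _, hmem, h2 _ hs⟩
  linarith

/-- This is the squared Frobenius norm. It makes `A` itself a direction that leaves the hyperplane
`A^⊥`. -/
theorem trace_self_pos {A : Mat3} (hs : A.IsSymm) (h0 : A ≠ 0) : 0 < (A * A).trace := by
  have h : (Aᴴ * A).trace ≠ 0 := fun h => h0 (Matrix.trace_conjTranspose_mul_self_eq_zero_iff.1 h)
  have h1 := (Matrix.posSemidef_conjTranspose_mul_self A).trace_nonneg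
  rw [Matrix.conjTranspose_eq_transpose_of_trivial, hs.eq] at h h1
  exact lt_of_le_of_ne h1 h.symm

/-- Points of `𝒫(3)` obtained by moving along a symmetric matrix. -/
theorem tendsto_rayPoint_add_smul (Y : SymSpace 3) {A : Mat3} (hA : A.IsSymm) :
    Filter.Tendsto (fun e : ℝ => rayPoint (Y.1 + e • A)) (𝓝 0) (𝓝 Y) ∧
      ∀ᶠ e : ℝ in 𝓝 0, (Y.1 + e • A).PosDef := by
  have hc : Continuous fun e : ℝ => Y.1 + e • A := by fun_prop
  have h1 := hc.tendsto 0
  simp only [zero_smul, add_zero] at h1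
  have hs : ∀ᶠ e : ℝ in 𝓝 0, (Y.1 + e • A).IsSymm := Filter.Eventually.of_forall fun e => by
    simp [Matrix.IsSymm, hA.eq, Y.2.1.isSymm.eq]
  have h2 := tendsto_rayPoint Y.2.1 h1 hs
  rw [rayPoint_self] at h2
  exact ⟨h2, eventually_posDef Y.2.1 h1 hs⟩

theorem dense_trace_ne_zero {A : Mat3} (hs : A.IsSymm) (h0 : A ≠ 0) :
    Dense {Y : SymSpace 3 | (A * Y.1).trace ≠ 0} := by
  intro Y
  by_cases hY : (A * Y.1).trace = 0
  · obtain ⟨h1, h2⟩ := tendsto_rayPoint_add_smul Y hs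
    refine mem_closure_of_tendsto (h1.mono_left (nhdsWithin_le_nhds (s := {0}ᶜ))) ?_
    filter_upwards [h2.filter_mono nhdsWithin_le_nhds, self_mem_nhdsWithin] with e he hne
    have hne : e ≠ 0 := hne
    change (A * _).trace ≠ 0
    rw [Ne, trace_rayPoint_eq_zero he, Matrix.mul_add, Matrix.trace_add, hY, Matrix.mul_smul,
      Matrix.trace_smul, zero_add, smul_eq_mul]
    exact mul_ne_zero hne (trace_self_pos hs h0).ne'
  · exact subset_closure hY

theorem inter_normalSpace_subset_frontier {𝒜 : Set Mat3} {A : Mat3} (hA : A ∈ 𝒜)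
    (hs : A.IsSymm) (h0 : A ≠ 0) :
    (⋂ B ∈ 𝒜, halfSpace B : Set (SymSpace 3)) ∩ normalSpace A ⊆
      frontier (⋂ B ∈ 𝒜, halfSpace B) := by
  rintro Y ⟨hY, hYA⟩
  refine ⟨subset_closure hY, fun hint => ?_⟩
  have hP := mem_interior_iff_mem_nhds.1 hint
  obtain ⟨h1, h2⟩ := tendsto_rayPoint_add_smul Y hs
  have h3 := (h1.mono_left (nhdsWithin_le_nhds (s := Set.Iio 0))).eventually hP
  obtain ⟨e, ⟨he1, he2⟩, he3⟩ :=
    ((h3.and (h2.filter_mono nhdsWithin_le_nhds)).and self_mem_nhdsWithin).exists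
  have he3 : e < 0 := he3
  have h4 := mem_biInter_halfSpace.1 he1 A hA
  have hYA : (A * Y.1).trace = 0 := hYA
  rw [trace_rayPoint_nonneg he2, Matrix.mul_add, Matrix.trace_add, hYA, Matrix.mul_smul,
      Matrix.trace_smul, zero_add, smul_eq_mul] at h4
  nlinarith [trace_self_pos hs h0]

theorem IsNormalVector.neg {A : Mat3} (hA : IsNormalVector A) : IsNormalVector (-A) := by
  obtain ⟨h1, h2, Y, hY⟩ := hA
  refine ⟨by simp [Matrix.IsSymm, h1.eq], neg_ne_zero.2 h2, Y, ?_⟩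
  have hY : (A * Y.1).trace = 0 := hY
  simp [normalSpace, hY]

theorem isConvexPolyhedron_inter_normalSpace {𝒜 : Set Mat3} (hn : ∀ A ∈ 𝒜, IsNormalVector A)
    (hlf : LocallyFinite (fun A : 𝒜 => normalSpace (A : Mat3))) {A : Mat3}
    (hA : IsNormalVector A) :
    IsConvexPolyhedron ((⋂ B ∈ 𝒜, halfSpace B : Set (SymSpace 3)) ∩ normalSpace A) := by
  refine ⟨𝒜 ∪ {A, -A}, ?_, ?_, ?_⟩
  · rintro B (hB | rfl | rfl)
    exacts [hn B hB, hA, hA.neg]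
  · rw [locallyFinite_normalSpace_iff] at hlf ⊢
    intro Y
    obtain ⟨t, ht, hfin⟩ := hlf Y
    refine ⟨t, ht, (hfin.union (Set.toFinite {A, -A})).subset ?_⟩
    rintro B ⟨hB | hB, h⟩
    exacts [Or.inl ⟨hB, h⟩, Or.inr hB]
  · ext Y
    rw [mem_biInter_halfSpace, Set.mem_inter_iff, mem_biInter_halfSpace]
    constructor
    · rintro ⟨h1, h2⟩ B (hB | rfl | rfl)
      · exact h1 B hB
      · exact (show (B * Y.1).trace = 0 from h2).ge
      · have : (A * Y.1).trace = 0 := h2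
        simp [this]
    · intro h
      refine ⟨fun B hB => h B (Or.inl hB), ?_⟩
      have h1 := h A (Or.inr (Or.inl rfl))
      have h2 := h (-A) (Or.inr (Or.inr rfl))
      simp only [Matrix.neg_mul, Matrix.trace_neg] at h2
      exact le_antisymm (by linarith) h1

theorem IsConvexPolyhedron.rayPoint_add_mem {P : Set (SymSpace 3)} (hP : IsConvexPolyhedron P)
    {Y Z : SymSpace 3} (hY : Y ∈ P) (hZ : Z ∈ P) {t : ℝ} (ht : 0 < t) :
    rayPoint (Y.1 + t • Z.1) ∈ P := by
  obtain ⟨𝒜, -, -, rfl⟩ := hP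
  rw [mem_biInter_halfSpace] at *
  intro A hA
  rw [trace_rayPoint_nonneg (Y.2.1.add (Z.2.1.smul ht)), Matrix.mul_add, Matrix.trace_add,
    Matrix.mul_smul, Matrix.trace_smul, smul_eq_mul]
  have := hY A hA
  have := hZ A hA
  positivity

/-- A convex polyhedron covered by finitely many hyperplanes lies in one of them. -/
theorem IsConvexPolyhedron.exists_subset_normalSpace {F : Set (SymSpace 3)}
    (hF : IsConvexPolyhedron F) (hne : F.Nonempty) {𝒜 : Set Mat3} (hfin : 𝒜.Finite)
    (hcov : F ⊆ ⋃ A ∈ 𝒜, normalSpace A) : ∃ A ∈ 𝒜, F ⊆ normalSpace A := by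
  by_contra hcon
  push Not at hcon
  suffices h : ∀ 𝒮 : Set Mat3, 𝒮.Finite → 𝒮 ⊆ 𝒜 → ∃ Y ∈ F, ∀ A ∈ 𝒮, (A * Y.1).trace ≠ 0 by
    obtain ⟨Y, hY, h⟩ := h 𝒜 hfin subset_rfl
    obtain ⟨A, hA, hYA⟩ := Set.mem_iUnion₂.1 (hcov hY)
    exact h A hA hYA
  intro 𝒮 h𝒮
  induction 𝒮, h𝒮 using Set.Finite.induction_on with
  | empty =>
    intro _
    obtain ⟨Y, hY⟩ := hne
    exact ⟨Y, hY, by simp⟩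
  | @insert A 𝒮 _ h𝒮 ih =>
    intro hsub
    obtain ⟨Y, hY, hY'⟩ := ih ((Set.subset_insert _ _).trans hsub)
    obtain ⟨Z, hZ, hZ'⟩ := Set.not_subset.1 (hcon A (hsub (Set.mem_insert _ _)))
    -- Along `Y + t Z` each trace is affine in `t` and not identically zero: `Y` is off the earlier
    -- hyperplanes and `Z` is off `A^⊥`. So almost every `t > 0` avoids them all.
    have hbad : (⋃ B ∈ insert A 𝒮, {t : ℝ | (B * Y.1).trace + t * (B * Z.1).trace = 0}).Finite := by
      refine (h𝒮.insert A).biUnion fun B hB => Set.Subsingleton.finite fun t ht t' ht' => ?_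
      have ht : (B * Y.1).trace + t * (B * Z.1).trace = 0 := ht
      have ht' : (B * Y.1).trace + t' * (B * Z.1).trace = 0 := ht'
      have hBZ : (B * Z.1).trace ≠ 0 := by
        intro h0
        rcases hB with rfl | hB
        · exact hZ' h0
        · exact hY' B hB (by simpa [h0] using ht)
      have : (t - t') * (B * Z.1).trace = 0 := by linarith
      exact sub_eq_zero.1 ((mul_eq_zero.1 this).resolve_right hBZ)
    obtain ⟨t, ht, hgood⟩ := (Set.Ioi_infinite (0 : ℝ)).exists_notMem_finite hbad
    have ht : 0 < t := ht
    refine ⟨_, hF.rayPoint_add_mem hY hZ ht, fun B hB h0 => hgood ?_⟩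
    rw [trace_rayPoint_eq_zero (Y.2.1.add (Z.2.1.smul ht)), Matrix.mul_add, Matrix.trace_add,
      Matrix.mul_smul, Matrix.trace_smul, smul_eq_mul] at h0
    exact Set.mem_iUnion₂.2 ⟨B, hB, h0⟩

/-- A finite intersection of half-spaces is finitely sided. -/
theorem finitelySided_of_finite {𝒜 : Set Mat3} (hfin : 𝒜.Finite)
    (hn : ∀ A ∈ 𝒜, IsNormalVector A) :
    FinitelySided (⋂ A ∈ 𝒜, halfSpace A : Set (SymSpace 3)) := by
  have hlf : LocallyFinite (fun A : 𝒜 => (normalSpace (A : Mat3) : Set (SymSpace 3))) :=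
    locallyFinite_normalSpace_iff.2 fun Y => ⟨Set.univ, Filter.univ_mem, hfin.subset fun A h => h.1⟩
  set P : Set (SymSpace 3) := ⋂ A ∈ 𝒜, halfSpace A with hP
  have hcl : IsClosed P := isClosed_biInter_halfSpace 𝒜
  refine ⟨⟨𝒜, hn, hlf, rfl⟩, (hfin.image fun A => P ∩ normalSpace A).subset ?_⟩
  rintro F ⟨⟨hne, hfr, hpoly⟩, hmax⟩
  -- A point of the polyhedron on no hyperplane is interior, so the boundary is covered by the
  -- hyperplanes.
  have hcov : F ⊆ ⋃ A ∈ 𝒜, normalSpace A := by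
    intro Y hY
    obtain ⟨h1, h2⟩ := hfr hY
    rw [hcl.closure_eq, hP, mem_biInter_halfSpace] at h1
    by_contra hno
    refine h2 (interior_maximal ?_ (isOpen_forall_trace_pos hlf) ?_)
    · exact fun Z hZ => mem_biInter_halfSpace.2 fun A hA => (hZ A hA).le
    · intro A hA
      exact lt_of_le_of_ne (h1 A hA) fun h0 => hno (Set.mem_iUnion₂.2 ⟨A, hA, h0.symm⟩)
  obtain ⟨A, hA, hFA⟩ := hpoly.exists_subset_normalSpace hne hfin hcov
  have hle : F ⊆ P ∩ normalSpace A :=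
    Set.subset_inter (hfr.trans hcl.frontier_subset) hFA
  refine ⟨A, hA, le_antisymm ?_ hle⟩
  exact hmax ⟨hne.mono hle, inter_normalSpace_subset_frontier hA (hn A hA).1 (hn A hA).2.1,
    isConvexPolyhedron_inter_normalSpace hn hlf (hn A hA)⟩ hle

/-- A face cut out by `A` is a facet if some point of it lies on no hyperplane of the family other
than `A^⊥`. -/
theorem isFacet_inter_normalSpace {𝒜 : Set Mat3} (hn : ∀ A ∈ 𝒜, IsNormalVector A)
    (hlf : LocallyFinite (fun A : 𝒜 => normalSpace (A : Mat3))) {A : Mat3} (hA : A ∈ 𝒜)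
    {Y : SymSpace 3} (hY : Y ∈ ⋂ B ∈ 𝒜, halfSpace B) (hYA : Y ∈ normalSpace A)
    (hun : ∀ B ∈ 𝒜, (B * Y.1).trace = 0 → ∃ c : ℝ, 0 < c ∧ B = c • A) :
    IsFacet (⋂ B ∈ 𝒜, halfSpace B) ((⋂ B ∈ 𝒜, halfSpace B) ∩ normalSpace A) := by
  refine ⟨⟨⟨Y, hY, hYA⟩, inter_normalSpace_subset_frontier hA (hn A hA).1 (hn A hA).2.1,
    isConvexPolyhedron_inter_normalSpace hn hlf (hn A hA)⟩, ?_⟩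
  rintro G ⟨-, hGfr, hG⟩ hle y hy
  have hcl := isClosed_biInter_halfSpace 𝒜
  have hyP := hcl.frontier_subset (hGfr hy)
  refine ⟨hyP, ?_⟩
  rw [mem_biInter_halfSpace] at hY hyP
  by_contra hyA
  have hpos : 0 < (A * y.1).trace := lt_of_le_of_ne (hyP A hA) (Ne.symm hyA)
  -- If `G` left `A^⊥` at `y`, the ray through `Y + y` would lie in `G`, hence in the boundary. But
  -- `Y` makes every inequality strict except those of positive multiples of `A`, and `y` takes care
  -- of these.
  have hmem := hGfr (hG.rayPoint_add_mem (hle ⟨mem_biInter_halfSpace.2 hY, hYA⟩) hy one_pos)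
  refine hmem.2 (interior_maximal ?_ (isOpen_forall_trace_pos hlf) ?_)
  · exact fun Z hZ => mem_biInter_halfSpace.2 fun A hA => (hZ A hA).le
  · intro B hB
    rw [trace_rayPoint_pos (Y.2.1.add (y.2.1.smul one_pos)), one_smul, Matrix.mul_add,
      Matrix.trace_add]
    rcases eq_or_lt_of_le (hY B hB) with h0 | h0
    · obtain ⟨c, hc, rfl⟩ := hun B hB h0.symm
      rw [← h0, zero_add, Matrix.smul_mul, Matrix.trace_smul, smul_eq_mul]
      positivity
    · exact add_pos_of_pos_of_nonneg h0 (hyP B hB)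

/-- A polyhedron with an interior point is cut out by those half-spaces of the family whose
bounding hyperplane has a point on no other hyperplane of the family. -/
theorem mem_of_forall_facet {𝒜 : Set Mat3} (hn : ∀ A ∈ 𝒜, IsNormalVector A)
    (hlf : LocallyFinite (fun A : 𝒜 => normalSpace (A : Mat3))) {p₀ : SymSpace 3}
    (hp₀ : ∀ A ∈ 𝒜, 0 < (A * p₀.1).trace) {Z : SymSpace 3}
    (hZ : ∀ A ∈ 𝒜, (∃ Y ∈ (⋂ B ∈ 𝒜, halfSpace B : Set (SymSpace 3)), Y ∈ normalSpace A ∧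
      ∀ B ∈ 𝒜, (B * Y.1).trace = 0 → ∃ c : ℝ, 0 < c ∧ B = c • A) → 0 ≤ (A * Z.1).trace) :
    Z ∈ ⋂ B ∈ 𝒜, halfSpace B := by
  by_contra hZP
  have hO := isOpen_forall_trace_pos hlf
  -- The segments from a compact neighbourhood of `p₀` to `Z` sweep out a compact set, met by
  -- finitely many hyperplanes. This leaves room to choose a generic starting point `p` among them.
  obtain ⟨K, hK, hKO, hKc⟩ := local_compact_nhds (hO.mem_nhds hp₀)
  have hcomp : IsCompact ((fun z : ℝ × SymSpace 3 =>
      rayPoint ((1 - z.1) • z.2.1 + z.1 • Z.1)) '' (Set.Icc 0 1 ×ˢ K)) := by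
    refine (isCompact_Icc.prod hKc).image_of_continuousOn fun z hz =>
      ContinuousAt.continuousWithinAt ?_
    have hc : Continuous fun z : ℝ × SymSpace 3 => (1 - z.1) • z.2.1 + z.1 • Z.1 := by fun_prop
    refine tendsto_rayPoint (posDef_segment z.2.2.1 Z.2.1 hz.1) (hc.tendsto z)
      (Filter.Eventually.of_forall fun z => ?_)
    have h3 := Z.2.1.isSymm.eq
    have h4 := z.2.2.1.isSymm.eq
    simp [Matrix.IsSymm, h3, h4]
  set C := (fun z : ℝ × SymSpace 3 =>
      rayPoint ((1 - z.1) • z.2.1 + z.1 • Z.1)) '' (Set.Icc 0 1 ×ˢ K)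
  have hfin : {B ∈ 𝒜 | (normalSpace B ∩ C).Nonempty}.Finite := by
    have := (hlf.finite_nonempty_inter_compact hcomp).image Subtype.val
    refine this.subset ?_
    rintro B ⟨hB, h⟩
    exact ⟨⟨B, hB⟩, h, rfl⟩
  set 𝒩 := {B ∈ 𝒜 | (normalSpace B ∩ C).Nonempty} with h𝒩
  -- If the segment from `p` to `Z` meets two hyperplanes at the same point, this combination of
  -- their normals, which kills `Z`, also kills `p`. When the combination is nonzero, a generic `p`
  -- excludes that.
  obtain ⟨p, hpK, hgen⟩ : ∃ p ∈ K, ∀ q ∈ {q ∈ 𝒩 ×ˢ 𝒩 |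
      (q.2 * Z.1).trace • q.1 - (q.1 * Z.1).trace • q.2 ≠ 0},
      (((q.2 * Z.1).trace • q.1 - (q.1 * Z.1).trace • q.2) * p.1).trace ≠ 0 := by
    have hd : Dense (⋂ q ∈ {q ∈ 𝒩 ×ˢ 𝒩 |
        (q.2 * Z.1).trace • q.1 - (q.1 * Z.1).trace • q.2 ≠ 0}, {p : SymSpace 3 |
        (((q.2 * Z.1).trace • q.1 - (q.1 * Z.1).trace • q.2) * p.1).trace ≠ 0}) := by
      refine dense_biInter_of_isOpen (fun q _ => ?_)
        ((hfin.prod hfin).subset fun q h => h.1).countable fun q hq => ?_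
      · exact isOpen_ne_fun (continuous_trace_mul _) continuous_const
      · refine dense_trace_ne_zero ?_ hq.2
        have h1 := (hn _ hq.1.1.1).1.eq
        have h2 := (hn _ hq.1.2.1).1.eq
        simp [Matrix.IsSymm, h1, h2]
    obtain ⟨p, hp, hpK⟩ := hd.inter_nhds_nonempty hK
    exact ⟨p, hpK, fun q hq => Set.mem_iInter₂.1 hp q hq⟩
  have hppos := hKO hpK
  -- every half-space that excludes `Z` has its hyperplane crossed by the segment from `p` to `Z`
  have hcross : ∀ B ∈ 𝒜, (B * Z.1).trace < 0 → B ∈ 𝒩 := by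
    intro B hB hneg
    have hp := hppos B hB
    have hd : 0 < (B * p.1).trace - (B * Z.1).trace := by linarith
    have hs : (B * p.1).trace / ((B * p.1).trace - (B * Z.1).trace) ∈ Set.Icc (0 : ℝ) 1 :=
      ⟨by positivity, by rw [div_le_one hd]; linarith⟩
    refine ⟨hB, _, ?_, ⟨(_, p), ⟨hs, hpK⟩, rfl⟩⟩
    change (B * _).trace = 0
    rw [trace_rayPoint_eq_zero (posDef_segment p.2.1 Z.2.1 hs), Matrix.mul_add, Matrix.trace_add,
      Matrix.mul_smul, Matrix.mul_smul, Matrix.trace_smul, Matrix.trace_smul, smul_eq_mul,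
      smul_eq_mul]
    field_simp
    ring
  have hneg : {B ∈ 𝒜 | (B * Z.1).trace < 0}.Nonempty := by
    rw [mem_biInter_halfSpace] at hZP
    push Not at hZP
    exact hZP
  -- On the ray `p + r Z` the half-space of `B` is left at this ratio. The smallest ratio gives the
  -- exit point from the polyhedron, which by genericity is on one hyperplane only.
  obtain ⟨B, ⟨hB, hBZ⟩, hmin⟩ := Set.exists_min_image {B ∈ 𝒜 | (B * Z.1).trace < 0}
    (fun B => (B * p.1).trace / -(B * Z.1).trace)
    (hfin.subset fun B h => hcross B h.1 h.2) hneg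
  set r := (B * p.1).trace / -(B * Z.1).trace with hr
  have hBp := hppos B hB
  have hr0 : 0 < r := div_pos hBp (by linarith)
  have hMpos := p.2.1.add (Z.2.1.smul hr0)
  have htr : ∀ A : Mat3, (A * (p.1 + r • Z.1)).trace = (A * p.1).trace + r * (A * Z.1).trace := by
    intro A
    rw [Matrix.mul_add, Matrix.trace_add, Matrix.mul_smul, Matrix.trace_smul, smul_eq_mul]
  have hle : ∀ A ∈ 𝒜, 0 ≤ (A * (p.1 + r • Z.1)).trace := by
    intro A hA
    rw [htr]
    have hAp := hppos A hA
    rcases le_or_gt 0 (A * Z.1).trace with h | h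
    · positivity
    · have h1 : r ≤ (A * p.1).trace / -(A * Z.1).trace := hmin A ⟨hA, h⟩
      rw [le_div_iff₀ (by linarith)] at h1
      linarith
  have hBr : r * (B * Z.1).trace = -(B * p.1).trace := by
    rw [hr, div_neg, neg_mul, div_mul_cancel₀ _ hBZ.ne]
  refine absurd (hZ B hB ⟨rayPoint (p.1 + r • Z.1), ?_, ?_, ?_⟩) (not_le.2 hBZ)
  · exact mem_biInter_halfSpace.2 fun A hA => (trace_rayPoint_nonneg hMpos).2 (hle A hA)
  · exact (trace_rayPoint_eq_zero hMpos).2 (by rw [htr, hBr]; ring)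
  · intro A hA h0
    rw [trace_rayPoint_eq_zero hMpos, htr] at h0
    have hAp := hppos A hA
    have hAZ : (A * Z.1).trace < 0 := by
      by_contra h
      rw [not_lt] at h
      have := mul_nonneg hr0.le h
      linarith
    have hD : (B * Z.1).trace • A - (A * Z.1).trace • B = 0 := by
      by_contra hD
      refine hgen (A, B) ⟨⟨hcross A hA hAZ, hcross B hB hBZ⟩, hD⟩ ?_
      simp only [Matrix.sub_mul, Matrix.smul_mul, Matrix.trace_sub, Matrix.trace_smul, smul_eq_mul]
      have h1 : (A * p.1).trace = -(r * (A * Z.1).trace) := by linarith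
      have h2 : (B * p.1).trace = -(r * (B * Z.1).trace) := by linarith
      rw [h1, h2]
      ring
    refine ⟨(A * Z.1).trace / (B * Z.1).trace, div_pos_of_neg_of_neg hAZ hBZ, ?_⟩
    rw [sub_eq_zero] at hD
    rw [div_eq_inv_mul, mul_smul, ← hD, smul_smul, inv_mul_cancel₀ hBZ.ne, one_smul]

/-- A polyhedron with an interior point that is not cut out by finitely many of the half-spaces
defining it is infinitely sided. -/
theorem infinitelySided_of_forall_finite {𝒜 : Set Mat3} (hn : ∀ A ∈ 𝒜, IsNormalVector A)
    (hlf : LocallyFinite (fun A : 𝒜 => normalSpace (A : Mat3))) {p₀ : SymSpace 3}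
    (hp₀ : ∀ A ∈ 𝒜, 0 < (A * p₀.1).trace)
    (hinf : ∀ 𝒮 ⊆ 𝒜, 𝒮.Finite → ∃ Y : SymSpace 3, (∀ A ∈ 𝒮, 0 ≤ (A * Y.1).trace) ∧
      Y ∉ ⋂ B ∈ 𝒜, halfSpace B) :
    InfinitelySided (⋂ B ∈ 𝒜, halfSpace B : Set (SymSpace 3)) := by
  refine ⟨⟨𝒜, hn, hlf, rfl⟩, fun hfin => ?_⟩
  set P : Set (SymSpace 3) := ⋂ B ∈ 𝒜, halfSpace B with hP
  set 𝒢 := {A ∈ 𝒜 | ∃ Y ∈ P, Y ∈ normalSpace A ∧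
      ∀ B ∈ 𝒜, (B * Y.1).trace = 0 → ∃ c : ℝ, 0 < c ∧ B = c • A} with h𝒢
  -- One normal vector for each facet that arises this way. Normals with the same facet are positive
  -- multiples of each other, so these representatives already cut out `P`.
  obtain ⟨𝒮, h𝒮, hbij⟩ := Set.exists_subset_bijOn 𝒢 fun A => P ∩ normalSpace A
  have himg : ((fun A => P ∩ normalSpace A) '' 𝒢).Finite := by
    refine hfin.subset ?_
    rintro _ ⟨A, ⟨hA, Y, hY, hYA, hun⟩, rfl⟩
    exact isFacet_inter_normalSpace hn hlf hA hY hYA hun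
  obtain ⟨Z, hZ, hZP⟩ := hinf 𝒮 (fun A hA => (h𝒮 hA).1) (hbij.finite_iff_finite.2 himg)
  refine hZP (mem_of_forall_facet hn hlf hp₀ fun A hA hex => ?_)
  have hA𝒢 : A ∈ 𝒢 := ⟨hA, hex⟩
  obtain ⟨A', hA', heq⟩ := hbij.surjOn ⟨A, hA𝒢, rfl⟩
  obtain ⟨Y, hY, hYA, hun⟩ := hex
  have hYA' : Y ∈ P ∩ normalSpace A' := by
    have heq : P ∩ normalSpace A' = P ∩ normalSpace A := heq
    rw [heq]
    exact ⟨hY, hYA⟩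
  obtain ⟨c, hc, rfl⟩ := hun A' (h𝒮 hA').1 hYA'.2
  have := hZ _ hA'
  rw [Matrix.smul_mul, Matrix.trace_smul, smul_eq_mul] at this
  exact (mul_nonneg_iff_of_pos_left hc).1 this

end Polyhedra

end DirichletSelberg

namespace DirichletSelberg

/-! ### Dirichlet–Selberg domains as polyhedra, and criteria on orbit traces -/

section Criteria

/-- The trace form `tr(g W gᵀ Y)`, which for `W = X⁻¹` is `s(g⁻¹.X, Y)`. -/
noncomputable def orbitTrace (W : Mat3) (g : SL(3, ℝ)) (Y : Mat3) : ℝ :=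
  ((g : Mat3) * W * (g : Mat3)ᵀ * Y).trace

/-- The normal vector `g W gᵀ - W`. -/
noncomputable def orbitNormal (W : Mat3) (g : SL(3, ℝ)) : Mat3 :=
  (g : Mat3) * W * (g : Mat3)ᵀ - W

theorem trace_orbitNormal_mul (W : Mat3) (g : SL(3, ℝ)) (Y : Mat3) :
    (orbitNormal W g * Y).trace = orbitTrace W g Y - orbitTrace W 1 Y := by
  simp [orbitNormal, orbitTrace, Matrix.sub_mul]

theorem coe_mul_coe_inv (g : SL(3, ℝ)) : (g : Mat3) * ((g⁻¹ : SL(3, ℝ)) : Mat3) = 1 := by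
  rw [← Matrix.SpecialLinearGroup.coe_mul, mul_inv_cancel, Matrix.SpecialLinearGroup.coe_one]

theorem coe_inv_mul_coe (g : SL(3, ℝ)) : ((g⁻¹ : SL(3, ℝ)) : Mat3) * (g : Mat3) = 1 := by
  rw [← Matrix.SpecialLinearGroup.coe_mul, inv_mul_cancel, Matrix.SpecialLinearGroup.coe_one]

theorem transpose_coe_inv_mul (g : SL(3, ℝ)) :
    (g : Mat3)ᵀ * ((g⁻¹ : SL(3, ℝ)) : Mat3)ᵀ = 1 := by
  rw [← Matrix.transpose_mul, coe_inv_mul_coe, Matrix.transpose_one]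

theorem transpose_coe_mul_inv (g : SL(3, ℝ)) :
    ((g⁻¹ : SL(3, ℝ)) : Mat3)ᵀ * (g : Mat3)ᵀ = 1 := by
  rw [← Matrix.transpose_mul, coe_mul_coe_inv, Matrix.transpose_one]

theorem selbergInv_act (X : SymSpace 3) (g : SL(3, ℝ)) (Y : SymSpace 3) :
    selbergInv (act g X) Y = orbitTrace X.1⁻¹ g⁻¹ Y.1 := by
  have h : ((act g X).1)⁻¹ = ((g⁻¹ : SL(3, ℝ)) : Mat3) * X.1⁻¹ * ((g⁻¹ : SL(3, ℝ)) : Mat3)ᵀ := by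
    apply Matrix.inv_eq_left_inv
    change _ * ((g : Mat3)ᵀ * X.1 * (g : Mat3)) = 1
    have hX : X.1⁻¹ * X.1 = 1 := Matrix.nonsing_inv_mul _ (by simp [X.2.2])
    calc _ = ((g⁻¹ : SL(3, ℝ)) : Mat3) * X.1⁻¹ *
          (((g⁻¹ : SL(3, ℝ)) : Mat3)ᵀ * (g : Mat3)ᵀ) * X.1 * (g : Mat3) := by
            simp only [Matrix.mul_assoc]
      _ = ((g⁻¹ : SL(3, ℝ)) : Mat3) * (X.1⁻¹ * X.1) * (g : Mat3) := by
            rw [transpose_coe_mul_inv]; simp only [Matrix.mul_one, Matrix.mul_assoc]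
      _ = 1 := by rw [hX, Matrix.mul_one, coe_inv_mul_coe]
  rw [selbergInv, h, orbitTrace]

/-- The inverse of `gᵀ X g` involves `g⁻¹`; since `Γ` is closed under inversion, the index can be
renamed. -/
theorem mem_DS_iff {X Y : SymSpace 3} {Γ : Subgroup SL(3, ℝ)} :
    Y ∈ DS X Γ ↔ ∀ g ∈ Γ, orbitTrace X.1⁻¹ 1 Y.1 ≤ orbitTrace X.1⁻¹ g Y.1 := by
  have h1 : selbergInv X Y = orbitTrace X.1⁻¹ 1 Y.1 := by simp [selbergInv, orbitTrace]
  constructor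
  · intro h g hg
    have := h g⁻¹ (Γ.inv_mem hg)
    rwa [selbergInv_act, inv_inv, h1] at this
  · intro h g hg
    rw [selbergInv_act, h1]
    exact h g⁻¹ (Γ.inv_mem hg)

theorem posDef_conj {W : Mat3} (hW : W.PosDef) (g : SL(3, ℝ)) :
    ((g : Mat3) * W * (g : Mat3)ᵀ).PosDef := by
  have h : Function.Injective (g : Mat3).vecMul :=
    Matrix.vecMul_injective_of_isUnit ((Matrix.isUnit_iff_isUnit_det _).2 (by simp))
  simpa [Matrix.conjTranspose_eq_transpose_of_trivial] using hW.mul_mul_conjTranspose_same h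

theorem posDef_conj_transpose {Y : Mat3} (hY : Y.PosDef) (g : SL(3, ℝ)) :
    ((g : Mat3)ᵀ * Y * (g : Mat3)).PosDef := by
  have := posDef_conj hY (Matrix.SpecialLinearGroup.transpose g)
  simpa using this

theorem isSymm_orbitNormal {W : Mat3} (hW : W.IsSymm) (g : SL(3, ℝ)) :
    (orbitNormal W g).IsSymm := by
  simp [Matrix.IsSymm, orbitNormal, hW.eq, Matrix.mul_assoc]

/-- For `M, X` positive definite of determinant one, `tr(M X) ≥ 3`, with equality only for
`M = X⁻¹`. -/
theorem three_le_trace_mul {M : Mat3} (hM : M.PosDef) (hdet : M.det = 1) (X : SymSpace 3) :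
    3 ≤ (M * X.1).trace ∧ ((M * X.1).trace = 3 → M = X.1⁻¹) := by
  -- Writing `X = Bᵀ B` turns `tr(M X)` into the trace of `B M Bᵀ`, positive definite of determinant
  -- one.
  obtain ⟨B, hB⟩ := exists_eq_transpose_mul_self X.2.1.posSemidef
  have hBdet : B.det * B.det = 1 := by
    have := X.2.2
    rwa [hB, Matrix.det_mul, Matrix.det_transpose] at this
  have hBu : IsUnit B.det := IsUnit.of_mul_eq_one _ hBdet
  have hN : (B * M * Bᵀ).PosDef := by
    simpa [Matrix.conjTranspose_eq_transpose_of_trivial] using hM.mul_mul_conjTranspose_same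
      (Matrix.vecMul_injective_of_isUnit ((Matrix.isUnit_iff_isUnit_det _).2 hBu))
  have htr : (M * X.1).trace = (B * M * Bᵀ).trace := by
    rw [hB, ← Matrix.mul_assoc, Matrix.trace_mul_comm, ← Matrix.mul_assoc]
  have hd : (B * M * Bᵀ).det = 1 := by
    rw [Matrix.det_mul, Matrix.det_mul, Matrix.det_transpose, hdet]
    linarith
  obtain ⟨h1, h2⟩ := three_le_trace hN hd
  rw [htr]
  refine ⟨h1, fun h => ?_⟩
  have h3 := h2 h
  symm
  apply Matrix.inv_eq_left_inv
  rw [hB]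
  have h4 : Bᵀ * (B * M) = 1 := mul_eq_one_comm.1 h3
  exact mul_eq_one_comm.1 (by rw [Matrix.mul_assoc, h4])

theorem posDef_inv (X : SymSpace 3) : (X.1⁻¹).PosDef := X.2.1.inv

theorem det_inv (X : SymSpace 3) : (X.1⁻¹).det = 1 := by
  rw [Matrix.det_nonsing_inv, X.2.2, Ring.inverse_one]

theorem orbitTrace_one_self (X : SymSpace 3) : orbitTrace X.1⁻¹ 1 X.1 = 3 := by
  have hX : X.1⁻¹ * X.1 = 1 := Matrix.nonsing_inv_mul _ (by simp [X.2.2])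
  simp [orbitTrace, hX]

theorem det_conj_inv (X : SymSpace 3) (g : SL(3, ℝ)) :
    ((g : Mat3) * X.1⁻¹ * (g : Mat3)ᵀ).det = 1 := by
  simp [Matrix.det_mul, X.2.2]

/-- The base point of a Dirichlet–Selberg domain lies strictly inside all its half-spaces. -/
theorem trace_orbitNormal_self_pos (X : SymSpace 3) {g : SL(3, ℝ)}
    (h0 : orbitNormal X.1⁻¹ g ≠ 0) : 0 < (orbitNormal X.1⁻¹ g * X.1).trace := by
  rw [trace_orbitNormal_mul, orbitTrace_one_self]
  obtain ⟨h1, h2⟩ := three_le_trace_mul (posDef_conj (posDef_inv X) g) (det_conj_inv X g) X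
  rw [orbitTrace, sub_pos]
  exact lt_of_le_of_ne h1 fun h => h0 (by rw [orbitNormal, h2 h.symm, sub_self])

/-- The trace against the normal is positive at `X` and nonpositive at `g⁻¹.X`, whose inverse is `g
X⁻¹ gᵀ`; a suitable combination of the two points lies on the hyperplane. -/
theorem isNormalVector_orbitNormal (X : SymSpace 3) {g : SL(3, ℝ)}
    (h0 : orbitNormal X.1⁻¹ g ≠ 0) : IsNormalVector (orbitNormal X.1⁻¹ g) := by
  refine ⟨isSymm_orbitNormal (posDef_inv X).isSymm g, h0, ?_⟩
  set A := orbitNormal X.1⁻¹ g with hA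
  have ha : 0 < (A * X.1).trace := trace_orbitNormal_self_pos X h0
  set Z : SymSpace 3 := act g⁻¹ X with hZ
  have hb : (A * Z.1).trace ≤ 0 := by
    rw [trace_orbitNormal_mul]
    have h1 : orbitTrace X.1⁻¹ g Z.1 = 3 := by
      have h2 : orbitTrace X.1⁻¹ g Z.1 = selbergInv (act g⁻¹ X) Z := by
        rw [selbergInv_act, inv_inv]
      rw [h2, ← hZ, selbergInv, Matrix.nonsing_inv_mul _ (by simp [Z.2.2])]
      simp
    have h2 := (three_le_trace_mul (posDef_inv X) (det_inv X) Z).1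
    rw [h1]
    simp only [orbitTrace, Matrix.SpecialLinearGroup.coe_one, Matrix.one_mul,
      Matrix.transpose_one, Matrix.mul_one]
    linarith
  have hpos : (((-(A * Z.1).trace) • X.1) + (A * X.1).trace • Z.1).PosDef :=
    Matrix.PosDef.posSemidef_add (X.2.1.posSemidef.smul (by linarith)) (Z.2.1.smul ha)
  refine ⟨rayPoint _, (trace_rayPoint_eq_zero hpos).2 ?_⟩
  rw [Matrix.mul_add, Matrix.trace_add, Matrix.mul_smul, Matrix.mul_smul, Matrix.trace_smul,
    Matrix.trace_smul, smul_eq_mul, smul_eq_mul]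
  ring

/-- `Γ` meets every compact set in a finite set. -/
def FiniteOnCompacts (Γ : Subgroup SL(3, ℝ)) : Prop :=
  ∀ K : Set SL(3, ℝ), IsCompact K → ((Γ : Set SL(3, ℝ)) ∩ K).Finite

theorem finiteOnCompacts_of_discrete (Γ : Subgroup SL(3, ℝ)) [DiscreteTopology Γ] :
    FiniteOnCompacts Γ := by
  intro K hK
  have hcl : IsClosed (Γ : Set SL(3, ℝ)) := Subgroup.isClosed_of_discrete
  refine (hK.inter_left hcl).finite ?_
  exact (isDiscrete_iff_discreteTopology.2 ‹_›).mono Set.inter_subset_left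

theorem FiniteOnCompacts.map_conj {Γ : Subgroup SL(3, ℝ)} (h : FiniteOnCompacts Γ)
    (k : SL(3, ℝ)) : FiniteOnCompacts (Γ.map (MulAut.conj k).toMonoidHom) := by
  intro K hK
  have hK' : IsCompact ((fun g => k⁻¹ * g * k) '' K) := hK.image (by fun_prop)
  refine ((h _ hK').image fun g => k * g * k⁻¹).subset ?_
  rintro _ ⟨⟨g, hg, rfl⟩, hgK⟩
  exact ⟨g, ⟨hg, _, hgK, by simp [mul_assoc]⟩, by simp⟩

/-- The trace is the sum of the squares of the entries, and `SL(3, ℝ)` is closed among all matrices.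
-/
theorem isCompact_trace_le (R : ℝ) :
    IsCompact {g : SL(3, ℝ) | ((g : Mat3) * (g : Mat3)ᵀ).trace ≤ R} := by
  have hK : IsCompact {M : Mat3 | (M * Mᵀ).trace ≤ R} := by
    have hb : IsCompact (Set.univ.pi fun _ : Fin 3 => Set.univ.pi fun _ : Fin 3 =>
        Set.Icc (-(1 + |R|)) (1 + |R|)) :=
      isCompact_univ_pi fun _ => isCompact_univ_pi fun _ => isCompact_Icc
    refine IsCompact.of_isClosed_subset (X := Mat3) hb
      (isClosed_le (by fun_prop) continuous_const) ?_
    intro M hM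
    have hM : (M * Mᵀ).trace ≤ R := hM
    refine Set.mem_univ_pi.2 fun i => Set.mem_univ_pi.2 fun j => ?_
    have h1 : M i j ^ 2 ≤ (M * Mᵀ).trace := by
      have h2 : (M * Mᵀ).trace = ∑ i, ∑ j, M i j ^ 2 := by
        simp [Matrix.trace, Matrix.mul_apply, sq]
      rw [h2]
      exact (Finset.single_le_sum (f := fun j => M i j ^ 2) (fun j _ => sq_nonneg _)
        (Finset.mem_univ j)).trans (Finset.single_le_sum (f := fun i => ∑ j, M i j ^ 2)
        (fun i _ => Finset.sum_nonneg fun j _ => sq_nonneg _) (Finset.mem_univ i))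
    have h3 := abs_le_of_sq_le_sq' (a := M i j) (b := 1 + |R|)
      (by nlinarith [le_abs_self R, abs_nonneg R]) (by positivity)
    exact h3
  exact Matrix.SpecialLinearGroup.isClosedEmbedding_val.isCompact_preimage hK

theorem le_trace_mul_of_posDef_sub {Y P : Mat3} {c : ℝ} (hY : (Y - c • (1 : Mat3)).PosDef)
    (hP : P.PosSemidef) : c * P.trace ≤ (P * Y).trace := by
  have := trace_mul_nonneg hP hY.posSemidef
  rw [Matrix.mul_sub, Matrix.trace_sub, Matrix.mul_smul, Matrix.mul_one, Matrix.trace_smul,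
    smul_eq_mul] at this
  linarith

theorem posSemidef_conj {P : Mat3} (hP : P.PosSemidef) (g : Mat3) :
    (g * P * gᵀ).PosSemidef := by
  simpa [Matrix.conjTranspose_eq_transpose_of_trivial] using hP.mul_mul_conjTranspose_same g

/-- `tr(g W gᵀ Y)` is comparable to `tr(g gᵀ Y)`. -/
theorem exists_orbitTrace_bounds {W : Mat3} (hW : W.PosDef) :
    ∃ c C : ℝ, 0 < c ∧ 0 < C ∧ ∀ (g : SL(3, ℝ)) (Y : Mat3), Y.PosSemidef →
      c * ((g : Mat3) * (g : Mat3)ᵀ * Y).trace ≤ orbitTrace W g Y ∧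
      orbitTrace W g Y ≤ C * ((g : Mat3) * (g : Mat3)ᵀ * Y).trace := by
  obtain ⟨c, hc, hcW⟩ := exists_posDef_sub hW
  obtain ⟨C, hC, hCW⟩ := exists_sub_posDef hW.isSymm
  refine ⟨c, C, hc, hC, fun g Y hY => ⟨?_, ?_⟩⟩
  · have := trace_mul_nonneg (posSemidef_conj hcW.posSemidef g) hY
    simp only [Matrix.mul_sub, Matrix.sub_mul, Matrix.trace_sub, Matrix.mul_smul, Matrix.smul_mul,
      Matrix.mul_one, Matrix.trace_smul, smul_eq_mul] at this
    rw [orbitTrace]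
    linarith
  · have := trace_mul_nonneg (posSemidef_conj hCW.posSemidef g) hY
    simp only [Matrix.mul_sub, Matrix.sub_mul, Matrix.trace_sub, Matrix.mul_smul, Matrix.smul_mul,
      Matrix.mul_one, Matrix.trace_smul, smul_eq_mul] at this
    rw [orbitTrace]
    linarith

/-- The nonzero normal vectors `g W gᵀ - W` for `g ∈ Γ`. -/
def orbitNormals (Γ : Subgroup SL(3, ℝ)) (W : Mat3) : Set Mat3 :=
  {A | A ≠ 0 ∧ ∃ g ∈ Γ, orbitNormal W g = A}

theorem DS_eq_biInter (X : SymSpace 3) (Γ : Subgroup SL(3, ℝ)) :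
    DS X Γ = ⋂ A ∈ orbitNormals Γ X.1⁻¹, halfSpace A := by
  ext Y
  rw [mem_DS_iff, mem_biInter_halfSpace]
  constructor
  · rintro h _ ⟨-, g, hg, rfl⟩
    rw [trace_orbitNormal_mul, sub_nonneg]
    exact h g hg
  · intro h g hg
    rw [← sub_nonneg, ← trace_orbitNormal_mul]
    by_cases h0 : orbitNormal X.1⁻¹ g = 0
    · simp [h0]
    · exact h _ ⟨h0, g, hg, rfl⟩

theorem isNormalVector_of_mem_orbitNormals {X : SymSpace 3} {Γ : Subgroup SL(3, ℝ)} {A : Mat3}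
    (hA : A ∈ orbitNormals Γ X.1⁻¹) : IsNormalVector A := by
  obtain ⟨h0, g, -, rfl⟩ := hA
  exact isNormalVector_orbitNormal X h0

/-- If the hyperplane of `g` passes through `Z` near `Y`, then `tr(g X⁻¹ gᵀ Z) = tr(X⁻¹ Z)` is
bounded, while the left side is at least a constant times `tr(g gᵀ)`. So `g` lies in a fixed compact
set. -/
theorem locallyFinite_orbitNormals (X : SymSpace 3) {Γ : Subgroup SL(3, ℝ)}
    (hΓ : FiniteOnCompacts Γ) :
    LocallyFinite (fun A : orbitNormals Γ X.1⁻¹ =>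
      (normalSpace (A : Mat3) : Set (SymSpace 3))) := by
  rw [locallyFinite_normalSpace_iff]
  intro Y
  obtain ⟨c, hc, hcY⟩ := exists_eventually_posDef_sub Y.2.1
  obtain ⟨w, hw, hwW⟩ := exists_posDef_sub (posDef_inv X)
  have h1 : ∀ᶠ Z : SymSpace 3 in 𝓝 Y, (Z.1 - c • (1 : Mat3)).PosDef := by
    filter_upwards [continuous_subtype_val.continuousAt.eventually hcY] with Z hZ
    exact hZ Z.2.1.isSymm
  have h2 : ∀ᶠ Z : SymSpace 3 in 𝓝 Y, (X.1⁻¹ * Z.1).trace < (X.1⁻¹ * Y.1).trace + 1 :=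
    (continuous_trace_mul X.1⁻¹).continuousAt.eventually (gt_mem_nhds (by linarith))
  refine ⟨_, h1.and h2, ((hΓ _ (isCompact_trace_le
    (((X.1⁻¹ * Y.1).trace + 1) / (c * w)))).image (orbitNormal X.1⁻¹)).subset ?_⟩
  rintro _ ⟨⟨-, g, hg, rfl⟩, Z, hZA, hZ1, hZ2⟩
  refine ⟨g, ⟨hg, ?_⟩, rfl⟩
  have hZA : (orbitNormal X.1⁻¹ g * Z.1).trace = 0 := hZA
  rw [trace_orbitNormal_mul, sub_eq_zero] at hZA
  have h3 := le_trace_mul_of_posDef_sub hZ1 (posDef_conj (posDef_inv X) g).posSemidef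
  have h4 := le_trace_mul_of_posDef_sub hwW
    (Matrix.posSemidef_conjTranspose_mul_self (g : Mat3))
  rw [Matrix.conjTranspose_eq_transpose_of_trivial, Matrix.mul_assoc,
    Matrix.trace_mul_comm (g : Mat3)ᵀ (g : Mat3),
    Matrix.trace_mul_comm (g : Mat3)ᵀ] at h4
  have h5 : orbitTrace X.1⁻¹ 1 Z.1 = (X.1⁻¹ * Z.1).trace := by simp [orbitTrace]
  change _ = _ at hZA
  rw [h5, orbitTrace] at hZA
  change ((g : Mat3) * (g : Mat3)ᵀ).trace ≤ _
  rw [le_div_iff₀ (by positivity)]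
  nlinarith

/-- Finitely many of the conditions indexed by `Γ` imply all of them. -/
def FinitelyCut (Γ : Subgroup SL(3, ℝ)) (W : Mat3) : Prop :=
  ∃ S : Set SL(3, ℝ), S.Finite ∧ S ⊆ Γ ∧ ∀ Y : Mat3, Y.PosDef →
    (∀ s ∈ S, orbitTrace W 1 Y ≤ orbitTrace W s Y) →
      ∀ g ∈ Γ, orbitTrace W 1 Y ≤ orbitTrace W g Y

/-- Points strictly inside any given finite number of the half-spaces indexed by `Γ` need not lie
strictly inside all of them. -/
def InfinitelyCut (Γ : Subgroup SL(3, ℝ)) (W : Mat3) : Prop :=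
  ∀ S : Set SL(3, ℝ), S.Finite → S ⊆ Γ → ∃ Y : Mat3, Y.PosDef ∧
    (∃ g ∈ Γ, g ≠ 1 ∧ orbitTrace W g Y ≤ orbitTrace W 1 Y) ∧
      ∀ s ∈ S, s ≠ 1 → orbitTrace W 1 Y < orbitTrace W s Y

theorem finitelySided_DS {X : SymSpace 3} {Γ : Subgroup SL(3, ℝ)}
    (h : FinitelyCut Γ X.1⁻¹) : FinitelySided (DS X Γ) := by
  obtain ⟨S, hfin, hS, h⟩ := h
  have heq : DS X Γ = ⋂ A ∈ {A : Mat3 | A ≠ 0 ∧ ∃ g ∈ S, orbitNormal X.1⁻¹ g = A},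
      halfSpace A := by
    ext Y
    rw [mem_DS_iff, mem_biInter_halfSpace]
    constructor
    · rintro h1 _ ⟨-, g, hg, rfl⟩
      rw [trace_orbitNormal_mul, sub_nonneg]
      exact h1 g (hS hg)
    · intro h1
      refine h Y.1 Y.2.1 fun g hg => ?_
      rw [← sub_nonneg, ← trace_orbitNormal_mul]
      by_cases h0 : orbitNormal X.1⁻¹ g = 0
      · simp [h0]
      · exact h1 _ ⟨h0, g, hg, rfl⟩
  rw [heq]
  refine finitelySided_of_finite ((hfin.image (orbitNormal X.1⁻¹)).subset fun A hA => hA.2) ?_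
  rintro _ ⟨h0, g, -, rfl⟩
  exact isNormalVector_orbitNormal X h0

/-- The stabilizer of `X⁻¹` is bounded. Its elements impose no condition and must be kept apart when
half-spaces are counted. -/
theorem finite_orbitNormal_eq_zero (X : SymSpace 3) {Γ : Subgroup SL(3, ℝ)}
    (hΓ : FiniteOnCompacts Γ) : {g ∈ Γ | orbitNormal X.1⁻¹ g = 0}.Finite := by
  obtain ⟨c, C, hc, hC, h⟩ := exists_orbitTrace_bounds (posDef_inv X)
  refine (hΓ _ (isCompact_trace_le ((X.1⁻¹).trace / c))).subset ?_
  rintro g ⟨hg, h0⟩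
  refine ⟨hg, ?_⟩
  have h1 := (h g 1 Matrix.PosSemidef.one).1
  rw [orbitNormal, sub_eq_zero] at h0
  rw [orbitTrace, h0, Matrix.mul_one, Matrix.mul_one] at h1
  change ((g : Mat3) * (g : Mat3)ᵀ).trace ≤ _
  rw [le_div_iff₀ hc]
  linarith

theorem infinitelySided_DS {X : SymSpace 3} {Γ : Subgroup SL(3, ℝ)} (hΓ : FiniteOnCompacts Γ)
    (h : InfinitelyCut Γ X.1⁻¹) : InfinitelySided (DS X Γ) := by
  rw [DS_eq_biInter]
  refine infinitelySided_of_forall_finite (p₀ := X)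
    (fun A hA => isNormalVector_of_mem_orbitNormals hA) (locallyFinite_orbitNormals X hΓ) ?_ ?_
  · rintro _ ⟨h0, g, -, rfl⟩
    exact trace_orbitNormal_self_pos X h0
  intro 𝒮 h𝒮 hfin
  have hpre : ∃ T : Set SL(3, ℝ), T.Finite ∧ T ⊆ Γ ∧ 𝒮 ⊆ orbitNormal X.1⁻¹ '' T := by
    choose! f hf hf' using fun A (hA : A ∈ 𝒮) => (h𝒮 hA).2
    refine ⟨f '' 𝒮, hfin.image f, Set.image_subset_iff.2 hf, fun A hA => ?_⟩
    exact ⟨f A, ⟨A, hA, rfl⟩, hf' A hA⟩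
  obtain ⟨T, hTfin, hTΓ, hT⟩ := hpre
  -- Including the stabilizer forces the violating element `g` to have a nonzero normal.
  obtain ⟨Y, hY, ⟨g, hg, hg1, hgY⟩, hst⟩ := h (T ∪ {g ∈ Γ | orbitNormal X.1⁻¹ g = 0})
    (hTfin.union (finite_orbitNormal_eq_zero X hΓ))
    (Set.union_subset hTΓ fun g hg => hg.1)
  have hA0 : orbitNormal X.1⁻¹ g ≠ 0 := by
    intro h0
    have h1 := hst g (Or.inr ⟨hg, h0⟩) hg1
    have h2 := trace_orbitNormal_mul X.1⁻¹ g Y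
    rw [h0, Matrix.zero_mul, Matrix.trace_zero] at h2
    linarith
  have hpos : ∀ A ∈ 𝒮, 0 < (A * (rayPoint Y).1).trace := by
    intro A hA
    rw [trace_rayPoint_pos hY]
    obtain ⟨s, hs, rfl⟩ := hT hA
    rw [trace_orbitNormal_mul, sub_pos]
    refine hst s (Or.inl hs) ?_
    rintro rfl
    exact (h𝒮 hA).1 (by simp [orbitNormal])
  have hsymm := isSymm_orbitNormal (posDef_inv X).isSymm g
  -- The inequality of `g` may be an equality at `Y`. A small step against its normal makes it fail
  -- strictly, while the finitely many strict inequalities survive.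
  obtain ⟨h1, h2⟩ := tendsto_rayPoint_add_smul (rayPoint Y) hsymm
  have h3 : ∀ᶠ Z : SymSpace 3 in 𝓝 (rayPoint Y), ∀ A ∈ 𝒮, 0 < (A * Z.1).trace :=
    (Filter.eventually_all_finite hfin).2 fun A hA =>
      (continuous_trace_mul A).continuousAt.eventually (lt_mem_nhds (hpos A hA))
  obtain ⟨e, ⟨he1, he2⟩, he3⟩ := ((((h1.eventually h3).and h2).filter_mono
    (nhdsWithin_le_nhds (s := Set.Iio 0))).and self_mem_nhdsWithin).exists
  have he3 : e < 0 := he3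
  refine ⟨_, fun A hA => (he1 A hA).le, fun hmem => ?_⟩
  have h4 := mem_biInter_halfSpace.1 hmem _ ⟨hA0, g, hg, rfl⟩
  rw [trace_rayPoint_nonneg he2, Matrix.mul_add, Matrix.trace_add, Matrix.mul_smul,
    Matrix.trace_smul, smul_eq_mul] at h4
  have h5 : ¬ 0 < (orbitNormal X.1⁻¹ g * (rayPoint Y).1).trace := by
    rw [trace_rayPoint_pos hY, trace_orbitNormal_mul]
    linarith
  nlinarith [trace_self_pos hsymm hA0]

theorem orbitTrace_conj (W : Mat3) (k g : SL(3, ℝ)) (Y : Mat3) :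
    orbitTrace ((k : Mat3) * W * (k : Mat3)ᵀ) (k * g * k⁻¹) Y =
      orbitTrace W g ((k : Mat3)ᵀ * Y * (k : Mat3)) := by
  have h1 : ((k * g * k⁻¹ : SL(3, ℝ)) : Mat3) * ((k : Mat3) * W * (k : Mat3)ᵀ) *
      ((k * g * k⁻¹ : SL(3, ℝ)) : Mat3)ᵀ = (k : Mat3) * ((g : Mat3) * W * (g : Mat3)ᵀ) *
        (k : Mat3)ᵀ := by
    rw [Matrix.SpecialLinearGroup.coe_mul, Matrix.SpecialLinearGroup.coe_mul,
      Matrix.transpose_mul, Matrix.transpose_mul]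
    calc _ = (k : Mat3) * (g : Mat3) * (((k⁻¹ : SL(3, ℝ)) : Mat3) * (k : Mat3)) * W *
          ((k : Mat3)ᵀ * ((k⁻¹ : SL(3, ℝ)) : Mat3)ᵀ) * (g : Mat3)ᵀ * (k : Mat3)ᵀ := by
            simp only [Matrix.mul_assoc]
      _ = _ := by
            rw [coe_inv_mul_coe, transpose_coe_inv_mul]
            simp only [Matrix.mul_assoc, Matrix.mul_one]
  rw [orbitTrace, h1, orbitTrace, Matrix.mul_assoc, Matrix.mul_assoc, Matrix.trace_mul_comm]
  simp only [Matrix.mul_assoc]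

/-- Conjugating the group by `k` amounts to replacing `W` by `k W kᵀ` and pulling `Y` back by the
congruence `kᵀ Y k`, a bijection of the positive definite cone. -/
theorem FinitelyCut.of_map_conj {Γ : Subgroup SL(3, ℝ)} {W : Mat3} (k : SL(3, ℝ))
    (h : FinitelyCut (Γ.map (MulAut.conj k).toMonoidHom) ((k : Mat3) * W * (k : Mat3)ᵀ)) :
    FinitelyCut Γ W := by
  obtain ⟨S, hfin, hS, h⟩ := h
  refine ⟨(fun g => k⁻¹ * g * k) '' S, hfin.image _, ?_, ?_⟩
  · rintro _ ⟨s, hs, rfl⟩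
    obtain ⟨g, hg, rfl⟩ := hS hs
    simpa [mul_assoc] using hg
  intro Y hY hle g hg
  set Y' : Mat3 := ((k⁻¹ : SL(3, ℝ)) : Mat3)ᵀ * Y * ((k⁻¹ : SL(3, ℝ)) : Mat3) with hY'
  have hback : (k : Mat3)ᵀ * Y' * (k : Mat3) = Y := by
    calc _ = ((k : Mat3)ᵀ * ((k⁻¹ : SL(3, ℝ)) : Mat3)ᵀ) * Y *
          (((k⁻¹ : SL(3, ℝ)) : Mat3) * (k : Mat3)) := by simp only [hY', Matrix.mul_assoc]
      _ = Y := by rw [transpose_coe_inv_mul, coe_inv_mul_coe, Matrix.one_mul, Matrix.mul_one]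
  have htr : ∀ g, orbitTrace ((k : Mat3) * W * (k : Mat3)ᵀ) (k * g * k⁻¹) Y' =
      orbitTrace W g Y := fun g => by rw [orbitTrace_conj, hback]
  have h1 : orbitTrace ((k : Mat3) * W * (k : Mat3)ᵀ) 1 Y' = orbitTrace W 1 Y := by
    simpa using htr 1
  have := h Y' (posDef_conj_transpose hY k⁻¹) (fun s hs => ?_) (k * g * k⁻¹) ⟨g, hg, rfl⟩
  · rwa [h1, htr] at this
  · have := hle _ ⟨s, hs, rfl⟩
    have h2 := htr (k⁻¹ * s * k)
    rw [show k * (k⁻¹ * s * k) * k⁻¹ = s by group] at h2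
    rwa [h1, h2]

theorem InfinitelyCut.of_map_conj {Γ : Subgroup SL(3, ℝ)} {W : Mat3} (k : SL(3, ℝ))
    (h : InfinitelyCut (Γ.map (MulAut.conj k).toMonoidHom) ((k : Mat3) * W * (k : Mat3)ᵀ)) :
    InfinitelyCut Γ W := by
  intro S hfin hS
  obtain ⟨Y, hY, ⟨_, ⟨g, hg, rfl⟩, hg1, hgY⟩, hst⟩ := h ((fun g => k * g * k⁻¹) '' S)
    (hfin.image _) (by rintro _ ⟨s, hs, rfl⟩; exact ⟨s, hS hs, rfl⟩)
  have h1 : orbitTrace ((k : Mat3) * W * (k : Mat3)ᵀ) 1 Y =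
      orbitTrace W 1 ((k : Mat3)ᵀ * Y * (k : Mat3)) := by
    simpa using orbitTrace_conj W k 1 Y
  refine ⟨(k : Mat3)ᵀ * Y * (k : Mat3), posDef_conj_transpose hY k, ⟨g, hg, ?_, ?_⟩, ?_⟩
  · rintro rfl
    exact hg1 (map_one _)
  · rw [← h1, ← orbitTrace_conj]
    exact hgY
  · intro s hs hs1
    rw [← h1, ← orbitTrace_conj]
    exact hst _ ⟨s, hs, rfl⟩ (by simpa [mul_inv_eq_one] using hs1)

/-- If for infinitely many `g` some point lies on the hyperplane of `g` and strictly inside the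
half-spaces of all other elements, then no finite number of half-spaces suffices. -/
theorem infinitelyCut_of_forall_exists {Γ : Subgroup SL(3, ℝ)} {W : Mat3} (G : Set SL(3, ℝ))
    (hG : G.Infinite) (hGΓ : G ⊆ Γ) (h : ∀ g ∈ G, ∃ Y : Mat3, Y.PosDef ∧
      orbitTrace W g Y ≤ orbitTrace W 1 Y ∧
        ∀ s ∈ Γ, s ≠ 1 → s ≠ g → orbitTrace W 1 Y < orbitTrace W s Y) : InfinitelyCut Γ W := by
  intro S hfin hS
  obtain ⟨g, hg, hgS⟩ := hG.exists_notMem_finite (hfin.insert 1)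
  rw [Set.mem_insert_iff, not_or] at hgS
  obtain ⟨Y, hY, h1, h2⟩ := h g hg
  exact ⟨Y, hY, ⟨g, hGΓ hg, hgS.1, h1⟩, fun s hs hs1 => h2 s (hS hs) hs1 (by
    rintro rfl; exact hgS.2 hs)⟩

end Criteria

end DirichletSelberg

namespace DirichletSelberg

/-! ### Abelian groups in normal form as images of subgroups of the plane -/

section Parametrizations

theorem map_zero_of_map_add {r : ℝ × ℝ → SL(3, ℝ)} (hadd : ∀ v w, r (v + w) = r v * r w) :
    r 0 = 1 := by
  have := hadd 0 0
  rwa [add_zero, left_eq_mul] at this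

theorem map_neg_of_map_add {r : ℝ × ℝ → SL(3, ℝ)} (hadd : ∀ v w, r (v + w) = r v * r w)
    (v : ℝ × ℝ) : r (-v) = (r v)⁻¹ := by
  rw [eq_inv_iff_mul_eq_one, ← hadd, neg_add_cancel, map_zero_of_map_add hadd]

/-- The subgroup generated by the images of `T` under a homomorphism from `ℝ²`. -/
theorem mem_closure_iff_exists {r : ℝ × ℝ → SL(3, ℝ)} (hadd : ∀ v w, r (v + w) = r v * r w)
    {T : Set (ℝ × ℝ)} {S : Set Mat3} (hS : S = (fun v => (r v : Mat3)) '' T) {g : SL(3, ℝ)} :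
    g ∈ Subgroup.closure {γ : SL(3, ℝ) | (γ : Mat3) ∈ S} ↔
      ∃ v ∈ AddSubgroup.closure T, r v = g := by
  have hset : {γ : SL(3, ℝ) | (γ : Mat3) ∈ S} = r '' T := by
    ext γ
    rw [hS]
    constructor
    · rintro ⟨v, hv, h⟩
      exact ⟨v, hv, Subtype.ext h⟩
    · rintro ⟨v, hv, rfl⟩
      exact ⟨v, hv, rfl⟩
  rw [hset]
  constructor
  · intro h
    induction h using Subgroup.closure_induction with
    | mem x hx =>
      obtain ⟨v, hv, rfl⟩ := hx
      exact ⟨v, AddSubgroup.subset_closure hv, rfl⟩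
    | one => exact ⟨0, AddSubgroup.zero_mem _, map_zero_of_map_add hadd⟩
    | mul x y _ _ hx hy =>
      obtain ⟨v, hv, rfl⟩ := hx
      obtain ⟨w, hw, rfl⟩ := hy
      exact ⟨v + w, AddSubgroup.add_mem _ hv hw, hadd v w⟩
    | inv x _ hx =>
      obtain ⟨v, hv, rfl⟩ := hx
      exact ⟨-v, AddSubgroup.neg_mem _ hv, map_neg_of_map_add hadd v⟩
  · rintro ⟨v, hv, rfl⟩
    induction hv using AddSubgroup.closure_induction with
    | mem x hx => exact Subgroup.subset_closure ⟨x, hx, rfl⟩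
    | zero => rw [map_zero_of_map_add hadd]; exact Subgroup.one_mem _
    | add x y _ _ hx hy => rw [hadd]; exact Subgroup.mul_mem _ hx hy
    | neg x _ hx => rw [map_neg_of_map_add hadd]; exact Subgroup.inv_mem _ hx

/-- `L` is the additive group of parameters of the elements of `Γ`. -/
def IsParameterGroup (r : ℝ × ℝ → SL(3, ℝ)) (L : AddSubgroup (ℝ × ℝ)) (Γ : Subgroup SL(3, ℝ)) :
    Prop :=
  ∀ g, g ∈ Γ ↔ ∃ v ∈ L, r v = g

theorem IsParameterGroup.finite_inter {r : ℝ × ℝ → SL(3, ℝ)} {L : AddSubgroup (ℝ × ℝ)}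
    {Γ : Subgroup SL(3, ℝ)} (h : IsParameterGroup r L Γ) (hr : Continuous r)
    (hinj : Function.Injective r) (hΓ : FiniteOnCompacts Γ) {K : Set (ℝ × ℝ)} (hK : IsCompact K) :
    ((L : Set (ℝ × ℝ)) ∩ K).Finite := by
  refine Set.Finite.of_finite_image ((hΓ _ (hK.image hr)).subset ?_) hinj.injOn
  rintro _ ⟨v, ⟨hv, hvK⟩, rfl⟩
  exact ⟨(h _).2 ⟨v, hv, rfl⟩, v, hvK, rfl⟩

theorem IsParameterGroup.ne_zmultiples {r : ℝ × ℝ → SL(3, ℝ)} {L : AddSubgroup (ℝ × ℝ)}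
    {Γ : Subgroup SL(3, ℝ)} (h : IsParameterGroup r L Γ)
    (hadd : ∀ v w, r (v + w) = r v * r w) (hΓ : ¬ IsCyclic Γ) (v : ℝ × ℝ) :
    L ≠ AddSubgroup.zmultiples v := by
  rintro rfl
  refine hΓ ?_
  let f : Multiplicative (ℝ × ℝ) →* SL(3, ℝ) :=
    { toFun := fun x => r x.toAdd
      map_one' := map_zero_of_map_add hadd
      map_mul' := fun x y => hadd _ _ }
  have : Γ = Subgroup.zpowers (r v) := by
    ext g
    rw [h, Subgroup.mem_zpowers_iff]
    constructor
    · rintro ⟨w, hw, rfl⟩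
      obtain ⟨k, rfl⟩ := AddSubgroup.mem_zmultiples_iff.1 hw
      exact ⟨k, (map_zpow f (Multiplicative.ofAdd v) k).symm⟩
    · rintro ⟨k, rfl⟩
      exact ⟨k • v, AddSubgroup.zsmul_mem_zmultiples v k, map_zpow f (Multiplicative.ofAdd v) k⟩
  rw [this]
  infer_instance

/-- The first coordinates of a noncyclic two-generated subgroup of `ℝ²` are either the multiples
of a single number, or faithful and arbitrarily small. -/
theorem fst_discrete_or_dense {v w : ℝ × ℝ}
    (hnc : ∀ x, AddSubgroup.closure {v, w} ≠ AddSubgroup.zmultiples x) :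
    (∃ x₀ ∈ AddSubgroup.closure {v, w}, (∀ x ∈ AddSubgroup.closure {v, w},
      ∃ k : ℤ, x.1 = k * x₀.1) ∧ ∃ z : ℝ, z ≠ 0 ∧ ((0, z) : ℝ × ℝ) ∈ AddSubgroup.closure {v, w}) ∨
    ((∀ x ∈ AddSubgroup.closure {v, w}, x.1 = 0 → x = 0) ∧
      ∀ δ > 0, ∃ x ∈ AddSubgroup.closure {v, w}, x.1 ≠ 0 ∧ |x.1| < δ) := by
  set L := AddSubgroup.closure {v, w} with hL
  rcases AddSubgroup.dense_or_cyclic (L.map (AddMonoidHom.fst ℝ ℝ)) with hd | ⟨p, hp⟩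
  · right
    have hsmall : ∀ δ > 0, ∃ x ∈ L, x.1 ≠ 0 ∧ |x.1| < δ := by
      intro δ hδ
      obtain ⟨y, hy, hy'⟩ := hd.exists_between hδ
      obtain ⟨x, hx, rfl⟩ := hy
      exact ⟨x, hx, hy'.1.ne', (abs_of_pos hy'.1).trans_lt hy'.2⟩
    refine ⟨fun k hk hk0 => ?_, hsmall⟩
    by_contra hne
    obtain ⟨m, n, rfl⟩ := AddSubgroup.mem_closure_pair.1 hk
    have hrel : (m : ℝ) * v.1 + n * w.1 = 0 := by simpa using hk0
    have hfst : ∀ a b : ℤ, (a • v + b • w).1 = a * v.1 + b * w.1 := fun a b => by simp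
    -- A nontrivial integer relation between the two first coordinates would put all first
    -- coordinates into a discrete group, against their density.
    have key : ∀ (c : ℤ) (q : ℝ), c ≠ 0 → (∀ x ∈ L, ∃ j : ℤ, (c : ℝ) * x.1 = j * q) → False := by
      intro c q hc hcq
      have hc' : (0 : ℝ) < |(c : ℝ)| := abs_pos.2 (Int.cast_ne_zero.2 hc)
      by_cases hq : q = 0
      · obtain ⟨x, hx, hx0, -⟩ := hsmall 1 one_pos
        obtain ⟨j, hj⟩ := hcq x hx
        rw [hq, mul_zero, mul_eq_zero] at hj
        exact hj.elim (fun h => hc (Int.cast_eq_zero.1 h)) hx0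
      · obtain ⟨x, hx, hx0, hlt⟩ := hsmall (|q| / |(c : ℝ)|) (by positivity)
        obtain ⟨j, hj⟩ := hcq x hx
        rw [lt_div_iff₀ hc', mul_comm, ← abs_mul, hj, abs_mul] at hlt
        have hj0 : j = 0 := by
          by_contra hj0
          have : (1 : ℝ) ≤ |(j : ℝ)| := by
            rw [← Int.cast_abs]
            exact_mod_cast Int.one_le_abs hj0
          nlinarith [abs_pos.2 hq]
        rw [hj0, Int.cast_zero, zero_mul, mul_eq_zero] at hj
        exact hj.elim (fun h => hc (Int.cast_eq_zero.1 h)) hx0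
    by_cases hn : n = 0
    · by_cases hm : m = 0
      · exact hne (by simp [hn, hm])
      · refine key m w.1 hm fun x hx => ?_
        obtain ⟨a, b, rfl⟩ := AddSubgroup.mem_closure_pair.1 hx
        refine ⟨m * b - a * n, ?_⟩
        rw [hfst]
        push_cast
        linear_combination (a : ℝ) * hrel
    · refine key n v.1 hn fun x hx => ?_
      obtain ⟨a, b, rfl⟩ := AddSubgroup.mem_closure_pair.1 hx
      refine ⟨n * a - b * m, ?_⟩
      rw [hfst]
      push_cast
      linear_combination (b : ℝ) * hrel
  · left
    have hp0 : p ∈ L.map (AddMonoidHom.fst ℝ ℝ) := by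
      rw [hp]
      exact AddSubgroup.subset_closure rfl
    obtain ⟨x₀, hx₀, hx₀p⟩ := hp0
    have hx₀p : x₀.1 = p := hx₀p
    have hmul : ∀ x ∈ L, ∃ k : ℤ, x.1 = k * x₀.1 := by
      intro x hx
      have : x.1 ∈ L.map (AddMonoidHom.fst ℝ ℝ) := ⟨x, hx, rfl⟩
      rw [hp, AddSubgroup.mem_closure_singleton] at this
      obtain ⟨k, hk⟩ := this
      exact ⟨k, by rw [hx₀p, ← hk, zsmul_eq_mul]⟩
    refine ⟨x₀, hx₀, hmul, ?_⟩
    by_contra hno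
    push Not at hno
    -- If the first coordinate were faithful and generated by that of `x₀`, then `x₀` would generate
    -- everything.
    refine hnc x₀ (le_antisymm (fun x hx => ?_) ?_)
    · obtain ⟨k, hk⟩ := hmul x hx
      have hmem : x - k • x₀ ∈ L := L.sub_mem hx (L.zsmul_mem hx₀ k)
      have h1 : (x - k • x₀).1 = 0 := by simp [hk]
      have h2 : (x - k • x₀).2 = 0 := by
        by_contra h2
        refine hno _ h2 ?_
        rw [← h1]
        exact hmem
      have h3 : x - k • x₀ = 0 := Prod.ext h1 h2
      rw [sub_eq_zero] at h3
      rw [h3]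
      exact AddSubgroup.zsmul_mem_zmultiples x₀ k
    · rwa [AddSubgroup.zmultiples_le]

theorem infinite_zsmul_add {r : ℝ × ℝ → SL(3, ℝ)} (hinj : Function.Injective r)
    {L : AddSubgroup (ℝ × ℝ)} {x₀ : ℝ × ℝ} (hx₀ : x₀ ∈ L) {z : ℝ} (hz : z ≠ 0)
    (hzL : ((0, z) : ℝ × ℝ) ∈ L) : (r '' {x | x ∈ L ∧ x.1 = x₀.1}).Infinite := by
  refine Set.Infinite.image hinj.injOn ?_
  refine Set.infinite_of_injective_forall_mem (f := fun n : ℤ => x₀ + n • ((0, z) : ℝ × ℝ)) ?_ ?_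
  · intro m n h
    have h : x₀ + m • ((0, z) : ℝ × ℝ) = x₀ + n • ((0, z) : ℝ × ℝ) := h
    rw [add_right_inj, Prod.ext_iff] at h
    simpa [hz] using h
  · intro n
    exact ⟨L.add_mem hx₀ (L.zsmul_mem hzL n), by simp⟩

/-- The matrices `I + m E₁₂ + n E₁₃`. -/
def rowUnipotent (v : ℝ × ℝ) : SL(3, ℝ) :=
  ⟨!![1, v.1, v.2; 0, 1, 0; 0, 0, 1], by simp [Matrix.det_fin_three]⟩

/-- The matrices `I + m E₁₃ + n E₂₃`. -/
def colUnipotent (v : ℝ × ℝ) : SL(3, ℝ) :=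
  ⟨!![1, 0, v.1; 0, 1, v.2; 0, 0, 1], by simp [Matrix.det_fin_three]⟩

/-- The one-parameter groups through the unipotent matrices with a cyclic vector. -/
noncomputable def fullUnipotent (v : ℝ × ℝ) : SL(3, ℝ) :=
  ⟨!![1, v.1, v.2 + v.1 ^ 2 / 2; 0, 1, v.1; 0, 0, 1], by simp [Matrix.det_fin_three]⟩

/-- The diagonal matrices with positive entries. -/
noncomputable def diagTorus (v : ℝ × ℝ) : SL(3, ℝ) :=
  ⟨expDiag v.1 v.2 (-v.1 - v.2), by
    simp [expDiag, Matrix.det_fin_three, ← Real.exp_add]⟩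

/-- The block matrices `e^τ (1, u; 0, 1) ⊕ e^{-2τ}`. -/
noncomputable def blockGroup (v : ℝ × ℝ) : SL(3, ℝ) :=
  ⟨expBlock v.1 (Real.exp v.1 * v.2), by
    simp only [expBlock, Matrix.det_fin_three]
    simp only [of_apply, cons_val', cons_val_zero, cons_val_one, cons_val, mul_zero, sub_zero,
      zero_mul, add_zero, ← Real.exp_add]
    ring_nf
    simp⟩

theorem rowUnipotent_add (v w : ℝ × ℝ) :
    rowUnipotent (v + w) = rowUnipotent v * rowUnipotent w := by
  apply Subtype.ext
  rw [Matrix.SpecialLinearGroup.coe_mul]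
  ext i j
  fin_cases i <;> fin_cases j <;>
    simp [rowUnipotent, Matrix.mul_apply, Fin.sum_univ_three, add_comm]

theorem colUnipotent_add (v w : ℝ × ℝ) :
    colUnipotent (v + w) = colUnipotent v * colUnipotent w := by
  apply Subtype.ext
  rw [Matrix.SpecialLinearGroup.coe_mul]
  ext i j
  fin_cases i <;> fin_cases j <;>
    simp [colUnipotent, Matrix.mul_apply, Fin.sum_univ_three, add_comm]

theorem fullUnipotent_add (v w : ℝ × ℝ) :
    fullUnipotent (v + w) = fullUnipotent v * fullUnipotent w := by
  apply Subtype.ext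
  rw [Matrix.SpecialLinearGroup.coe_mul]
  ext i j
  fin_cases i <;> fin_cases j <;>
    simp [fullUnipotent, Matrix.mul_apply, Fin.sum_univ_three] <;> ring

theorem diagTorus_add (v w : ℝ × ℝ) : diagTorus (v + w) = diagTorus v * diagTorus w := by
  apply Subtype.ext
  rw [Matrix.SpecialLinearGroup.coe_mul]
  ext i j
  fin_cases i <;> fin_cases j <;>
    simp [diagTorus, expDiag, Matrix.mul_apply, Fin.sum_univ_three, ← Real.exp_add]
  ring

theorem blockGroup_add (v w : ℝ × ℝ) : blockGroup (v + w) = blockGroup v * blockGroup w := by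
  apply Subtype.ext
  rw [Matrix.SpecialLinearGroup.coe_mul]
  ext i j
  fin_cases i <;> fin_cases j <;>
    simp [blockGroup, expBlock, Matrix.mul_apply, Fin.sum_univ_three, mul_add, Real.exp_add] <;>
    ring

theorem continuous_of_continuous_coe {r : ℝ × ℝ → SL(3, ℝ)}
    (h : ∀ i j, Continuous fun v => (r v : Mat3) i j) : Continuous r :=
  continuous_induced_rng.2 (continuous_matrix h)

theorem continuous_rowUnipotent : Continuous rowUnipotent :=
  continuous_of_continuous_coe fun i j => by
    fin_cases i <;> fin_cases j <;> simp [rowUnipotent] <;> fun_prop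

theorem continuous_fullUnipotent : Continuous fullUnipotent :=
  continuous_of_continuous_coe fun i j => by
    fin_cases i <;> fin_cases j <;> simp [fullUnipotent] <;> fun_prop

theorem continuous_diagTorus : Continuous diagTorus :=
  continuous_of_continuous_coe fun i j => by
    fin_cases i <;> fin_cases j <;> simp [diagTorus, expDiag] <;> fun_prop

theorem continuous_blockGroup : Continuous blockGroup :=
  continuous_of_continuous_coe fun i j => by
    fin_cases i <;> fin_cases j <;> simp [blockGroup, expBlock] <;> fun_prop

theorem coe_apply_eq_of_eq {g h : SL(3, ℝ)} (e : g = h) (i j : Fin 3) :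
    (g : Mat3) i j = (h : Mat3) i j := by rw [e]

theorem injective_rowUnipotent : Function.Injective rowUnipotent := fun v w h => by
  have h1 := coe_apply_eq_of_eq h 0 1
  have h2 := coe_apply_eq_of_eq h 0 2
  simp [rowUnipotent] at h1 h2
  exact Prod.ext h1 h2

theorem injective_colUnipotent : Function.Injective colUnipotent := fun v w h => by
  have h1 := coe_apply_eq_of_eq h 0 2
  have h2 := coe_apply_eq_of_eq h 1 2
  simp [colUnipotent] at h1 h2
  exact Prod.ext h1 h2

theorem injective_fullUnipotent : Function.Injective fullUnipotent := fun v w h => by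
  have h1 := coe_apply_eq_of_eq h 0 1
  have h2 := coe_apply_eq_of_eq h 0 2
  simp [fullUnipotent] at h1 h2
  rw [h1, add_left_inj] at h2
  exact Prod.ext h1 h2

theorem injective_diagTorus : Function.Injective diagTorus := fun v w h => by
  have h1 := coe_apply_eq_of_eq h 0 0
  have h2 := coe_apply_eq_of_eq h 1 1
  simp [diagTorus, expDiag] at h1 h2
  exact Prod.ext h1 h2

theorem injective_blockGroup : Function.Injective blockGroup := fun v w h => by
  have h1 := coe_apply_eq_of_eq h 0 0
  have h2 := coe_apply_eq_of_eq h 0 1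
  simp [blockGroup, expBlock] at h1 h2
  rw [h1] at h2
  exact Prod.ext h1 (mul_left_cancel₀ (Real.exp_ne_zero _) h2)

end Parametrizations

end DirichletSelberg

namespace DirichletSelberg

/-! ### Finitely sided types: domination and quadratic forms -/

section FinitelySidedTypes

/-- If `g` stretches one part `a` of the trace of `Y` enough, and `μ` contracts the complementary
part `b` enough, then the condition of `μ` implies that of `g`. -/
theorem exists_domination {W : Mat3} (hW : W.PosDef) :
    ∃ ε : ℝ, 0 < ε ∧ ∀ R : ℝ, 0 ≤ R → ∃ K : ℝ, 0 < K ∧ ∀ (g μ : SL(3, ℝ)) (Y : Mat3),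
      Y.PosDef → ∀ a b : ℝ, 0 ≤ a → a + b = Y.trace →
        K * a ≤ ((g : Mat3) * (g : Mat3)ᵀ * Y).trace →
        ((μ : Mat3) * (μ : Mat3)ᵀ * Y).trace ≤ R * a + ε * b →
        orbitTrace W 1 Y ≤ orbitTrace W μ Y → orbitTrace W 1 Y ≤ orbitTrace W g Y := by
  obtain ⟨c, C, hc, hC, h⟩ := exists_orbitTrace_bounds hW
  -- With this `ε` the condition of `μ` reads `c (a + b) ≤ C R a + (c / 2) b`, so `b` is at most `(2
  -- C R / c) a`. The value for `1` is then at most `C (1 + 2 C R / c) a`, which `c K a` dominates.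
  refine ⟨c / (2 * C), by positivity, fun R hR => ⟨(C * (1 + 2 * C * R / c) + 1) / c,
    by positivity, fun g μ Y hY a b ha hab hg hμ hle => ?_⟩⟩
  by_contra hlt
  rw [not_le] at hlt
  have h1 := h 1 Y hY.posSemidef
  have h2 := (h g Y hY.posSemidef).1
  have h3 := (h μ Y hY.posSemidef).2
  simp only [Matrix.SpecialLinearGroup.coe_one, Matrix.transpose_one, Matrix.one_mul] at h1
  rw [← hab] at h1
  have h4 : C * ((μ : Mat3) * (μ : Mat3)ᵀ * Y).trace ≤ C * R * a + c / 2 * b := by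
    calc _ ≤ C * (R * a + c / (2 * C) * b) := mul_le_mul_of_nonneg_left hμ hC.le
      _ = _ := by field_simp
  have h5 : (C * (1 + 2 * C * R / c) + 1) * a ≤ c * ((g : Mat3) * (g : Mat3)ᵀ * Y).trace := by
    calc _ = c * ((C * (1 + 2 * C * R / c) + 1) / c * a) := by field_simp
      _ ≤ _ := mul_le_mul_of_nonneg_left hg hc.le
  have h6 : b ≤ 2 * C * R / c * a := by
    rw [div_mul_eq_mul_div, le_div_iff₀ hc]
    nlinarith [h1.1]
  nlinarith [h1.2]

/-- In each of the two directions of a cyclic group one inequality implies all sufficiently late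
ones, so a finite window of exponents suffices. -/
theorem finitelyCut_of_zmultiples {r : ℝ × ℝ → SL(3, ℝ)} {v : ℝ × ℝ} {Γ : Subgroup SL(3, ℝ)}
    {W : Mat3} (hΓ : IsParameterGroup r (AddSubgroup.zmultiples v) Γ)
    (h : ∀ w : ℝ × ℝ, w = v ∨ w = -v → ∃ m₀ n₀ : ℕ, ∀ n : ℕ, n₀ ≤ n → ∀ Y : Mat3, Y.PosDef →
      orbitTrace W 1 Y ≤ orbitTrace W (r (m₀ • w)) Y →
        orbitTrace W 1 Y ≤ orbitTrace W (r (n • w)) Y) : FinitelyCut Γ W := by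
  obtain ⟨m₁, n₁, h₁⟩ := h v (Or.inl rfl)
  obtain ⟨m₂, n₂, h₂⟩ := h (-v) (Or.inr rfl)
  set B : ℕ := m₁ + n₁ + m₂ + n₂ with hB
  refine ⟨(fun n : ℤ => r (n • v)) '' Set.Icc (-(B : ℤ)) B, (Set.finite_Icc _ _).image _, ?_, ?_⟩
  · rintro _ ⟨n, -, rfl⟩
    exact (hΓ _).2 ⟨_, AddSubgroup.zsmul_mem_zmultiples v n, rfl⟩
  intro Y hY hS g hg
  obtain ⟨w, hw, rfl⟩ := (hΓ g).1 hg
  obtain ⟨n, rfl⟩ := AddSubgroup.mem_zmultiples_iff.1 hw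
  by_cases hn : n ∈ Set.Icc (-(B : ℤ)) B
  · exact hS _ ⟨n, hn, rfl⟩
  rw [Set.mem_Icc, not_and_or, not_le, not_le] at hn
  rcases hn with hn | hn
  · obtain ⟨k, rfl⟩ : ∃ k : ℕ, n = -(k : ℤ) := ⟨(-n).toNat, by omega⟩
    have h3 := h₂ k (by omega) Y hY
    rw [← natCast_zsmul _ m₂, ← natCast_zsmul _ k, smul_neg, smul_neg, ← neg_smul,
      ← neg_smul] at h3
    exact h3 (hS _ ⟨-(m₂ : ℤ), ⟨by omega, by omega⟩, rfl⟩)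
  · obtain ⟨k, rfl⟩ : ∃ k : ℕ, n = (k : ℤ) := ⟨n.toNat, by omega⟩
    have h3 := h₁ k (by omega) Y hY
    rw [← natCast_zsmul _ m₁, ← natCast_zsmul _ k] at h3
    exact h3 (hS _ ⟨(m₁ : ℤ), ⟨by omega, by omega⟩, rfl⟩)

/-- The logarithms of the diagonal entries of `diagTorus v`. -/
def logWeight (v : ℝ × ℝ) : Fin 3 → ℝ := ![v.1, v.2, -v.1 - v.2]

theorem trace_diagTorus (v : ℝ × ℝ) (Y : Mat3) :
    ((diagTorus v : Mat3) * (diagTorus v : Mat3)ᵀ * Y).trace =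
      ∑ i, Real.exp (2 * logWeight v i) * Y i i := by
  simp only [diagTorus, expDiag, logWeight, Matrix.trace, Matrix.diag, Matrix.mul_apply,
    Fin.sum_univ_three, Matrix.transpose_apply, two_mul, Real.exp_add]
  simp

/-- Domination with the diagonal of `Y` split into the entries that `μ` contracts below `ε` and the
others. The bound `M` is chosen so that a weight at most `-M` gives the factor `ε`; on the other
entries `v` must stretch by `K`. -/
theorem diagTorus_dominates {W : Mat3} (hW : W.PosDef) :
    ∃ M : ℝ, ∀ μ : ℝ × ℝ, ∃ N : ℝ, ∀ v : ℝ × ℝ,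
      (∀ i, logWeight μ i ≤ -M ∨ N ≤ logWeight v i) → ∀ Y : Mat3, Y.PosDef →
        orbitTrace W 1 Y ≤ orbitTrace W (diagTorus μ) Y →
          orbitTrace W 1 Y ≤ orbitTrace W (diagTorus v) Y := by
  obtain ⟨ε, hε, h⟩ := exists_domination hW
  refine ⟨-Real.log ε / 2, fun μ => ?_⟩
  obtain ⟨K, hK, h⟩ := h (∑ i, Real.exp (2 * logWeight μ i))
    (Finset.sum_nonneg fun i _ => (Real.exp_pos _).le)
  refine ⟨K, fun v hv Y hY => ?_⟩
  classical
  have hd : ∀ i, 0 ≤ Y i i := fun i => hY.posSemidef.diag_nonneg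
  set p : Fin 3 → Prop := fun i => ¬ logWeight μ i ≤ -(-Real.log ε / 2) with hp
  refine h (diagTorus v) (diagTorus μ) Y hY (∑ i with p i, Y i i) (∑ i with ¬ p i, Y i i)
    (Finset.sum_nonneg fun i _ => hd i) (Finset.sum_filter_add_sum_filter_not _ _ _) ?_ ?_
  · rw [trace_diagTorus, Finset.mul_sum]
    refine (Finset.sum_le_sum fun i hi => ?_).trans
      (Finset.sum_le_sum_of_subset_of_nonneg (Finset.filter_subset p _)
        fun i _ _ => mul_nonneg (Real.exp_pos _).le (hd i))
    refine mul_le_mul_of_nonneg_right ?_ (hd i)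
    have h1 := (hv i).resolve_left (Finset.mem_filter.1 hi).2
    have h2 := Real.add_one_le_exp (2 * logWeight v i)
    linarith
  · rw [trace_diagTorus, ← Finset.sum_filter_add_sum_filter_not _ p, Finset.mul_sum,
      Finset.mul_sum]
    refine add_le_add (Finset.sum_le_sum fun i _ => mul_le_mul_of_nonneg_right ?_ (hd i))
      (Finset.sum_le_sum fun i hi => mul_le_mul_of_nonneg_right ?_ (hd i))
    · exact Finset.single_le_sum (f := fun i => Real.exp (2 * logWeight μ i))
        (fun i _ => (Real.exp_pos _).le) (Finset.mem_univ i)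
    · have h1 := not_not.1 (Finset.mem_filter.1 hi).2
      rw [← Real.le_log_iff_exp_le hε]
      linarith

theorem logWeight_nsmul (n : ℕ) (v : ℝ × ℝ) (i : Fin 3) :
    logWeight (n • v) i = n * logWeight v i := by
  fin_cases i <;> simp [logWeight]
  ring

/-- As all weights are nonzero, multiples of `v` contract every negative weight and stretch every
positive one without bound. -/
theorem finitelyCut_diagTorus_zmultiples {W : Mat3} (hW : W.PosDef) {v : ℝ × ℝ}
    (hv : ∀ i, logWeight v i ≠ 0) {Γ : Subgroup SL(3, ℝ)}
    (hΓ : IsParameterGroup diagTorus (AddSubgroup.zmultiples v) Γ) : FinitelyCut Γ W := by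
  refine finitelyCut_of_zmultiples hΓ fun w hw => ?_
  have hw0 : ∀ i, logWeight w i ≠ 0 := by
    rcases hw with rfl | rfl
    · exact hv
    · intro i h
      refine hv i ?_
      fin_cases i <;> simp [logWeight] at h ⊢ <;> linarith
  obtain ⟨M, h⟩ := diagTorus_dominates hW
  have hev : ∀ (A : ℝ) (i : Fin 3), ∀ᶠ n : ℕ in Filter.atTop, A ≤ n * |logWeight w i| := by
    intro A i
    have ht : Filter.Tendsto (fun n : ℕ => (n : ℝ) * |logWeight w i|) Filter.atTop Filter.atTop :=
      tendsto_natCast_atTop_atTop.atTop_mul_const (abs_pos.2 (hw0 i))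
    exact ht.eventually_ge_atTop A
  obtain ⟨m₀, hm₀⟩ := (Filter.eventually_all.2 (hev M)).exists
  obtain ⟨N, h⟩ := h (m₀ • w)
  obtain ⟨n₀, hn₀⟩ := Filter.eventually_atTop.1 (Filter.eventually_all.2 (hev N))
  refine ⟨m₀, n₀, fun n hn => h (n • w) fun i => ?_⟩
  rw [logWeight_nsmul, logWeight_nsmul]
  have h1 := hm₀ i
  have h2 := hn₀ n hn i
  rcases lt_or_gt_of_ne (hw0 i) with h0 | h0
  · left
    rw [abs_of_neg h0] at h1
    linarith
  · right
    rwa [abs_of_pos h0] at h2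

/-- A discrete noncyclic subgroup of `ℝ²` with two generators has linearly independent
generators. -/
theorem det_ne_zero_of_finite_inter {v w : ℝ × ℝ}
    (hfin : ∀ K : Set (ℝ × ℝ), IsCompact K →
      ((AddSubgroup.closure {v, w} : Set (ℝ × ℝ)) ∩ K).Finite)
    (hnc : ∀ x, AddSubgroup.closure {v, w} ≠ AddSubgroup.zmultiples x) :
    v.1 * w.2 - v.2 * w.1 ≠ 0 := by
  intro hdet
  by_cases hv : v = 0
  · refine hnc w ?_
    rw [hv, AddSubgroup.closure_insert_zero, AddSubgroup.zmultiples_eq_closure]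
  obtain ⟨c, rfl⟩ : ∃ c : ℝ, w = c • v := by
    by_cases h1 : v.1 = 0
    · have h2 : v.2 ≠ 0 := fun h2 => hv (Prod.ext h1 h2)
      have h3 : w.1 = 0 := by
        rw [h1, zero_mul, zero_sub, neg_eq_zero, mul_eq_zero] at hdet
        exact hdet.resolve_left h2
      exact ⟨w.2 / v.2, Prod.ext (by simp [h1, h3]) (by simp [h2])⟩
    · refine ⟨w.1 / v.1, Prod.ext (by simp [h1]) ?_⟩
      simp only [Prod.smul_snd, smul_eq_mul]
      field_simp
      linarith
  have hmem : ∀ a ∈ AddSubgroup.closure {(1 : ℝ), c}, a • v ∈ AddSubgroup.closure {v, c • v} := by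
    intro a ha
    obtain ⟨m, n, rfl⟩ := AddSubgroup.mem_closure_pair.1 ha
    refine AddSubgroup.mem_closure_pair.2 ⟨m, n, ?_⟩
    rw [add_smul, smul_assoc, smul_assoc, one_smul]
  -- On a common line the group is a copy of the coefficient group `ℤ + ℤ c`: if dense, it has
  -- infinitely many points in a segment; if cyclic, the group itself is cyclic.
  rcases AddSubgroup.dense_or_cyclic (AddSubgroup.closure {(1 : ℝ), c}) with hd | ⟨q, hq⟩
  · have hsub := hd.open_subset_closure_inter (isOpen_Ioo (a := (0 : ℝ)) (b := 1))
    have hf : (Set.Ioo (0 : ℝ) 1 ∩ (AddSubgroup.closure {(1 : ℝ), c} : Set ℝ)).Finite := by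
      have hK : IsCompact ((fun t : ℝ => t • v) '' Set.Icc 0 1) :=
        isCompact_Icc.image (by fun_prop)
      refine Set.Finite.of_finite_image ((hfin _ hK).subset ?_)
        (smul_left_injective ℝ hv).injOn
      rintro _ ⟨t, ⟨ht, hta⟩, rfl⟩
      exact ⟨hmem t hta, t, Set.Ioo_subset_Icc_self ht, rfl⟩
    rw [hf.isClosed.closure_eq] at hsub
    exact Set.Ioo_infinite zero_lt_one (hf.subset hsub)
  · refine hnc (q • v) (le_antisymm ?_ ?_)
    · intro x hx
      obtain ⟨m, n, rfl⟩ := AddSubgroup.mem_closure_pair.1 hx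
      have : m • (1 : ℝ) + n • c ∈ AddSubgroup.closure {(1 : ℝ), c} :=
        AddSubgroup.mem_closure_pair.2 ⟨m, n, rfl⟩
      rw [hq, AddSubgroup.mem_closure_singleton] at this
      obtain ⟨k, hk⟩ := this
      refine AddSubgroup.mem_zmultiples_iff.2 ⟨k, ?_⟩
      rw [← smul_assoc, hk, add_smul, smul_assoc, smul_assoc, one_smul]
    · rw [AddSubgroup.zmultiples_le]
      refine hmem q ?_
      rw [hq]
      exact AddSubgroup.subset_closure rfl

/-- Round down the coordinates of `p` in the basis `v, w`, given by Cramer's rule. -/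
theorem exists_mem_closure_near {v w : ℝ × ℝ} (hdet : v.1 * w.2 - v.2 * w.1 ≠ 0) :
    ∃ C : ℝ, ∀ p : ℝ × ℝ, ∃ x ∈ AddSubgroup.closure {v, w},
      |x.1 - p.1| ≤ C ∧ |x.2 - p.2| ≤ C := by
  refine ⟨|v.1| + |w.1| + |v.2| + |w.2|, fun p => ?_⟩
  set d := v.1 * w.2 - v.2 * w.1 with hd
  set α := (p.1 * w.2 - p.2 * w.1) / d with hα
  set β := (v.1 * p.2 - v.2 * p.1) / d with hβ
  have h1 : α * v.1 + β * w.1 = p.1 := by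
    rw [hα, hβ]; field_simp; rw [hd]; ring
  have h2 : α * v.2 + β * w.2 = p.2 := by
    rw [hα, hβ]; field_simp; rw [hd]; ring
  refine ⟨⌊α⌋ • v + ⌊β⌋ • w, AddSubgroup.mem_closure_pair.2 ⟨_, _, rfl⟩, ?_⟩
  have hfa : |(⌊α⌋ : ℝ) - α| ≤ 1 := by
    rw [abs_le]; constructor <;> linarith [Int.floor_le α, Int.lt_floor_add_one α]
  have hfb : |(⌊β⌋ : ℝ) - β| ≤ 1 := by
    rw [abs_le]; constructor <;> linarith [Int.floor_le β, Int.lt_floor_add_one β]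
  have key : ∀ a b q : ℝ, α * a + β * b = q → |⌊α⌋ * a + ⌊β⌋ * b - q| ≤ |a| + |b| := by
    intro a b q hq
    rw [← hq]
    calc _ = |(⌊α⌋ - α) * a + (⌊β⌋ - β) * b| := by congr 1; ring
      _ ≤ |(⌊α⌋ - α) * a| + |(⌊β⌋ - β) * b| := abs_add_le _ _
      _ = |⌊α⌋ - α| * |a| + |⌊β⌋ - β| * |b| := by rw [abs_mul, abs_mul]
      _ ≤ _ := by nlinarith [abs_nonneg a, abs_nonneg b]
  have k1 := key v.1 w.1 p.1 h1
  have k2 := key v.2 w.2 p.2 h2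
  constructor
  · simp only [Prod.fst_add, zsmul_eq_mul, Prod.fst_mul, Prod.fst_intCast] at k1 ⊢
    linarith [abs_nonneg v.2, abs_nonneg w.2]
  · simp only [Prod.snd_add, zsmul_eq_mul, Prod.snd_mul, Prod.snd_intCast] at k2 ⊢
    linarith [abs_nonneg v.1, abs_nonneg w.1]

theorem finitelyCut_diagTorus_closure_pair {W : Mat3} (hW : W.PosDef) {v w : ℝ × ℝ}
    {Γ : Subgroup SL(3, ℝ)} (hΓ : IsParameterGroup diagTorus (AddSubgroup.closure {v, w}) Γ)
    (hfc : FiniteOnCompacts Γ) (hcyc : ¬ IsCyclic Γ) : FinitelyCut Γ W := by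
  have hfin := fun K => hΓ.finite_inter continuous_diagTorus injective_diagTorus hfc (K := K)
  have hdet := det_ne_zero_of_finite_inter hfin (hΓ.ne_zmultiples diagTorus_add hcyc)
  obtain ⟨C, hC⟩ := exists_mem_closure_near hdet
  obtain ⟨M, h⟩ := diagTorus_dominates hW
  have hμ : ∀ i, ∃ μ ∈ AddSubgroup.closure {v, w}, ∀ j, j ≠ i → logWeight μ j ≤ -M := by
    intro i
    -- The target has two weights `-(M + 2 C)` and its `i`-th weight twice as large and positive.
    -- Approximation costs at most `C` in the first two weights and `2 C` in the third, minus their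
    -- sum.
    obtain ⟨μ, hμ, h1, h2⟩ := hC (![(2 * (M + 2 * C), -(M + 2 * C)),
      (-(M + 2 * C), 2 * (M + 2 * C)), (-(M + 2 * C), -(M + 2 * C))] i)
    have hC0 : 0 ≤ C := (abs_nonneg _).trans h1
    refine ⟨μ, hμ, fun j hj => ?_⟩
    rw [abs_le] at h1 h2
    fin_cases i <;> fin_cases j <;> simp [logWeight] at hj h1 h2 ⊢ <;> linarith
  choose μ hμL hμ using hμ
  choose N hN using fun i => h (μ i)
  set R := |N 0| + |N 1| + |N 2| with hR
  have hNR : ∀ i, N i ≤ R := by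
    intro i
    have h0 := abs_nonneg (N 0)
    have h1 := abs_nonneg (N 1)
    have h2 := abs_nonneg (N 2)
    have h3 := le_abs_self (N i)
    fin_cases i <;> simp at h3 ⊢ <;> linarith
  refine ⟨diagTorus '' (((AddSubgroup.closure {v, w} : Set (ℝ × ℝ)) ∩
    Set.Icc (-2 * R, -2 * R) (R, R)) ∪ Set.range μ),
    ((hfin _ isCompact_Icc).union (Set.finite_range μ)).image _, ?_, ?_⟩
  · rintro _ ⟨x, ⟨hx, -⟩ | ⟨i, rfl⟩, rfl⟩
    · exact (hΓ _).2 ⟨x, hx, rfl⟩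
    · exact (hΓ _).2 ⟨μ i, hμL i, rfl⟩
  intro Y hY hS g hg
  obtain ⟨x, hx, rfl⟩ := (hΓ g).1 hg
  -- An element with one large weight is dominated by the `μ i` that contracts the other two. If all
  -- weights are below `R`, their zero sum keeps them above `-2 R`, and only finitely many elements
  -- remain.
  by_cases hbig : ∃ i, R ≤ logWeight x i
  · obtain ⟨i, hi⟩ := hbig
    refine hN i x (fun j => ?_) Y hY (hS _ ⟨μ i, Or.inr ⟨i, rfl⟩, rfl⟩)
    by_cases hj : j = i
    · subst hj
      exact Or.inr ((hNR j).trans hi)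
    · exact Or.inl (hμ i j hj)
  · push Not at hbig
    have h0 := hbig 0
    have h1 := hbig 1
    have h2 := hbig 2
    simp [logWeight] at h0 h1 h2
    refine hS _ ⟨x, Or.inl ⟨hx, ?_⟩, rfl⟩
    rw [Set.mem_Icc, Prod.le_def, Prod.le_def]
    refine ⟨⟨?_, ?_⟩, ?_, ?_⟩ <;> simp only <;> linarith

theorem trace_blockGroup (v : ℝ × ℝ) {Y : Mat3} (hY : Y.IsSymm) :
    ((blockGroup v : Mat3) * (blockGroup v : Mat3)ᵀ * Y).trace =
      Real.exp v.1 ^ 2 * ((1 + v.2 ^ 2) * Y 0 0 + 2 * v.2 * Y 0 1 + Y 1 1) +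
        Real.exp (-2 * v.1) ^ 2 * Y 2 2 := by
  have h : Y 1 0 = Y 0 1 := hY.apply 0 1
  simp only [blockGroup, expBlock, Matrix.trace, Matrix.diag, Matrix.mul_apply,
    Fin.sum_univ_three, Matrix.transpose_apply, h]
  simp
  ring

theorem quadratic_nonneg {Y : Mat3} (hY : Y.PosSemidef) (a b : ℝ) :
    0 ≤ a ^ 2 * Y 0 0 + 2 * a * b * Y 0 1 + b ^ 2 * Y 1 1 := by
  have h : Y 1 0 = Y 0 1 := by simpa using hY.1.apply 0 1
  have := hY.dotProduct_mulVec_nonneg ![a, b, 0]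
  simp [dotProduct, Matrix.mulVec, Fin.sum_univ_three, h] at this
  linarith

/-- A shear `(1, u; 0, 1)` times its transpose has determinant one and trace `2 + u²`, so both
eigenvalues lie between `1 / (2 + u²)` and `2 + u²`: the distortion is only polynomial in `u`. -/
theorem shear_bounds {Y : Mat3} (hY : Y.PosSemidef) (u : ℝ) :
    Y 0 0 + Y 1 1 ≤ 2 * (1 + u ^ 2) * ((1 + u ^ 2) * Y 0 0 + 2 * u * Y 0 1 + Y 1 1) ∧
    (1 + u ^ 2) * Y 0 0 + 2 * u * Y 0 1 + Y 1 1 ≤ 2 * (1 + u ^ 2) * (Y 0 0 + Y 1 1) := by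
  have h0 : 0 ≤ Y 0 0 := hY.diag_nonneg
  have h1 : 0 ≤ Y 1 1 := hY.diag_nonneg
  constructor
  · have h2 := quadratic_nonneg hY u 1
    -- Completing the square: `1 + u²` times the required difference is this form plus `Y 0 0`.
    have h3 := quadratic_nonneg hY (u * (2 + u ^ 2)) (1 + u ^ 2)
    have h4 : 0 ≤ (1 + u ^ 2) *
        ((2 + u ^ 2) * ((1 + u ^ 2) * Y 0 0 + 2 * u * Y 0 1 + Y 1 1) - (Y 0 0 + Y 1 1)) := by
      nlinarith
    have h5 := nonneg_of_mul_nonneg_right h4 (by positivity)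
    nlinarith [mul_nonneg (sq_nonneg u) h0,
      mul_nonneg (sq_nonneg u) (add_nonneg h2 h0)]
  · have h2 := quadratic_nonneg hY u (-1)
    nlinarith [mul_nonneg (sq_nonneg u) h1]

theorem tendsto_exp_mul_shear {t : ℝ} (ht : 0 < t) (q : ℝ) :
    Filter.Tendsto (fun n : ℕ => Real.exp (-(n * t)) ^ 2 * (2 * (1 + (n * q) ^ 2))) Filter.atTop
      (𝓝 0) := by
  have hr : |Real.exp (-2 * t)| < 1 := by
    rw [abs_of_pos (Real.exp_pos _), Real.exp_lt_one_iff]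
    linarith
  have h0 := tendsto_pow_const_mul_const_pow_of_abs_lt_one 0 hr
  have h2 := tendsto_pow_const_mul_const_pow_of_abs_lt_one 2 hr
  have := (h0.const_mul 2).add (h2.const_mul (2 * q ^ 2))
  simp only [mul_zero, add_zero] at this
  refine this.congr fun n => ?_
  rw [← Real.exp_nat_mul, ← Real.exp_nat_mul]
  have : ((2 : ℕ) : ℝ) * -(n * t) = n * (-2 * t) := by push_cast; ring
  rw [this]
  ring

/-- Domination with the trace of `Y` split into the upper block and the last entry. Powers contract
one and stretch the other exponentially, and the shear of the block grows only polynomially. -/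
theorem finitelyCut_blockGroup_zmultiples {W : Mat3} (hW : W.PosDef) {v : ℝ × ℝ}
    (hv : v.1 ≠ 0) {Γ : Subgroup SL(3, ℝ)}
    (hΓ : IsParameterGroup blockGroup (AddSubgroup.zmultiples v) Γ) : FinitelyCut Γ W := by
  refine finitelyCut_of_zmultiples hΓ fun w hw => ?_
  have hw0 : w.1 ≠ 0 := by
    rcases hw with rfl | rfl
    · exact hv
    · simpa using hv
  obtain ⟨ε, hε, h⟩ := exists_domination hW
  have htr : ∀ (n : ℕ) (Y : Mat3), Y.PosDef →
      ((blockGroup (n • w) : Mat3) * (blockGroup (n • w) : Mat3)ᵀ * Y).trace =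
      Real.exp (n * w.1) ^ 2 * ((1 + (n * w.2) ^ 2) * Y 0 0 + 2 * (n * w.2) * Y 0 1 + Y 1 1) +
        Real.exp (-(2 * n * w.1)) ^ 2 * Y 2 2 := by
    intro n Y hY
    rw [trace_blockGroup _ hY.isSymm]
    simp only [Prod.smul_fst, Prod.smul_snd]
    simp only [nsmul_eq_mul]
    rw [show -2 * (n * w.1) = -(2 * n * w.1) by ring]
  have hexp2 : ∀ x : ℝ, Real.exp (-(2 * x)) ^ 2 = (Real.exp (-x) ^ 2) ^ 2 := by
    intro x
    rw [← Real.exp_nat_mul, ← Real.exp_nat_mul, ← Real.exp_nat_mul]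
    congr 1
    push_cast
    ring
  have hinv : ∀ x : ℝ, Real.exp x ^ 2 = (Real.exp (-x) ^ 2)⁻¹ := by
    intro x
    rw [Real.exp_neg, inv_pow, inv_inv]
  rcases lt_or_gt_of_ne hw0 with hneg | hpos
  · have hlim := tendsto_exp_mul_shear (neg_pos.2 hneg) w.2
    obtain ⟨m₀, hm₀⟩ := (hlim.eventually (ge_mem_nhds hε)).exists
    obtain ⟨K, hK, h⟩ := h (Real.exp (-(2 * m₀ * w.1)) ^ 2) (by positivity)
    have hlim2 := tendsto_exp_mul_shear (neg_pos.2 hneg) 0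
    obtain ⟨n₀, hn₀⟩ := Filter.eventually_atTop.1
      -- The last entry grows like the square of the quantity controlled here; being at least `1`
      -- and at least `K`, that quantity has a square at least `K`.
      (hlim2.eventually (ge_mem_nhds (show 0 < min 1 K⁻¹ by positivity)))
    refine ⟨m₀, n₀, fun n hn Y hY => h _ _ Y hY (Y 2 2) (Y 0 0 + Y 1 1)
      hY.posSemidef.diag_nonneg (by rw [Matrix.trace_fin_three]; ring) ?_ ?_⟩
    · rw [htr n Y hY]
      obtain ⟨h1, -⟩ := shear_bounds hY.posSemidef (n * w.2)
      have h00 : 0 ≤ Y 0 0 := hY.posSemidef.diag_nonneg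
      have h11 : 0 ≤ Y 1 1 := hY.posSemidef.diag_nonneg
      have h2 : 0 ≤ (1 + (n * w.2) ^ 2) * Y 0 0 + 2 * (n * w.2) * Y 0 1 + Y 1 1 :=
        nonneg_of_mul_nonneg_right ((add_nonneg h00 h11).trans h1) (by positivity)
      have h3 := hn₀ n hn
      simp only [mul_zero, ne_eq, OfNat.ofNat_ne_zero, not_false_eq_true, zero_pow, add_zero,
        mul_one] at h3
      have h4 : K ≤ Real.exp (-(2 * n * w.1)) ^ 2 := by
        set E := Real.exp (-(n * -w.1)) ^ 2 with hE
        have hE0 : 0 < E := by positivity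
        have h5 : Real.exp (-(2 * n * w.1)) ^ 2 = (E⁻¹) ^ 2 := by
          rw [hE, ← hinv, ← Real.exp_nat_mul, ← Real.exp_nat_mul, ← Real.exp_nat_mul]
          congr 1
          push_cast
          ring
        have h6 : K ≤ E⁻¹ := by
          rw [le_inv_comm₀ hK hE0]
          linarith [min_le_right 1 K⁻¹]
        have h7 : 1 ≤ E⁻¹ := by
          rw [one_le_inv₀ hE0]
          linarith [min_le_left 1 K⁻¹]
        rw [h5]
        nlinarith
      have h22 : 0 ≤ Y 2 2 := hY.posSemidef.diag_nonneg
      have h8 := mul_le_mul_of_nonneg_right h4 h22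
      have h9 : 0 ≤ Real.exp (n * w.1) ^ 2 *
          ((1 + (n * w.2) ^ 2) * Y 0 0 + 2 * (n * w.2) * Y 0 1 + Y 1 1) := by positivity
      linarith
    · rw [htr m₀ Y hY]
      obtain ⟨-, h2⟩ := shear_bounds hY.posSemidef (m₀ * w.2)
      have h00 : 0 ≤ Y 0 0 := hY.posSemidef.diag_nonneg
      have h11 : 0 ≤ Y 1 1 := hY.posSemidef.diag_nonneg
      have h3 : Real.exp (m₀ * w.1) ^ 2 *
          ((1 + (m₀ * w.2) ^ 2) * Y 0 0 + 2 * (m₀ * w.2) * Y 0 1 + Y 1 1) ≤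
          ε * (Y 0 0 + Y 1 1) := by
        refine (mul_le_mul_of_nonneg_left h2 (by positivity)).trans ?_
        rw [← mul_assoc]
        refine mul_le_mul_of_nonneg_right ?_ (add_nonneg h00 h11)
        rwa [mul_neg, neg_neg] at hm₀
      linarith
  · have hlim := tendsto_exp_mul_shear hpos w.2
    have hlim2 := tendsto_exp_mul_shear hpos 0
    obtain ⟨m₀, hm₀⟩ := (hlim2.eventually
      (ge_mem_nhds (show 0 < min 1 ε by positivity))).exists
    obtain ⟨K, hK, h⟩ := h (Real.exp (m₀ * w.1) ^ 2 * (2 * (1 + (m₀ * w.2) ^ 2))) (by positivity)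
    obtain ⟨n₀, hn₀⟩ := Filter.eventually_atTop.1
      (hlim.eventually (ge_mem_nhds (show 0 < K⁻¹ by positivity)))
    refine ⟨m₀, n₀, fun n hn Y hY => h _ _ Y hY (Y 0 0 + Y 1 1) (Y 2 2)
      (add_nonneg hY.posSemidef.diag_nonneg hY.posSemidef.diag_nonneg)
      (by rw [Matrix.trace_fin_three]) ?_ ?_⟩
    · rw [htr n Y hY]
      obtain ⟨h1, -⟩ := shear_bounds hY.posSemidef (n * w.2)
      have h22 : 0 ≤ Y 2 2 := hY.posSemidef.diag_nonneg
      have h3 := hn₀ n hn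
      have hs : 0 ≤ Y 0 0 + Y 1 1 :=
        add_nonneg hY.posSemidef.diag_nonneg hY.posSemidef.diag_nonneg
      set E := Real.exp (-(n * w.1)) ^ 2 with hE
      have hE0 : 0 < E := by positivity
      set B := 2 * (1 + (n * w.2) ^ 2) with hB
      have hB0 : 0 < B := by positivity
      set q := (1 + (n * w.2) ^ 2) * Y 0 0 + 2 * (n * w.2) * Y 0 1 + Y 1 1
      have h4 : K ≤ (E * B)⁻¹ := by
        rw [le_inv_comm₀ hK (by positivity)]
        exact h3
      have h5 : K * (Y 0 0 + Y 1 1) ≤ E⁻¹ * q := by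
        calc _ ≤ (E * B)⁻¹ * (Y 0 0 + Y 1 1) := mul_le_mul_of_nonneg_right h4 hs
          _ ≤ (E * B)⁻¹ * (B * q) := mul_le_mul_of_nonneg_left h1 (by positivity)
          _ = E⁻¹ * q := by field_simp
      rw [hinv (n * w.1)]
      have h6 : 0 ≤ Real.exp (-(2 * n * w.1)) ^ 2 * Y 2 2 := by positivity
      linarith
    · rw [htr m₀ Y hY]
      obtain ⟨-, h2⟩ := shear_bounds hY.posSemidef (m₀ * w.2)
      have h22 : 0 ≤ Y 2 2 := hY.posSemidef.diag_nonneg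
      simp only [mul_zero, ne_eq, OfNat.ofNat_ne_zero, not_false_eq_true, zero_pow, add_zero,
        mul_one] at hm₀
      have h3 : Real.exp (-(2 * m₀ * w.1)) ^ 2 ≤ ε := by
        rw [mul_assoc, hexp2]
        set E := Real.exp (-(m₀ * w.1)) ^ 2
        have hE0 : 0 < E := by positivity
        nlinarith [min_le_left 1 ε, min_le_right 1 ε]
      have h4 := mul_le_mul_of_nonneg_right h3 h22
      have h5 := mul_le_mul_of_nonneg_left h2 (sq_nonneg (Real.exp (m₀ * w.1)))
      linarith

/-- Up to the factor `Y 0 0` the quadratic part does not depend on `Y`; this uniformity yields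
finiteness. -/
theorem orbitTrace_rowUnipotent {W Y : Mat3} (hW : W.IsSymm) (hY : Y.IsSymm) (v : ℝ × ℝ) :
    orbitTrace W (rowUnipotent v) Y - orbitTrace W 1 Y =
      Y 0 0 * (v.1 ^ 2 * W 1 1 + 2 * v.1 * v.2 * W 1 2 + v.2 ^ 2 * W 2 2) +
        2 * (v.1 * (W * Y) 1 0 + v.2 * (W * Y) 2 0) := by
  have h1 := hW.apply 0 1
  have h2 := hW.apply 0 2
  have h3 := hW.apply 1 2
  have h4 := hY.apply 0 1
  have h5 := hY.apply 0 2
  have h6 := hY.apply 1 2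
  simp only [orbitTrace, rowUnipotent, Matrix.trace, Matrix.diag, Matrix.mul_apply,
    Fin.sum_univ_three, Matrix.SpecialLinearGroup.coe_one, Matrix.transpose_apply, h1, h2, h3, h4,
    h5, h6]
  simp
  ring

theorem finitelyCut_rowUnipotent_zmultiples {W : Mat3} (hW : W.PosDef) {Γ : Subgroup SL(3, ℝ)}
    (hΓ : IsParameterGroup rowUnipotent (AddSubgroup.zmultiples ((1, 0) : ℝ × ℝ)) Γ) :
    FinitelyCut Γ W := by
  refine finitelyCut_of_zmultiples hΓ fun w hw => ⟨1, 1, fun n hn Y hY h1 => ?_⟩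
  have hw2 : w.2 = 0 := by rcases hw with rfl | rfl <;> simp
  rw [← sub_nonneg, orbitTrace_rowUnipotent hW.isSymm hY.isSymm] at h1 ⊢
  have hn' : (1 : ℝ) ≤ n := by exact_mod_cast hn
  simp only [Prod.smul_fst, Prod.smul_snd, hw2, one_smul, smul_zero] at h1 ⊢
  simp only [nsmul_eq_mul]
  have hY0 : 0 < Y 0 0 := hY.diag_pos
  have hW1 : 0 < W 1 1 := hW.diag_pos
  have h2 : 0 ≤ Y 0 0 * W 1 1 * w.1 ^ 2 := by positivity
  have h3 : 0 ≤ n * (Y 0 0 * W 1 1 * w.1 ^ 2 + 2 * (w.1 * (W * Y) 1 0)) := by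
    apply mul_nonneg (by linarith)
    linarith
  -- For `f n = q n² + l n` one has `f n = n f 1 + n (n - 1) q`.
  nlinarith [mul_nonneg (mul_nonneg (by linarith : (0 : ℝ) ≤ n) (sub_nonneg.2 hn')) h2]

theorem finitelyCut_rowUnipotent_closure_pair {W : Mat3} (hW : W.PosDef) {Γ : Subgroup SL(3, ℝ)}
    (hΓ : IsParameterGroup rowUnipotent
      (AddSubgroup.closure {((1, 0) : ℝ × ℝ), ((0, 1) : ℝ × ℝ)}) Γ)
    (hfc : FiniteOnCompacts Γ) : FinitelyCut Γ W := by
  have hfin := fun K => hΓ.finite_inter continuous_rowUnipotent injective_rowUnipotent hfc (K := K)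
  have hmem : ∀ m n : ℤ, ((m, n) : ℝ × ℝ) ∈
      AddSubgroup.closure {((1, 0) : ℝ × ℝ), ((0, 1) : ℝ × ℝ)} := fun m n =>
    AddSubgroup.mem_closure_pair.2 ⟨m, n, by simp⟩
  obtain ⟨c, hc, hcW⟩ := exists_posDef_sub hW
  have hq : ∀ m n : ℝ, c * (m ^ 2 + n ^ 2) ≤ m ^ 2 * W 1 1 + 2 * m * n * W 1 2 + n ^ 2 * W 2 2 := by
    intro m n
    have h := hcW.posSemidef.dotProduct_mulVec_nonneg ![0, m, n]
    have h3 : W 2 1 = W 1 2 := hW.isSymm.apply 1 2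
    simp [dotProduct, Matrix.mulVec, Fin.sum_univ_three, h3, Matrix.one_apply] at h
    linarith
  set Q := |W 1 1| + 2 * |W 1 2| + |W 2 2| with hQ
  -- Outside the box of radius `R` the form is at least `c R² ≥ Q`, and `Q` bounds it on vectors
  -- with entries `0` and `1`.
  obtain ⟨R, hR⟩ := exists_nat_ge (1 + Q / c)
  have hQ0 : 0 ≤ Q := by positivity
  have hR1 : (1 : ℝ) ≤ R := by linarith [div_nonneg hQ0 hc.le]
  have hRQ : Q ≤ c * (R : ℝ) ^ 2 := by
    have : Q ≤ c * R := by
      rw [mul_comm, ← div_le_iff₀ hc]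
      linarith
    nlinarith
  refine ⟨rowUnipotent '' ((AddSubgroup.closure {((1, 0) : ℝ × ℝ), ((0, 1) : ℝ × ℝ)} :
    Set (ℝ × ℝ)) ∩ Set.Icc (-R, -R) (R, R)), (hfin _ isCompact_Icc).image _, ?_, ?_⟩
  · rintro _ ⟨x, ⟨hx, -⟩, rfl⟩
    exact (hΓ _).2 ⟨x, hx, rfl⟩
  intro Y hY hS
  suffices h : ∀ (k : ℕ) (m n : ℤ), m.natAbs + n.natAbs ≤ k →
      orbitTrace W 1 Y ≤ orbitTrace W (rowUnipotent (m, n)) Y by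
    intro g hg
    obtain ⟨x, hx, rfl⟩ := (hΓ g).1 hg
    obtain ⟨m, n, rfl⟩ := AddSubgroup.mem_closure_pair.1 hx
    have := h _ m n le_rfl
    simpa using this
  intro k
  induction k with
  | zero =>
    intro m n hmn
    obtain ⟨rfl, rfl⟩ : m = 0 ∧ n = 0 := by omega
    have : rowUnipotent ((0 : ℤ), (0 : ℤ)) = 1 := by
      rw [Int.cast_zero]
      exact map_zero_of_map_add rowUnipotent_add
    rw [this]
  | succ k ih =>
    intro m n hmn
    by_cases hbox : m.natAbs ≤ R ∧ n.natAbs ≤ R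
    · refine hS _ ⟨_, ⟨hmem m n, ?_⟩, rfl⟩
      have h1 : -(R : ℤ) ≤ m := by omega
      have h2 : m ≤ (R : ℤ) := by omega
      have h3 : -(R : ℤ) ≤ n := by omega
      have h4 : n ≤ (R : ℤ) := by omega
      exact ⟨⟨show -(R : ℝ) ≤ (m : ℝ) by exact_mod_cast h1,
        show -(R : ℝ) ≤ (n : ℝ) by exact_mod_cast h3⟩,
        show (m : ℝ) ≤ (R : ℝ) by exact_mod_cast h2,
        show (n : ℝ) ≤ (R : ℝ) by exact_mod_cast h4⟩
    -- Needed for the descent: halving with rounding down fixes `-1`, but strictly decreases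
    -- absolute values above `1`.
    have hR1' : 1 ≤ R := by exact_mod_cast hR1
    have hlarge : R < m.natAbs ∨ R < n.natAbs := by omega
    -- Split the vector into two nearly equal halves differing by `(d, e)` with entries `0` or `1`.
    -- The polynomial exceeds the sum of its values at the halves by `Y 0 0 / 2` times `q(m, n) -
    -- q(d, e)`, nonnegative outside the box.
    have h1 := ih (m / 2) (n / 2) (by omega)
    have h2 := ih (m - m / 2) (n - n / 2) (by omega)
    rw [← sub_nonneg, orbitTrace_rowUnipotent hW.isSymm hY.isSymm] at h1 h2 ⊢
    have hY0 : 0 < Y 0 0 := hY.diag_pos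
    obtain ⟨d, hd, hd01⟩ : ∃ d : ℤ, m = 2 * (m / 2) + d ∧ (d = 0 ∨ d = 1) :=
      ⟨m % 2, by omega, by omega⟩
    obtain ⟨e, he, he01⟩ : ∃ e : ℤ, n = 2 * (n / 2) + e ∧ (e = 0 ∨ e = 1) :=
      ⟨n % 2, by omega, by omega⟩
    have hdq : (d : ℝ) ^ 2 * W 1 1 + 2 * d * e * W 1 2 + (e : ℝ) ^ 2 * W 2 2 ≤ Q := by
      have a1 := le_abs_self (W 1 1)
      have a2 := le_abs_self (W 1 2)
      have a3 := le_abs_self (W 2 2)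
      have b1 := abs_nonneg (W 1 1)
      have b2 := abs_nonneg (W 1 2)
      have b3 := abs_nonneg (W 2 2)
      rcases hd01 with rfl | rfl <;> rcases he01 with rfl | rfl <;> simp <;> linarith
    have hmn2 : (R : ℝ) ^ 2 ≤ (m : ℝ) ^ 2 + (n : ℝ) ^ 2 := by
      rcases hlarge with h | h
      · have h' : (R : ℝ) < |(m : ℝ)| := by
          rw [← Int.cast_abs, ← Nat.cast_natAbs]
          exact_mod_cast h
        rw [← sq_abs (m : ℝ)]
        nlinarith [sq_nonneg (n : ℝ)]
      · have h' : (R : ℝ) < |(n : ℝ)| := by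
          rw [← Int.cast_abs, ← Nat.cast_natAbs]
          exact_mod_cast h
        rw [← sq_abs (n : ℝ)]
        nlinarith [sq_nonneg (m : ℝ)]
    have hqm := hq m n
    have hcR := mul_le_mul_of_nonneg_left hmn2 hc.le
    have hmR : (m : ℝ) = 2 * ((m / 2 : ℤ) : ℝ) + d := by exact_mod_cast hd
    have hnR : (n : ℝ) = 2 * ((n / 2 : ℤ) : ℝ) + e := by exact_mod_cast he
    push_cast at h1 h2 ⊢
    set a : ℝ := ((m / 2 : ℤ) : ℝ)
    set b : ℝ := ((n / 2 : ℤ) : ℝ)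
    have hgap : 0 ≤ Y 0 0 * (((m : ℝ) ^ 2 * W 1 1 + 2 * m * n * W 1 2 + (n : ℝ) ^ 2 * W 2 2) -
        ((d : ℝ) ^ 2 * W 1 1 + 2 * d * e * W 1 2 + (e : ℝ) ^ 2 * W 2 2)) :=
      mul_nonneg hY0.le (by linarith)
    rw [hmR, hnR] at h2 hgap ⊢
    linarith

end FinitelySidedTypes

end DirichletSelberg

namespace DirichletSelberg

/-! ### Infinitely sided types: prescribing the orbit trace through `Y` -/

section InfinitelySidedTypes

/-- The symmetric matrix with the triangular decomposition
`d₁ (1, l₂, l₃)⊗(1, l₂, l₃) + d₂ (0, 1, m)⊗(0, 1, m) + d₃ e₃⊗e₃`. -/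
def ldl (d₁ d₂ d₃ l₂ l₃ m : ℝ) : Mat3 :=
  !![d₁, d₁ * l₂, d₁ * l₃;
     d₁ * l₂, d₁ * l₂ ^ 2 + d₂, d₁ * l₂ * l₃ + d₂ * m;
     d₁ * l₃, d₁ * l₂ * l₃ + d₂ * m, d₁ * l₃ ^ 2 + d₂ * m ^ 2 + d₃]

theorem posDef_ldl {d₁ d₂ d₃ : ℝ} (h₁ : 0 < d₁) (h₂ : 0 < d₂) (h₃ : 0 < d₃) (l₂ l₃ m : ℝ) :
    (ldl d₁ d₂ d₃ l₂ l₃ m).PosDef := by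
  refine posDef_iff_isSymm.2 ⟨?_, fun x hx => ?_⟩
  · ext i j
    fin_cases i <;> fin_cases j <;> simp [ldl]
  · have h : x ⬝ᵥ (ldl d₁ d₂ d₃ l₂ l₃ m *ᵥ x) =
        d₁ * (x 0 + l₂ * x 1 + l₃ * x 2) ^ 2 + d₂ * (x 1 + m * x 2) ^ 2 + d₃ * x 2 ^ 2 := by
      simp only [dotProduct, Matrix.mulVec, Fin.sum_univ_three, ldl]
      simp
      ring
    rw [h]
    have a1 : 0 ≤ d₁ * (x 0 + l₂ * x 1 + l₃ * x 2) ^ 2 := by positivity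
    have a2 : 0 ≤ d₂ * (x 1 + m * x 2) ^ 2 := by positivity
    have a3 : 0 ≤ d₃ * x 2 ^ 2 := by positivity
    by_cases h2 : x 2 = 0
    · by_cases h1 : x 1 = 0
      · have h0 : x 0 ≠ 0 := by
          intro h0
          apply hx
          ext i
          fin_cases i <;> simp [h0, h1, h2]
        have : 0 < d₁ * (x 0 + l₂ * x 1 + l₃ * x 2) ^ 2 := by
          rw [h1, h2, mul_zero, mul_zero, add_zero, add_zero]
          positivity
        linarith
      · have : 0 < d₂ * (x 1 + m * x 2) ^ 2 := by
          rw [h2, mul_zero, add_zero]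
          positivity
        linarith
    · have : 0 < d₃ * x 2 ^ 2 := by positivity
      linarith

/-- The quadratic form of a symmetric matrix. -/
def quadForm (W : Mat3) (x y z : ℝ) : ℝ :=
  W 0 0 * x ^ 2 + W 1 1 * y ^ 2 + W 2 2 * z ^ 2 + 2 * W 0 1 * x * y + 2 * W 0 2 * x * z +
    2 * W 1 2 * y * z

theorem orbitTrace_ldl {W : Mat3} (hW : W.IsSymm) (g : SL(3, ℝ)) (d₁ d₂ d₃ l₂ l₃ m : ℝ) :
    orbitTrace W g (ldl d₁ d₂ d₃ l₂ l₃ m) =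
      d₁ * quadForm W ((g : Mat3) 0 0 + (g : Mat3) 1 0 * l₂ + (g : Mat3) 2 0 * l₃)
        ((g : Mat3) 0 1 + (g : Mat3) 1 1 * l₂ + (g : Mat3) 2 1 * l₃)
        ((g : Mat3) 0 2 + (g : Mat3) 1 2 * l₂ + (g : Mat3) 2 2 * l₃) +
      d₂ * quadForm W ((g : Mat3) 1 0 + (g : Mat3) 2 0 * m)
        ((g : Mat3) 1 1 + (g : Mat3) 2 1 * m) ((g : Mat3) 1 2 + (g : Mat3) 2 2 * m) +
      d₃ * quadForm W ((g : Mat3) 2 0) ((g : Mat3) 2 1) ((g : Mat3) 2 2) := by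
  have h1 := hW.apply 0 1
  have h2 := hW.apply 0 2
  have h3 := hW.apply 1 2
  simp only [orbitTrace, Matrix.trace, Matrix.diag, Matrix.mul_apply, Fin.sum_univ_three,
    Matrix.transpose_apply, h1, h2, h3, quadForm]
  simp [ldl]
  ring

theorem orbitTrace_one_ldl {W : Mat3} (hW : W.IsSymm) (d₁ d₂ d₃ l₂ l₃ m : ℝ) :
    orbitTrace W 1 (ldl d₁ d₂ d₃ l₂ l₃ m) =
      d₁ * quadForm W 1 l₂ l₃ + d₂ * quadForm W 0 1 m + d₃ * quadForm W 0 0 1 := by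
  rw [orbitTrace_ldl hW]
  simp

/-- For integral `k` the target vanishes on integer points only at `(0, 0)` and `(1, k)`, and is
positive at the others. The pivots and `l₂` diagonalize its quadratic part; `l₃` and `m` then match
the linear coefficients. -/
theorem exists_orbitTrace_colUnipotent {W : Mat3} (hW : W.PosDef) (k : ℝ) :
    ∃ Y : Mat3, Y.PosDef ∧ ∀ v, orbitTrace W (colUnipotent v) Y - orbitTrace W 1 Y =
      (v.2 - k * v.1) ^ 2 + v.1 ^ 2 - v.1 := by
  have hw : 0 < W 2 2 := hW.diag_pos
  obtain ⟨d₁, hd₁⟩ : ∃ d₁, d₁ * W 2 2 = k ^ 2 + 1 := ⟨(k ^ 2 + 1) / W 2 2, by field_simp⟩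
  obtain ⟨l₂, hl₂⟩ : ∃ l₂, l₂ * (k ^ 2 + 1) = -k := ⟨-k / (k ^ 2 + 1), by field_simp⟩
  obtain ⟨d₂, hd₂⟩ : ∃ d₂, d₂ * W 2 2 * (k ^ 2 + 1) = 1 :=
    ⟨1 / (W 2 2 * (k ^ 2 + 1)), by field_simp⟩
  have h1 : 0 < d₁ := by
    refine pos_of_mul_pos_left (b := W 2 2) ?_ hw.le
    rw [hd₁]; positivity
  have h2 : 0 < d₂ := by
    refine pos_of_mul_pos_left (b := W 2 2) ?_ hw.le
    refine pos_of_mul_pos_left (b := k ^ 2 + 1) ?_ (by positivity)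
    rw [hd₂]; exact one_pos
  obtain ⟨l₃, hl₃⟩ : ∃ l₃, 2 * d₁ * (W 2 2 * l₃ + W 0 2 + W 1 2 * l₂) = -1 :=
    ⟨(-1 / (2 * d₁) - W 0 2 - W 1 2 * l₂) / W 2 2, by field_simp; ring⟩
  obtain ⟨m, hm⟩ : ∃ m, 2 * d₂ * (W 2 2 * m + W 1 2) = l₂ :=
    ⟨(l₂ / (2 * d₂) - W 1 2) / W 2 2, by field_simp; ring⟩
  refine ⟨ldl d₁ d₂ 1 l₂ l₃ m, posDef_ldl h1 h2 one_pos _ _ _, fun v => ?_⟩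
  rw [orbitTrace_ldl hW.isSymm, orbitTrace_one_ldl hW.isSymm]
  simp only [colUnipotent, quadForm]
  simp
  have h3 : d₂ * W 2 2 = 1 - (k ^ 2 + 1) * l₂ ^ 2 := by
    have h0 : k ^ 2 + 1 ≠ 0 := by positivity
    refine mul_right_cancel₀ h0 ?_
    rw [hd₂]
    linear_combination (l₂ * (k ^ 2 + 1) - k) * hl₂
  linear_combination (v.1 + v.2 * l₂) ^ 2 * hd₁ + v.2 ^ 2 * h3 + 2 * v.1 * v.2 * hl₂ +
    (v.1 + v.2 * l₂) * hl₃ + v.2 * hm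

/-- Completing the square in the last variable of `W` isolates the square; what remains is quadratic
in `v.1`. The Schur complement of `W` contributes `α * D` to the coefficient `A`, and the pivot `d₂
> 0` supplies the rest. -/
theorem exists_orbitTrace_fullUnipotent {W : Mat3} (hW : W.PosDef) :
    ∃ D : ℝ, ∀ α A : ℝ, 0 < α → α * D < A → ∀ b c B : ℝ, ∃ Y : Mat3, Y.PosDef ∧
      ∀ v, orbitTrace W (fullUnipotent v) Y - orbitTrace W 1 Y =
        α * ((v.2 + v.1 ^ 2 / 2 + b * v.1 + c) ^ 2 - c ^ 2) + A * v.1 ^ 2 + B * v.1 := by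
  have hw : 0 < W 2 2 := hW.diag_pos
  refine ⟨(W 1 1 - W 1 2 ^ 2 / W 2 2) / W 2 2, fun α A hα hA b c B => ?_⟩
  obtain ⟨d₁, hd₁⟩ : ∃ d₁, d₁ * W 2 2 = α := ⟨α / W 2 2, by field_simp⟩
  have h1 : 0 < d₁ := by
    refine pos_of_mul_pos_left (b := W 2 2) ?_ hw.le
    rwa [hd₁]
  obtain ⟨l₂, hl₂⟩ : ∃ l₂, W 1 2 = W 2 2 * (b - l₂) :=
    ⟨b - W 1 2 / W 2 2, by field_simp; ring⟩
  obtain ⟨l₃, hl₃⟩ : ∃ l₃, W 0 2 = W 2 2 * (c - l₃) - l₂ * W 1 2 :=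
    ⟨c - (W 0 2 + l₂ * W 1 2) / W 2 2, by field_simp; ring⟩
  obtain ⟨d₂, hd₂⟩ : ∃ d₂, A = d₂ * W 2 2 + d₁ * (W 1 1 - W 2 2 * (b - l₂) ^ 2) :=
    ⟨(A - d₁ * (W 1 1 - W 2 2 * (b - l₂) ^ 2)) / W 2 2, by field_simp; ring⟩
  have h2 : 0 < d₂ := by
    refine pos_of_mul_pos_left (b := W 2 2) ?_ hw.le
    have : α * ((W 1 1 - W 1 2 ^ 2 / W 2 2) / W 2 2) =
        d₁ * (W 1 1 - W 2 2 * (b - l₂) ^ 2) := by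
      rw [← hd₁, hl₂]; field_simp
    linarith
  obtain ⟨m, hm⟩ : ∃ m, B = 2 * d₁ * (W 0 1 - W 0 2 * (b - l₂) +
      (W 1 1 - W 2 2 * (b - l₂) ^ 2) * l₂) + 2 * d₂ * W 1 2 + 2 * d₂ * W 2 2 * m :=
    ⟨(B - (2 * d₁ * (W 0 1 - W 0 2 * (b - l₂) + (W 1 1 - W 2 2 * (b - l₂) ^ 2) * l₂) +
      2 * d₂ * W 1 2)) / (2 * d₂ * W 2 2), by field_simp; ring⟩
  refine ⟨ldl d₁ d₂ 1 l₂ l₃ m, posDef_ldl h1 h2 one_pos _ _ _, fun v => ?_⟩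
  rw [orbitTrace_ldl hW.isSymm, orbitTrace_one_ldl hW.isSymm]
  simp only [fullUnipotent, quadForm]
  simp
  rw [hm, hd₂, ← hd₁, hl₃, hl₂]
  ring

/-- With zero third weight the trace is a Laurent polynomial in `exp t` with exponents from `-2` to
`2`. The pivots set the outer coefficients; the middle ones are reached through `W 0 2` and `W 1 2`.
The target square vanishes exactly when `exp t` is `1` or `X`. -/
theorem exists_orbitTrace_diagTorus {W : Mat3} (hW : W.PosDef) (h02 : W 0 2 ≠ 0)
    (h12 : W 1 2 ≠ 0) {X : ℝ} (hX : 0 < X) :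
    ∃ Y : Mat3, Y.PosDef ∧ ∀ t : ℝ, orbitTrace W (diagTorus (t, -t)) Y - orbitTrace W 1 Y =
      ((Real.exp t - 1) * (Real.exp t - X) * Real.exp (-t)) ^ 2 := by
  have hw0 : 0 < W 0 0 := hW.diag_pos
  have hw1 : 0 < W 1 1 := hW.diag_pos
  obtain ⟨d₁, hd₁⟩ : ∃ d₁, d₁ * W 0 0 = 1 := ⟨1 / W 0 0, by field_simp⟩
  obtain ⟨d₂, hd₂⟩ : ∃ d₂, d₂ * W 1 1 = X ^ 2 := ⟨X ^ 2 / W 1 1, by field_simp⟩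
  have h1 : 0 < d₁ := by
    refine pos_of_mul_pos_left (b := W 0 0) ?_ hw0.le
    rw [hd₁]; exact one_pos
  have h2 : 0 < d₂ := by
    refine pos_of_mul_pos_left (b := W 1 1) ?_ hw1.le
    rw [hd₂]; positivity
  obtain ⟨l₃, hl₃⟩ : ∃ l₃, d₁ * l₃ * W 0 2 = -(1 + X) :=
    ⟨-(1 + X) / (d₁ * W 0 2), by field_simp⟩
  obtain ⟨m, hm⟩ : ∃ m, d₂ * m * W 1 2 = -X * (1 + X) :=
    ⟨-X * (1 + X) / (d₂ * W 1 2), by field_simp⟩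
  refine ⟨ldl d₁ d₂ 1 0 l₃ m, posDef_ldl h1 h2 one_pos _ _ _, fun t => ?_⟩
  rw [orbitTrace_ldl hW.isSymm, orbitTrace_one_ldl hW.isSymm]
  simp only [diagTorus, expDiag, quadForm]
  simp
  have hxy : Real.exp t * Real.exp (-t) = 1 := by rw [← Real.exp_add, add_neg_cancel, Real.exp_zero]
  set x := Real.exp t
  set y := Real.exp (-t)
  have hrhs : (x - 1) * (x - X) * y = x - (1 + X) + X * y := by
    linear_combination (x - (1 + X)) * hxy
  rw [hrhs]
  linear_combination (x ^ 2 - 1) * hd₁ + (y ^ 2 - 1) * hd₂ + 2 * (x - 1) * hl₃ +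
    2 * (y - 1) * hm - 2 * X * hxy

/-- The first pivot, of size `α`, produces the square, and the other parameters cancel its
by-products. As `α` tends to `0` the other two pivots tend to `β / W 1 1` and `γ / W 2 2`, so they
are positive for small `α`. -/
theorem exists_orbitTrace_blockGroup {W : Mat3} (hW : W.PosDef) (h12 : W 1 2 ≠ 0)
    {β γ : ℝ} (hβ : 0 < β) (hγ : 0 < γ) (κ : ℝ) :
    ∀ᶠ α : ℝ in 𝓝[>] 0, ∀ u₀ : ℝ, ∃ Y : Mat3, Y.PosDef ∧
      ∀ v, orbitTrace W (blockGroup v) Y =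
        α * (Real.exp v.1 * (v.2 - u₀) - κ * Real.exp (-2 * v.1)) ^ 2 + β * Real.exp v.1 ^ 2 +
          γ * Real.exp (-2 * v.1) ^ 2 := by
  have hw1 : 0 < W 1 1 := hW.diag_pos
  have hw2 : 0 < W 2 2 := hW.diag_pos
  obtain ⟨l₃, hl₃⟩ : ∃ l₃, W 1 2 * l₃ = -κ * W 1 1 := ⟨-κ * W 1 1 / W 1 2, by field_simp⟩
  obtain ⟨ν, hν⟩ : ∃ ν, W 0 1 = -ν * W 1 1 := ⟨-W 0 1 / W 1 1, by field_simp⟩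
  set D₂ : ℝ → ℝ := fun α => (β - α / W 1 1 * (W 0 0 + W 0 1 * ν)) / W 1 1 with hD₂
  set M : ℝ → ℝ := fun α => -(α / W 1 1 * l₃ * (W 0 2 + W 1 2 * ν)) / (D₂ α * W 1 2) with hM
  set D₃ : ℝ → ℝ := fun α =>
    (γ + α * κ ^ 2) / W 2 2 - α / W 1 1 * l₃ ^ 2 - D₂ α * M α ^ 2 with hD₃
  have hcD₂ : Continuous D₂ := by fun_prop
  have hD₂0 : 0 < D₂ 0 := by simp only [hD₂, zero_div, zero_mul, sub_zero]; positivity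
  have hcM : ContinuousAt M 0 := by
    refine ContinuousAt.div (by fun_prop) (by fun_prop) ?_
    exact mul_ne_zero hD₂0.ne' h12
  have hcD₃ : ContinuousAt D₃ 0 := by
    refine ContinuousAt.sub (by fun_prop) (hcD₂.continuousAt.mul (hcM.pow 2))
  have hD₃0 : 0 < D₃ 0 := by
    have : M 0 = 0 := by simp [hM]
    simp only [hD₃, this, zero_mul, add_zero, zero_div, sub_zero]
    simp only [ne_eq, OfNat.ofNat_ne_zero, not_false_eq_true, zero_pow, mul_zero, sub_zero]
    positivity
  filter_upwards [(hcD₂.continuousAt.eventually (lt_mem_nhds hD₂0)).filter_mono nhdsWithin_le_nhds,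
    (hcD₃.eventually (lt_mem_nhds hD₃0)).filter_mono nhdsWithin_le_nhds,
    self_mem_nhdsWithin] with α h2 h3 hα u₀
  have hα : 0 < α := hα
  have h1 : 0 < α / W 1 1 := by positivity
  refine ⟨ldl (α / W 1 1) (D₂ α) (D₃ α) (ν - u₀) l₃ (M α),
    posDef_ldl h1 h2 h3 _ _ _, fun v => ?_⟩
  rw [orbitTrace_ldl hW.isSymm]
  simp only [blockGroup, expBlock, quadForm]
  simp
  have e1 : α / W 1 1 * W 1 1 = α := by field_simp
  have e4 : D₂ α * W 1 1 + α / W 1 1 * (W 0 0 + W 0 1 * ν) = β := by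
    simp only [hD₂]; field_simp; ring
  have e5 : D₂ α * W 1 2 * M α + α / W 1 1 * l₃ * (W 0 2 + W 1 2 * ν) = 0 := by
    simp only [hM]; field_simp; ring
  have e6 : (α / W 1 1 * l₃ ^ 2 + D₂ α * M α ^ 2 + D₃ α) * W 2 2 = γ + α * κ ^ 2 := by
    simp only [hD₃]; field_simp; ring
  set d₁ := α / W 1 1
  set d₂ := D₂ α
  set d₃ := D₃ α
  set m := M α
  set x := Real.exp v.1
  set y := Real.exp (-(2 * v.1))
  rw [← e4]
  rw [hν] at *
  have e6' : γ = (d₁ * l₃ ^ 2 + d₂ * m ^ 2 + d₃) * W 2 2 - α * κ ^ 2 := by linarith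
  rw [e6', ← e1]
  linear_combination 2 * d₁ * x * y * (v.2 - u₀) * hl₃ + 2 * x * y * e5

theorem infinitelyCut_colUnipotent {W : Mat3} (hW : W.PosDef) {Γ : Subgroup SL(3, ℝ)}
    (hΓ : IsParameterGroup colUnipotent
      (AddSubgroup.closure {((0, 1) : ℝ × ℝ), ((1, 0) : ℝ × ℝ)}) Γ) : InfinitelyCut Γ W := by
  have hmem : ∀ m n : ℤ, ((m, n) : ℝ × ℝ) ∈
      AddSubgroup.closure {((0, 1) : ℝ × ℝ), ((1, 0) : ℝ × ℝ)} := fun m n =>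
    AddSubgroup.mem_closure_pair.2 ⟨n, m, by simp⟩
  refine infinitelyCut_of_forall_exists (Set.range fun k : ℤ => colUnipotent (1, k)) ?_ ?_ ?_
  · refine Set.infinite_range_of_injective fun k l h => ?_
    simpa using injective_colUnipotent h
  · rintro _ ⟨k, rfl⟩
    exact (hΓ _).2 ⟨_, by simpa using hmem 1 k, rfl⟩
  rintro _ ⟨k, rfl⟩
  obtain ⟨Y, hY, h⟩ := exists_orbitTrace_colUnipotent hW k
  refine ⟨Y, hY, ?_, fun s hs hs1 hsg => ?_⟩
  · have := h (1, k)
    simp only at this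
    linarith
  obtain ⟨v, hv, rfl⟩ := (hΓ s).1 hs
  obtain ⟨n, m, rfl⟩ := AddSubgroup.mem_closure_pair.1 hv
  have hvv : n • ((0, 1) : ℝ × ℝ) + m • ((1, 0) : ℝ × ℝ) = ((m : ℝ), (n : ℝ)) := by simp
  rw [hvv] at hs1 hsg ⊢
  rw [← sub_pos, h]
  simp only
  have hpos : 0 < (n - k * m) ^ 2 + m ^ 2 - m := by
    by_cases h0 : m = 0
    · have hn : n ≠ 0 := by
        rintro rfl
        refine hs1 ?_
        rw [h0, Int.cast_zero]
        exact map_zero_of_map_add colUnipotent_add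
      subst h0
      have : 0 < n ^ 2 := by positivity
      linarith
    by_cases h1 : m = 1
    · have hn : n ≠ k := by
        rintro rfl
        exact hsg (by rw [h1, Int.cast_one])
      subst h1
      have : 0 < (n - k) ^ 2 := by
        have := sub_ne_zero.2 hn
        positivity
      linarith
    · have : 0 < m * (m - 1) := by
        rcases lt_or_gt_of_ne h0 with h | h
        · exact mul_pos_of_neg_of_neg h (by omega)
        · exact mul_pos h (by omega)
      nlinarith [sq_nonneg (n - k * m)]
  exact_mod_cast hpos

theorem infinitelyCut_fullUnipotent_zmultiples {W : Mat3} (hW : W.PosDef) {Γ : Subgroup SL(3, ℝ)}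
    (hΓ : IsParameterGroup fullUnipotent (AddSubgroup.zmultiples ((1, -1 / 2) : ℝ × ℝ)) Γ) :
    InfinitelyCut Γ W := by
  obtain ⟨D, hD⟩ := exists_orbitTrace_fullUnipotent hW
  set A := |D| + 1 with hA
  have hA0 : 0 < A := by positivity
  have hsm : ∀ n : ℤ, n • ((1, -1 / 2) : ℝ × ℝ) = ((n : ℝ), -(n : ℝ) / 2) := fun n => by
    ext <;> simp; ring
  obtain ⟨N₀, hN₀⟩ := exists_nat_gt (4 * A + 1)
  refine infinitelyCut_of_forall_exists
    ((fun N : ℕ => fullUnipotent ((N : ℤ) • ((1, -1 / 2) : ℝ × ℝ))) '' Set.Ici N₀) ?_ ?_ ?_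
  · refine (Set.Ici_infinite N₀).image fun k _ l _ h => ?_
    have := injective_fullUnipotent h
    rw [hsm, hsm] at this
    simpa using congrArg Prod.fst this
  · rintro _ ⟨N, -, rfl⟩
    exact (hΓ _).2 ⟨_, AddSubgroup.zsmul_mem_zmultiples _ _, rfl⟩
  rintro _ ⟨N, hN, rfl⟩
  have hN : N₀ ≤ N := hN
  have hNR : 4 * A + 1 < N := hN₀.trans_le (by exact_mod_cast hN)
  -- This `b` makes the squared term `n (n - N) / 2`, so the function factors with zeros at `0` and
  -- `N`. Strictly between them both factors are negative, because `n (N - n) ≥ N - 1 > 4 A`.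
  obtain ⟨Y, hY, h⟩ := hD 1 A one_pos (by linarith [le_abs_self D]) ((1 - N) / 2) 0 (-A * N)
  have hf : ∀ n : ℤ, orbitTrace W (fullUnipotent (n • ((1, -1 / 2) : ℝ × ℝ))) Y -
      orbitTrace W 1 Y = n * (n - N) * (n * (n - N) / 4 + A) := by
    intro n
    rw [h, hsm]
    ring
  refine ⟨Y, hY, ?_, fun s hs hs1 hsg => ?_⟩
  · have := hf N
    simp at this ⊢
    linarith
  obtain ⟨v, hv, rfl⟩ := (hΓ s).1 hs
  obtain ⟨n, rfl⟩ := AddSubgroup.mem_zmultiples_iff.1 hv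
  rw [← sub_pos, hf]
  have hn0 : n ≠ 0 := by
    rintro rfl
    exact hs1 (by rw [zero_smul]; exact map_zero_of_map_add fullUnipotent_add)
  have hnN : n ≠ N := by
    rintro rfl
    exact hsg rfl
  by_cases hmid : 0 < n ∧ n < N
  · have h1 : (N : ℤ) - 1 ≤ n * (N - n) := by nlinarith
    have h2 : (N : ℝ) - 1 ≤ n * (N - n) := by exact_mod_cast h1
    nlinarith
  · have h1 : 0 < n * (n - N) := by
      rcases lt_or_gt_of_ne hn0 with h | h
      · exact mul_pos_of_neg_of_neg h (by omega)
      · exact mul_pos h (by omega)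
    have h2 : (0 : ℝ) < n * (n - N) := by exact_mod_cast h1
    positivity

theorem infinitelyCut_diagTorus_zmultiples {W : Mat3} (hW : W.PosDef) (h02 : W 0 2 ≠ 0)
    (h12 : W 1 2 ≠ 0) {s : ℝ} (hs : s ≠ 0) {Γ : Subgroup SL(3, ℝ)}
    (hΓ : IsParameterGroup diagTorus (AddSubgroup.zmultiples ((s, -s) : ℝ × ℝ)) Γ) :
    InfinitelyCut Γ W := by
  have hsm : ∀ n : ℤ, n • ((s, -s) : ℝ × ℝ) = ((n * s : ℝ), -(n * s)) := fun n => by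
    ext <;> simp
  refine infinitelyCut_of_forall_exists
    (Set.range fun n : ℤ => diagTorus (n • ((s, -s) : ℝ × ℝ))) ?_ ?_ ?_
  · refine Set.infinite_range_of_injective fun k l h => ?_
    have := injective_diagTorus h
    rw [hsm, hsm] at this
    simpa [hs] using congrArg Prod.fst this
  · rintro _ ⟨N, rfl⟩
    exact (hΓ _).2 ⟨_, AddSubgroup.zsmul_mem_zmultiples _ _, rfl⟩
  rintro _ ⟨N, rfl⟩
  obtain ⟨Y, hY, h⟩ := exists_orbitTrace_diagTorus hW h02 h12 (Real.exp_pos (N * s))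
  refine ⟨Y, hY, ?_, fun g hg hg1 hgN => ?_⟩
  · have := h (N * s)
    simp only [hsm]
    simp only [sub_self, mul_zero, zero_mul, ne_eq, OfNat.ofNat_ne_zero, not_false_eq_true,
      zero_pow] at this
    linarith
  obtain ⟨v, hv, rfl⟩ := (hΓ g).1 hg
  obtain ⟨n, rfl⟩ := AddSubgroup.mem_zmultiples_iff.1 hv
  simp only [hsm] at hg1 hgN ⊢
  rw [← sub_pos, h]
  have h1 : Real.exp (n * s) - 1 ≠ 0 := by
    intro h0
    rw [sub_eq_zero, Real.exp_eq_one_iff] at h0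
    refine hg1 ?_
    rw [h0, neg_zero]
    exact map_zero_of_map_add diagTorus_add
  have h2 : Real.exp (n * s) - Real.exp (N * s) ≠ 0 := by
    intro h0
    rw [sub_eq_zero, Real.exp_eq_exp] at h0
    exact hgN (by rw [h0])
  have h3 := Real.exp_ne_zero (-(n * s))
  positivity

/-- In a subgroup of `ℝ²` with arbitrarily small and faithful first coordinates there are elements
whose first coordinate is small compared with those of a given finite set, and whose second
coordinate is not small. -/
theorem exists_small_fst {L : AddSubgroup (ℝ × ℝ)}
    (hfin : ∀ K : Set (ℝ × ℝ), IsCompact K → ((L : Set (ℝ × ℝ)) ∩ K).Finite)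
    (hinj : ∀ x ∈ L, x.1 = 0 → x = 0) (hsmall : ∀ δ > 0, ∃ x ∈ L, x.1 ≠ 0 ∧ |x.1| < δ)
    {h : ℝ → ℝ} (hc : ContinuousAt h 0) (h0 : h 0 = 0) (hpos : ∀ t, t ≠ 0 → 0 < h t)
    {T : Set (ℝ × ℝ)} (hT : T.Finite) (hTL : T ⊆ L) {p : ℝ → Prop} (hp : ∀ᶠ θ in 𝓝[>] 0, p θ) :
    ∃ θ : ℝ, 0 < θ ∧ p θ ∧ (∀ s ∈ T, s ≠ 0 → θ < h s.1) ∧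
      ∃ g ∈ L, g ≠ 0 ∧ |g.1| ≤ 1 ∧ 2 < |g.2| ∧ h g.1 < θ := by
  have hT' := hT.union (hfin _ (isCompact_Icc (a := ((-1, -2) : ℝ × ℝ)) (b := (1, 2))))
  -- Keeping `θ` below `h` on the nonzero group elements of this box too forces an element with `h
  -- g.1 < θ` and `|g.1| ≤ 1` out of the box, hence to have `|g.2| > 2`.
  set T' := T ∪ ((L : Set (ℝ × ℝ)) ∩ Set.Icc (-1, -2) (1, 2)) with hT'def
  have hT'L : T' ⊆ L := Set.union_subset hTL Set.inter_subset_left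
  have h1 : ∀ᶠ θ : ℝ in 𝓝[>] 0, ∀ s ∈ T', s ≠ 0 → θ < h s.1 := by
    refine (Filter.eventually_all_finite hT').2 fun s hs => ?_
    by_cases hs0 : s = 0
    · simp [hs0]
    · filter_upwards [(gt_mem_nhds (hpos s.1 fun h => hs0 (hinj s (hT'L hs) h))).filter_mono
        nhdsWithin_le_nhds] with θ hθ _ using hθ
  obtain ⟨θ, ⟨h2, h3⟩, hθ⟩ := ((h1.and hp).and self_mem_nhdsWithin).exists
  have hθ : 0 < θ := hθ
  refine ⟨θ, hθ, h3, fun s hs => h2 s (Or.inl hs), ?_⟩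
  obtain ⟨δ, hδ, hball⟩ := Metric.eventually_nhds_iff.1
    (hc.eventually (gt_mem_nhds (show h 0 < θ by rwa [h0])))
  obtain ⟨g, hg, hg1, hgδ⟩ := hsmall (min δ 1) (by positivity)
  have hgθ : h g.1 < θ := hball (by
    rw [Real.dist_eq, sub_zero]
    exact hgδ.trans_le (min_le_left _ _))
  have hg0 : g ≠ 0 := fun h => hg1 (by rw [h]; rfl)
  have hle := (hgδ.trans_le (min_le_right _ _)).le
  refine ⟨g, hg, hg0, hle, ?_, hgθ⟩
  by_contra hsm
  rw [not_lt] at hsm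
  rw [abs_le] at hsm hle
  have := h2 g (Or.inr ⟨hg, ⟨hle.1, hsm.1⟩, hle.2, hsm.2⟩) hg0
  linarith

theorem infinitelyCut_fullUnipotent_closure_pair {W : Mat3} (hW : W.PosDef) {v w : ℝ × ℝ}
    (hv : v.1 ≠ 0) {Γ : Subgroup SL(3, ℝ)}
    (hΓ : IsParameterGroup fullUnipotent (AddSubgroup.closure {v, w}) Γ)
    (hfc : FiniteOnCompacts Γ) (hcyc : ¬ IsCyclic Γ) : InfinitelyCut Γ W := by
  obtain ⟨D, hD⟩ := exists_orbitTrace_fullUnipotent hW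
  have hfin := fun K => hΓ.finite_inter continuous_fullUnipotent injective_fullUnipotent hfc (K := K)
  rcases fst_discrete_or_dense (hΓ.ne_zmultiples fullUnipotent_add hcyc) with
    ⟨x₀, hx₀, hmul, z, hz, hzL⟩ | ⟨hinj, hsmall⟩
  · have hx0 : x₀.1 ≠ 0 := by
      intro h0
      obtain ⟨k, hk⟩ := hmul v (AddSubgroup.subset_closure (Or.inl rfl))
      exact hv (by rw [hk, h0, mul_zero])
    refine infinitelyCut_of_forall_exists _
      (infinite_zsmul_add injective_fullUnipotent hx₀ hz hzL) ?_ ?_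
    · rintro _ ⟨x, ⟨hx, -⟩, rfl⟩
      exact (hΓ _).2 ⟨x, hx, rfl⟩
    rintro _ ⟨x, ⟨hx, hxx₀⟩, rfl⟩
    set A := |D| + 1 with hA
    have hA0 : 0 < A := by positivity
    have hx1 : x.1 ≠ 0 := by rwa [hxx₀]
    obtain ⟨b, hb⟩ : ∃ b, x.2 + x.1 ^ 2 / 2 + b * x.1 = 0 :=
      ⟨-(x.2 + x.1 ^ 2 / 2) / x.1, by field_simp; ring⟩
    -- On first coordinate `k * x.1` the terms outside the square give `A x.1² k (k - 1)`, zero only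
    -- for `k = 0, 1`. On those two fibres the square vanishes only at `0` and at `x`.
    obtain ⟨Y, hY, h⟩ := hD 1 A one_pos (by linarith [le_abs_self D]) b 0 (-A * x.1)
    refine ⟨Y, hY, ?_, fun s hs hs1 hsx => ?_⟩
    · have := h x
      rw [add_zero, hb] at this
      nlinarith
    obtain ⟨y, hy, rfl⟩ := (hΓ s).1 hs
    rw [← sub_pos, h]
    obtain ⟨k, hk⟩ := hmul y hy
    rw [← hxx₀] at hk
    by_cases hk0 : k = 0
    · have hy1 : y.1 = 0 := by rw [hk, hk0, Int.cast_zero, zero_mul]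
      have hy2 : y.2 ≠ 0 := by
        intro hy2
        have : y = 0 := Prod.ext hy1 hy2
        exact hs1 (by rw [this, map_zero_of_map_add fullUnipotent_add])
      have : 0 < y.2 ^ 2 := by positivity
      rw [hy1]
      linarith
    by_cases hk1 : k = 1
    · have hy1 : y.1 = x.1 := by rw [hk, hk1, Int.cast_one, one_mul]
      have hy2 : y.2 - x.2 ≠ 0 := by
        intro hy2
        exact hsx (by rw [show y = x from Prod.ext hy1 (sub_eq_zero.1 hy2)])
      have : 0 < (y.2 - x.2) ^ 2 := by positivity
      rw [hy1, add_zero, show y.2 + x.1 ^ 2 / 2 + b * x.1 = y.2 - x.2 by linarith]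
      linarith
    · have h1 : 0 < k * (k - 1) := by
        rcases lt_or_gt_of_ne hk0 with h | h
        · exact mul_pos_of_neg_of_neg h (by omega)
        · exact mul_pos h (by omega)
      have h2 : (0 : ℝ) < k * (k - 1) := by exact_mod_cast h1
      have h3 : 0 < A * x.1 ^ 2 * (k * (k - 1)) := by positivity
      have h4 : A * y.1 ^ 2 + -A * x.1 * y.1 = A * x.1 ^ 2 * (k * (k - 1)) := by rw [hk]; ring
      nlinarith [sq_nonneg (y.2 + y.1 ^ 2 / 2 + b * y.1 + 0)]
  · intro S hSfin hS
    have hTfin : (fullUnipotent ⁻¹' S).Finite := hSfin.preimage injective_fullUnipotent.injOn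
    have hTL : fullUnipotent ⁻¹' S ⊆ AddSubgroup.closure {v, w} := by
      intro x hx
      obtain ⟨y, hy, hyx⟩ := (hΓ _).1 (hS hx)
      rwa [← injective_fullUnipotent hyx]
    have hp : ∀ᶠ θ : ℝ in 𝓝[>] 0, θ * |D| < 1 := by
      have hc : Continuous fun θ : ℝ => θ * |D| := by fun_prop
      exact (hc.continuousAt.eventually (gt_mem_nhds (by simp))).filter_mono nhdsWithin_le_nhds
    obtain ⟨θ, hθ, hθD, hST, g, hg, hg0, hg1, hg2, hgθ⟩ := exists_small_fst hfin hinj hsmall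
      (h := fun t => t ^ 2) (by fun_prop) (by simp) (fun t ht => by positivity) hTfin hTL hp
    set c := -(g.2 + g.1 ^ 2 / 2) with hc
    have hc1 : 1 ≤ c ^ 2 := by
      rw [abs_le] at hg1
      have h1 : g.1 ^ 2 ≤ 1 := by nlinarith
      rcases lt_abs.1 hg2 with h | h <;> nlinarith [sq_nonneg g.1]
    have hθc : θ / c ^ 2 ≤ θ := div_le_self hθ.le hc1
    have hθc0 : 0 < θ / c ^ 2 := by positivity
    -- The function is at least `v.1 ^ 2 - θ`, with equality at `g`, where the square vanishes by
    -- the choice of `c`. The threshold `θ` separates `g` from the finite set.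
    obtain ⟨Y, hY, h⟩ := hD (θ / c ^ 2) 1 hθc0 (by
      nlinarith [le_abs_self D, abs_nonneg D]) 0 c 0
    have hθeq : θ / c ^ 2 * c ^ 2 = θ := div_mul_cancel₀ _ (by linarith : (0 : ℝ) < c ^ 2).ne'
    refine ⟨Y, hY, ⟨_, (hΓ _).2 ⟨g, hg, rfl⟩, ?_, ?_⟩, fun s hs hs1 => ?_⟩
    · rw [← map_zero_of_map_add fullUnipotent_add]
      exact fun h => hg0 (injective_fullUnipotent h)
    · rw [← sub_nonpos, h, show g.2 + g.1 ^ 2 / 2 + 0 * g.1 + c = 0 by rw [hc]; ring]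
      linarith
    · obtain ⟨x, hx, rfl⟩ := (hΓ s).1 (hS hs)
      have hx0 : x ≠ 0 := by
        rintro rfl
        exact hs1 (map_zero_of_map_add fullUnipotent_add)
      have h1 := hST x hs hx0
      rw [← sub_pos, h]
      have h2 : 0 ≤ θ / c ^ 2 * (x.2 + x.1 ^ 2 / 2 + 0 * x.1 + c) ^ 2 := by positivity
      nlinarith

theorem exp_mul_exp_sub_pos {a b c : ℝ} (h : 0 < a * (b - c)) :
    0 < (Real.exp a - 1) * (Real.exp b - Real.exp c) := by
  rcases (mul_pos_iff.1 h) with ⟨h1, h2⟩ | ⟨h1, h2⟩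
  · have := Real.exp_lt_exp.2 (sub_pos.1 h2)
    have := Real.one_lt_exp_iff.2 h1
    exact mul_pos (by linarith) (by linarith)
  · have := Real.exp_lt_exp.2 (sub_neg.1 h2)
    have := Real.exp_lt_one_iff.2 h1
    exact mul_pos_of_neg_of_neg (by linarith) (by linarith)

theorem exp_neg_two_sq (t : ℝ) : Real.exp (-2 * t) ^ 2 = ((Real.exp t ^ 2) ^ 2)⁻¹ := by
  rw [← Real.exp_nat_mul, ← Real.exp_nat_mul, ← Real.exp_nat_mul, ← Real.exp_neg]
  congr 1
  push_cast
  ring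

theorem infinitelyCut_blockGroup_closure_pair {W : Mat3} (hW : W.PosDef) (h12 : W 1 2 ≠ 0)
    {v w : ℝ × ℝ} (hvw : v.1 ≠ 0 ∨ w.1 ≠ 0) {Γ : Subgroup SL(3, ℝ)}
    (hΓ : IsParameterGroup blockGroup (AddSubgroup.closure {v, w}) Γ)
    (hfc : FiniteOnCompacts Γ) (hcyc : ¬ IsCyclic Γ) : InfinitelyCut Γ W := by
  have hfin := fun K => hΓ.finite_inter continuous_blockGroup injective_blockGroup hfc (K := K)
  have hone : ∀ Y, orbitTrace W 1 Y = orbitTrace W (blockGroup 0) Y := fun Y => by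
    rw [map_zero_of_map_add blockGroup_add]
  rcases fst_discrete_or_dense (hΓ.ne_zmultiples blockGroup_add hcyc) with
    ⟨x₀, hx₀, hmul, z, hz, hzL⟩ | ⟨hinj, hsmall⟩
  · have hx0 : x₀.1 ≠ 0 := by
      intro h0
      have h1 : ∀ x ∈ AddSubgroup.closure {v, w}, x.1 = 0 := fun x hx => by
        obtain ⟨k, hk⟩ := hmul x hx
        rw [hk, h0, mul_zero]
      rcases hvw with h | h
      · exact h (h1 v (AddSubgroup.subset_closure (Or.inl rfl)))
      · exact h (h1 w (AddSubgroup.subset_closure (Or.inr rfl)))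
    refine infinitelyCut_of_forall_exists _
      (infinite_zsmul_add injective_blockGroup hx₀ hz hzL) ?_ ?_
    · rintro _ ⟨x, ⟨hx, -⟩, rfl⟩
      exact (hΓ _).2 ⟨x, hx, rfl⟩
    rintro _ ⟨x, ⟨hx, hxx₀⟩, rfl⟩
    have hx1 : x.1 ≠ 0 := by rwa [hxx₀]
    set X := Real.exp x.1 ^ 2 with hX
    have hX0 : 0 < X := by positivity
    have hne : Real.exp (-2 * x.1) - Real.exp x.1 ≠ 0 := by
      rw [sub_ne_zero, Ne, Real.exp_eq_exp]
      intro h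
      exact hx1 (by linarith)
    -- With `u₀ = -κ` the square vanishes at both `0` and `x`.
    obtain ⟨κ, hκ⟩ : ∃ κ, κ * (Real.exp (-2 * x.1) - Real.exp x.1) = Real.exp x.1 * x.2 :=
      ⟨Real.exp x.1 * x.2 / (Real.exp (-2 * x.1) - Real.exp x.1),
        div_mul_cancel₀ _ hne⟩
    -- This `β`, with `γ = 1`, makes `β Z + γ / Z²` equal at `Z = 1` and `Z = X`; it is larger for
    -- positive `Z` outside the interval between them.
    have hβ : 0 < (X + 1) / X ^ 2 := by positivity
    obtain ⟨α, hα, hα0⟩ := ((exists_orbitTrace_blockGroup hW h12 hβ one_pos κ).and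
      self_mem_nhdsWithin).exists
    have hα0 : 0 < α := hα0
    obtain ⟨Y, hY, h⟩ := hα (-κ)
    have h1 : orbitTrace W 1 Y = (X + 1) / X ^ 2 + 1 := by
      rw [hone, h]
      simp
    refine ⟨Y, hY, ?_, fun s hs hs1 hsx => ?_⟩
    · rw [h1, h, exp_neg_two_sq, ← hX,
        show Real.exp x.1 * (x.2 - -κ) - κ * Real.exp (-2 * x.1) = 0 by linear_combination -hκ]
      refine le_of_eq ?_
      field_simp
      ring
    obtain ⟨y, hy, rfl⟩ := (hΓ s).1 hs
    rw [h1, h]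
    obtain ⟨k, hk⟩ := hmul y hy
    rw [← hxx₀] at hk
    by_cases hk0 : k = 0
    · have hy1 : y.1 = 0 := by rw [hk, hk0, Int.cast_zero, zero_mul]
      have hy2 : y.2 ≠ 0 := by
        intro hy2
        have : y = 0 := Prod.ext hy1 hy2
        exact hs1 (by rw [this, map_zero_of_map_add blockGroup_add])
      have : 0 < α * y.2 ^ 2 := by positivity
      rw [hy1, mul_zero, Real.exp_zero]
      linarith
    by_cases hk1 : k = 1
    · have hy1 : y.1 = x.1 := by rw [hk, hk1, Int.cast_one, one_mul]
      have hy2 : y.2 - x.2 ≠ 0 := by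
        intro hy2
        exact hsx (by rw [show y = x from Prod.ext hy1 (sub_eq_zero.1 hy2)])
      have h2 : 0 < α * (Real.exp x.1 * (y.2 - x.2)) ^ 2 := by positivity
      rw [hy1, exp_neg_two_sq, ← hX, show Real.exp x.1 * (y.2 - -κ) - κ * Real.exp (-2 * x.1) =
        Real.exp x.1 * (y.2 - x.2) by linear_combination -hκ]
      have h3 : (X + 1) / X ^ 2 * X + 1 * (X ^ 2)⁻¹ = (X + 1) / X ^ 2 + 1 := by
        field_simp
        ring
      linarith
    · have h2 : 0 < k * (k - 1) := by
        rcases lt_or_gt_of_ne hk0 with h | h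
        · exact mul_pos_of_neg_of_neg h (by omega)
        · exact mul_pos h (by omega)
      have h3 : (0 : ℝ) < k * (k - 1) := by exact_mod_cast h2
      set Z := Real.exp y.1 ^ 2 with hZ
      have hZ0 : 0 < Z := by positivity
      have h4 : 0 < (Z - 1) * (Z - X) := by
        rw [hZ, hX, ← Real.exp_nat_mul, ← Real.exp_nat_mul]
        refine exp_mul_exp_sub_pos ?_
        have h5 : ((2 : ℕ) : ℝ) * y.1 * (((2 : ℕ) : ℝ) * y.1 - ((2 : ℕ) : ℝ) * x.1) =
            4 * x.1 ^ 2 * (k * (k - 1)) := by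
          rw [hk]; push_cast; ring
        rw [h5]
        positivity
      have h6 : (X + 1) / X ^ 2 * Z + 1 * (Z ^ 2)⁻¹ - ((X + 1) / X ^ 2 + 1) =
          (Z - 1) * (Z - X) * ((X * Z + X + Z) / (X ^ 2 * Z ^ 2)) := by
        field_simp
        ring
      have h7 : 0 < (Z - 1) * (Z - X) * ((X * Z + X + Z) / (X ^ 2 * Z ^ 2)) := by positivity
      rw [exp_neg_two_sq, ← hZ]
      have h8 : 0 ≤ α * (Real.exp y.1 * (y.2 - -κ) - κ * Real.exp (-2 * y.1)) ^ 2 := by positivity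
      linarith
  · intro S hSfin hS
    have hTfin : (blockGroup ⁻¹' S).Finite := hSfin.preimage injective_blockGroup.injOn
    have hTL : blockGroup ⁻¹' S ⊆ AddSubgroup.closure {v, w} := by
      intro x hx
      obtain ⟨y, hy, hyx⟩ := (hΓ _).1 (hS hx)
      rwa [← injective_blockGroup hyx]
    -- For `β = 2`, `γ = 1` the function `2 Z + 1 / Z²` has its strict minimum `3` on `Z > 0` at `Z
    -- = 1`, so its excess over `3` can play the role of a squared first coordinate.
    obtain ⟨α₀, hα₀, hα⟩ := mem_nhdsGT_iff_exists_Ioo_subset.1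
      (exists_orbitTrace_blockGroup hW h12 two_pos one_pos 0)
    have hα₀ : 0 < α₀ := hα₀
    have hp : ∀ᶠ θ : ℝ in 𝓝[>] 0, θ < α₀ := (gt_mem_nhds hα₀).filter_mono nhdsWithin_le_nhds
    obtain ⟨θ, hθ, hθD, hST, g, hg, hg0, hg1, hg2, hgθ⟩ := exists_small_fst hfin hinj hsmall
      (h := fun t => 2 * Real.exp t ^ 2 + Real.exp (-2 * t) ^ 2 - 3) (by fun_prop)
      (by norm_num) (fun t ht => by
        rw [exp_neg_two_sq]
        have hX1 : Real.exp t ^ 2 - 1 ≠ 0 := by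
          rw [← Real.exp_nat_mul, sub_ne_zero, Ne, Real.exp_eq_one_iff]
          simpa using ht
        set X := Real.exp t ^ 2
        have hX0 : 0 < X := by positivity
        have : 2 * X + (X ^ 2)⁻¹ - 3 = (X - 1) ^ 2 * ((2 * X + 1) / X ^ 2) := by
          field_simp
          ring
        rw [this]
        positivity) hTfin hTL hp
    have hu1 : 1 ≤ g.2 ^ 2 := by
      rw [← sq_abs]
      nlinarith
    have hθc : θ / g.2 ^ 2 ≤ θ := div_le_self hθ.le hu1
    have hθc0 : 0 < θ / g.2 ^ 2 := by positivity
    obtain ⟨Y, hY, h⟩ := hα ⟨hθc0, hθc.trans_lt hθD⟩ g.2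
    have hθeq : θ / g.2 ^ 2 * g.2 ^ 2 = θ :=
      div_mul_cancel₀ _ (by linarith : (0 : ℝ) < g.2 ^ 2).ne'
    have h1 : orbitTrace W 1 Y = θ + 3 := by
      rw [hone, h]
      simp
      linarith
    refine ⟨Y, hY, ⟨_, (hΓ _).2 ⟨g, hg, rfl⟩, ?_, ?_⟩, fun s hs hs1 => ?_⟩
    · rw [← map_zero_of_map_add blockGroup_add]
      exact fun h => hg0 (injective_blockGroup h)
    · rw [h1, h, sub_self, mul_zero, zero_mul, sub_zero]
      linarith
    · obtain ⟨x, hx, rfl⟩ := (hΓ s).1 (hS hs)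
      have hx0 : x ≠ 0 := by
        rintro rfl
        exact hs1 (map_zero_of_map_add blockGroup_add)
      have h2 := hST x hs hx0
      rw [h1, h]
      have h3 : 0 ≤ θ / g.2 ^ 2 * (Real.exp x.1 * (x.2 - g.2) - 0 * Real.exp (-2 * x.1)) ^ 2 := by
        positivity
      linarith

end InfinitelySidedTypes

end DirichletSelberg

namespace DirichletSelberg

/-! ### The dense Zariski open set of base points -/

section Generic

/-- The points `X` such that the off-diagonal entries in the last column of the congruence
transform of `X⁻¹` by `k` do not vanish. -/
def genericSet (k : SL(3, ℝ)) : Set (SymSpace 3) :=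
  {X | ((k : Mat3) * X.1⁻¹ * (k : Mat3)ᵀ) 0 2 ≠ 0 ∧ ((k : Mat3) * X.1⁻¹ * (k : Mat3)ᵀ) 1 2 ≠ 0}

theorem inv_eq_adjugate (X : SymSpace 3) : X.1⁻¹ = X.1.adjugate := by
  rw [Matrix.inv_def, X.2.2, Ring.inverse_one, one_smul]

/-- At determinant one the inverse is the adjugate, so both entries are polynomials in `X`; the
complement is the zero set of their product. -/
theorem isZariskiOpen_genericSet (k : SL(3, ℝ)) : IsZariskiOpen (genericSet k) := by
  set C : ℝ →+* MvPolynomial (Fin 3 × Fin 3) ℝ := MvPolynomial.C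
  set P : Matrix (Fin 3) (Fin 3) (MvPolynomial (Fin 3 × Fin 3) ℝ) :=
    C.mapMatrix (k : Mat3) * (Matrix.mvPolynomialX (Fin 3) (Fin 3) ℝ).adjugate *
      C.mapMatrix (k : Mat3)ᵀ with hP
  have heval : ∀ (X : SymSpace 3) (i j : Fin 3),
      MvPolynomial.eval (fun ij : Fin 3 × Fin 3 => X.1 ij.1 ij.2) (P i j) =
        ((k : Mat3) * X.1⁻¹ * (k : Mat3)ᵀ) i j := by
    intro X i j
    have hC : ∀ M : Mat3, (MvPolynomial.eval fun ij : Fin 3 × Fin 3 => X.1 ij.1 ij.2).mapMatrix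
        (C.mapMatrix M) = M := fun M => by
      ext i j
      simp [C]
    have : (MvPolynomial.eval fun ij : Fin 3 × Fin 3 => X.1 ij.1 ij.2).mapMatrix P =
        (k : Mat3) * X.1⁻¹ * (k : Mat3)ᵀ := by
      rw [hP, map_mul, map_mul, hC, hC, RingHom.map_adjugate, Matrix.mvPolynomialX_mapMatrix_eval,
        inv_eq_adjugate]
    rw [← this]
    rfl
  refine ⟨{P 0 2 * P 1 2}, ?_⟩
  ext X
  simp only [genericSet, Set.mem_compl_iff, Set.mem_ofPred_eq, Set.mem_singleton_iff, forall_eq,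
    map_mul, heval, mul_eq_zero]
  tauto

/-- Perturb the transformed inverse `W` along `E`, which moves exactly the two entries in question
and their mirror images, and return to `𝒫(3)` by the adjugate and rescaling. Up to a positive factor
this recovers the perturbed matrix. -/
theorem dense_genericSet (k : SL(3, ℝ)) : Dense (genericSet k) := by
  intro X
  set W : Mat3 := (k : Mat3) * X.1⁻¹ * (k : Mat3)ᵀ with hW
  have hWpos : W.PosDef := posDef_conj (posDef_inv X) k
  set E : Mat3 := !![0, 0, 1; 0, 0, 1; 1, 1, 0] with hE
  have hEs : E.IsSymm := by
    ext i j
    fin_cases i <;> fin_cases j <;> rfl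
  set F : ℝ → Mat3 := fun ε => W + ε • E with hF
  have hFc : Continuous F := by fun_prop
  have hFs : ∀ ε, (F ε).IsSymm := fun ε => hWpos.isSymm.add (hEs.smul ε)
  set G : ℝ → Mat3 := fun ε => (k : Mat3)ᵀ * (F ε).adjugate * (k : Mat3) with hG
  have hGc : Continuous G :=
    (continuous_const.matrix_mul hFc.matrix_adjugate).matrix_mul continuous_const
  have hk1 : (k : Mat3) * (k : Mat3).adjugate = 1 := by simp [Matrix.mul_adjugate]
  have hk2 : (k : Mat3).adjugate * (k : Mat3) = 1 := by simp [Matrix.adjugate_mul]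
  have hk3 : (k : Mat3)ᵀ * (k : Mat3)ᵀ.adjugate = 1 := by simp [Matrix.mul_adjugate]
  have hk4 : (k : Mat3)ᵀ.adjugate * (k : Mat3)ᵀ = 1 := by simp [Matrix.adjugate_mul]
  have hG0 : G 0 = X.1 := by
    have h : (F 0).adjugate = (k : Mat3)ᵀ.adjugate * X.1 * (k : Mat3).adjugate := by
      simp only [hF, zero_smul, add_zero, hW, Matrix.adjugate_mul_distrib, inv_eq_adjugate]
      rw [Matrix.adjugate_adjugate _ (by simp), X.2.2, one_pow, one_smul, Matrix.mul_assoc]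
    simp only [hG, h]
    calc _ = ((k : Mat3)ᵀ * (k : Mat3)ᵀ.adjugate) * X.1 * ((k : Mat3).adjugate * (k : Mat3)) := by
          simp only [Matrix.mul_assoc]
      _ = X.1 := by simp [hk3, hk2]
  have hGs : ∀ ε, (G ε).IsSymm := fun ε => by
    simp [Matrix.IsSymm, hG, Matrix.mul_assoc, Matrix.adjugate_transpose, (hFs ε).eq]
  have hGt : Filter.Tendsto G (𝓝[≠] 0) (𝓝 X.1) :=
    hG0 ▸ (hGc.tendsto 0).mono_left nhdsWithin_le_nhds
  have hlim := tendsto_rayPoint X.2.1 hGt (Filter.Eventually.of_forall hGs)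
  rw [rayPoint_self] at hlim
  refine mem_closure_of_tendsto hlim ?_
  have hFpos : ∀ᶠ ε in 𝓝[≠] (0 : ℝ), (F ε).PosDef :=
    eventually_posDef hWpos
      (by simpa [hF] using (hFc.tendsto 0).mono_left (nhdsWithin_le_nhds (s := {0}ᶜ)))
      (Filter.Eventually.of_forall hFs)
  have hentry : ∀ i j, E i j = 1 → ∀ᶠ ε in 𝓝[≠] (0 : ℝ), F ε i j ≠ 0 := by
    intro i j hij
    have h : ∀ ε, F ε i j = W i j + ε := fun ε => by simp [hF, hij]
    rcases eq_or_ne (W i j) 0 with h0 | h0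
    · filter_upwards [self_mem_nhdsWithin] with ε hε
      rw [h, h0, zero_add]
      exact hε
    · refine ((hFc.matrix_elem i j).tendsto 0).mono_left nhdsWithin_le_nhds |>.eventually_ne ?_
      simpa [h] using h0
  filter_upwards [eventually_posDef X.2.1 hGt (Filter.Eventually.of_forall hGs), hFpos,
    hentry 0 2 rfl, hentry 1 2 rfl] with ε hGp hFp h02 h12
  obtain ⟨c, hc, hcG⟩ := exists_rayPoint_eq hGp
  have hkey : (k : Mat3) * (rayPoint (G ε)).1⁻¹ * (k : Mat3)ᵀ = (c ^ 2 * (F ε).det) • F ε := by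
    rw [inv_eq_adjugate, hcG, Matrix.adjugate_smul]
    simp only [hG, Matrix.adjugate_mul_distrib]
    rw [Matrix.adjugate_adjugate _ (by simp)]
    simp only [Fintype.card_fin, Nat.reduceSub, pow_one, Matrix.mul_smul, Matrix.smul_mul,
      smul_smul]
    congr 1
    calc _ = ((k : Mat3) * (k : Mat3).adjugate) * F ε * ((k : Mat3)ᵀ.adjugate * (k : Mat3)ᵀ) := by
          simp only [Matrix.mul_assoc]
      _ = F ε := by simp [hk1, hk4]
  have hne : c ^ 2 * (F ε).det ≠ 0 := (mul_pos (pow_pos hc 2) hFp.det_pos).ne'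
  simp only [genericSet, Set.mem_ofPred_eq, hkey, Matrix.smul_apply, smul_eq_mul]
  exact ⟨mul_ne_zero hne h02, mul_ne_zero hne h12⟩

end Generic

/-! ### From conjugates of the normal forms to the theorem -/

section Transport

variable {Γ : Subgroup SL(3, ℝ)}

theorem isCyclic_of_isCyclic_map_conj {k : SL(3, ℝ)}
    (h : IsCyclic (Γ.map (MulAut.conj k).toMonoidHom)) : IsCyclic Γ := by
  have e := Γ.equivMapOfInjective (MulAut.conj k).toMonoidHom (MulAut.conj k).injective
  exact isCyclic_of_surjective e.symm e.symm.surjective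

theorem finitelySided_of_isConjugateToSpan [DiscreteTopology Γ] {S : Set Mat3}
    (h : IsConjugateToSpan Γ S) {r : ℝ × ℝ → SL(3, ℝ)} (hadd : ∀ v w, r (v + w) = r v * r w)
    (T : Set (ℝ × ℝ)) (hS : S = (fun v => (r v : Mat3)) '' T)
    (hcut : ∀ (Γ' : Subgroup SL(3, ℝ)) (W : Mat3), W.PosDef → FiniteOnCompacts Γ' →
      (IsCyclic Γ' → IsCyclic Γ) → IsParameterGroup r (AddSubgroup.closure T) Γ' →
      FinitelyCut Γ' W) (X : SymSpace 3) : FinitelySided (DS X Γ) := by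
  obtain ⟨k, hk⟩ := h
  refine finitelySided_DS (FinitelyCut.of_map_conj k (hcut _ _ (posDef_conj (posDef_inv X) k)
    ((finiteOnCompacts_of_discrete Γ).map_conj k) isCyclic_of_isCyclic_map_conj fun g => ?_))
  rw [hk]
  exact mem_closure_iff_exists hadd hS

theorem exists_infinitelySided_of_isConjugateToSpan [DiscreteTopology Γ] {S : Set Mat3}
    (h : IsConjugateToSpan Γ S) {r : ℝ × ℝ → SL(3, ℝ)} (hadd : ∀ v w, r (v + w) = r v * r w)
    (T : Set (ℝ × ℝ)) (hS : S = (fun v => (r v : Mat3)) '' T)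
    (hcut : ∀ (Γ' : Subgroup SL(3, ℝ)) (W : Mat3), W.PosDef → W 0 2 ≠ 0 → W 1 2 ≠ 0 →
      FiniteOnCompacts Γ' → (IsCyclic Γ' → IsCyclic Γ) →
      IsParameterGroup r (AddSubgroup.closure T) Γ' → InfinitelyCut Γ' W) :
    ∃ U : Set (SymSpace 3), Dense U ∧ IsZariskiOpen U ∧
      ∀ X ∈ U, InfinitelySided (DS X Γ) := by
  obtain ⟨k, hk⟩ := h
  refine ⟨genericSet k, dense_genericSet k, isZariskiOpen_genericSet k, fun X hX => ?_⟩
  refine infinitelySided_DS (finiteOnCompacts_of_discrete Γ) (InfinitelyCut.of_map_conj k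
    (hcut _ _ (posDef_conj (posDef_inv X) k) hX.1 hX.2
      ((finiteOnCompacts_of_discrete Γ).map_conj k) isCyclic_of_isCyclic_map_conj fun g => ?_))
  rw [hk]
  exact mem_closure_iff_exists hadd hS

theorem coe_diagTorus_of_add_eq_zero {r s t : ℝ} (h : r + s + t = 0) :
    (diagTorus (r, s) : Mat3) = expDiag r s t := by
  rw [show t = -r - s by linarith]
  rfl

theorem coe_blockGroup_exp_neg (t a : ℝ) :
    (blockGroup (t, Real.exp (-t) * a) : Mat3) = expBlock t a := by
  change expBlock t (Real.exp t * (Real.exp (-t) * a)) = _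
  rw [← mul_assoc, ← Real.exp_add, add_neg_cancel, Real.exp_zero, one_mul]

theorem coe_fullUnipotent_sub (a b : ℝ) :
    (fullUnipotent (a, b - a ^ 2 / 2) : Mat3) = !![1, a, b; 0, 1, a; 0, 0, 1] := by
  simp [fullUnipotent]

theorem coe_fullUnipotent_one :
    (fullUnipotent (1, -1 / 2) : Mat3) = !![1, 1, 0; 0, 1, 1; 0, 0, 1] := by
  norm_num [fullUnipotent]

theorem finitelySided_of_cyclic [DiscreteTopology Γ]
    (h : CyclicType1 Γ ∨ CyclicType3 Γ ∨ CyclicType4 Γ) (X : SymSpace 3) :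
    FinitelySided (DS X Γ) := by
  rcases h with h | ⟨r, s, t, h0, hr, hs, ht, h⟩ | ⟨t, ht, h⟩
  · refine finitelySided_of_isConjugateToSpan h rowUnipotent_add {(1, 0)}
      (by rw [Set.image_singleton]; rfl) (fun Γ' W hW _ _ hΓ' => ?_) X
    rw [← AddSubgroup.zmultiples_eq_closure] at hΓ'
    exact finitelyCut_rowUnipotent_zmultiples hW hΓ'
  · refine finitelySided_of_isConjugateToSpan h diagTorus_add {(r, s)}
      (by rw [Set.image_singleton, coe_diagTorus_of_add_eq_zero h0]) (fun Γ' W hW _ _ hΓ' => ?_) X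
    rw [← AddSubgroup.zmultiples_eq_closure] at hΓ'
    refine finitelyCut_diagTorus_zmultiples hW (fun i => ?_) hΓ'
    have : -r - s ≠ 0 := by
      rwa [show -r - s = t by linarith]
    fin_cases i
    exacts [hr, hs, this]
  · refine finitelySided_of_isConjugateToSpan h blockGroup_add {(t, Real.exp (-t) * 1)}
      (by rw [Set.image_singleton, coe_blockGroup_exp_neg]) (fun Γ' W hW _ _ hΓ' => ?_) X
    rw [← AddSubgroup.zmultiples_eq_closure] at hΓ'
    exact finitelyCut_blockGroup_zmultiples hW ht hΓ'

theorem finitelySided_of_twoGenerated [DiscreteTopology Γ] (hcyc : ¬ IsCyclic Γ)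
    (h : TwoGenType1 Γ ∨ TwoGenType3 Γ) (X : SymSpace 3) : FinitelySided (DS X Γ) := by
  rcases h with h | ⟨r, s, t, r', s', t', h0, h0', h⟩
  · exact finitelySided_of_isConjugateToSpan h rowUnipotent_add {(1, 0), (0, 1)}
      (by rw [Set.image_pair]; rfl)
      (fun Γ' W hW hfc _ hΓ' => finitelyCut_rowUnipotent_closure_pair hW hΓ' hfc) X
  · exact finitelySided_of_isConjugateToSpan h diagTorus_add {(r, s), (r', s')}
      (by rw [Set.image_pair, coe_diagTorus_of_add_eq_zero h0, coe_diagTorus_of_add_eq_zero h0'])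
      (fun Γ' W hW hfc hc hΓ' =>
        finitelyCut_diagTorus_closure_pair hW hΓ' hfc fun h => hcyc (hc h)) X

theorem exists_infinitelySided_of_cyclic [DiscreteTopology Γ]
    (h : CyclicType2 Γ ∨ CyclicType3' Γ) :
    ∃ U : Set (SymSpace 3), Dense U ∧ IsZariskiOpen U ∧
      ∀ X ∈ U, InfinitelySided (DS X Γ) := by
  rcases h with h | ⟨s, hs, h⟩
  · refine exists_infinitelySided_of_isConjugateToSpan h fullUnipotent_add {(1, -1 / 2)}
      (by rw [Set.image_singleton, coe_fullUnipotent_one]) fun Γ' W hW _ _ _ _ hΓ' => ?_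
    rw [← AddSubgroup.zmultiples_eq_closure] at hΓ'
    exact infinitelyCut_fullUnipotent_zmultiples hW hΓ'
  · refine exists_infinitelySided_of_isConjugateToSpan h diagTorus_add {(s, -s)}
      (by rw [Set.image_singleton, coe_diagTorus_of_add_eq_zero (t := 0) (by ring)])
      fun Γ' W hW h02 h12 _ _ hΓ' => ?_
    rw [← AddSubgroup.zmultiples_eq_closure] at hΓ'
    exact infinitelyCut_diagTorus_zmultiples hW h02 h12 hs hΓ'

theorem exists_infinitelySided_of_twoGenerated [DiscreteTopology Γ] (hcyc : ¬ IsCyclic Γ)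
    (h : TwoGenType1' Γ ∨ TwoGenType2 Γ ∨ TwoGenType4 Γ) :
    ∃ U : Set (SymSpace 3), Dense U ∧ IsZariskiOpen U ∧
      ∀ X ∈ U, InfinitelySided (DS X Γ) := by
  rcases h with h | ⟨a, b, -, h⟩ | ⟨s, t, a, hst, h⟩
  · exact exists_infinitelySided_of_isConjugateToSpan h colUnipotent_add {(0, 1), (1, 0)}
      (by rw [Set.image_pair]; rfl) fun Γ' W hW _ _ _ _ hΓ' => infinitelyCut_colUnipotent hW hΓ'
  · exact exists_infinitelySided_of_isConjugateToSpan h fullUnipotent_add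
      {(1, -1 / 2), (a, b - a ^ 2 / 2)}
      (by rw [Set.image_pair, coe_fullUnipotent_one, coe_fullUnipotent_sub])
      fun Γ' W hW _ _ hfc hc hΓ' => infinitelyCut_fullUnipotent_closure_pair hW one_ne_zero hΓ' hfc
        fun h => hcyc (hc h)
  · refine exists_infinitelySided_of_isConjugateToSpan h blockGroup_add
      {(t, Real.exp (-t) * 1), (s, Real.exp (-s) * a)}
      (by rw [Set.image_pair, coe_blockGroup_exp_neg, coe_blockGroup_exp_neg])
      fun Γ' W hW _ h12 hfc hc hΓ' => infinitelyCut_blockGroup_closure_pair hW h12 ?_ hΓ' hfc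
        fun h => hcyc (hc h)
    by_contra! h0
    exact hst (Prod.ext h0.2 h0.1)

end Transport

end DirichletSelberg

theorem mainTheorem6
    (Γ : Subgroup (Matrix.SpecialLinearGroup (Fin 3) ℝ))
    (hdisc : DiscreteTopology Γ)
    (hfree : DirichletSelberg.IsFreeAbelian Γ)
    (hpos : DirichletSelberg.GeneratedByPositive Γ) :
    ((IsCyclic Γ ∧
          (DirichletSelberg.CyclicType1 Γ ∨ DirichletSelberg.CyclicType3 Γ ∨
            DirichletSelberg.CyclicType4 Γ)) ∨
        (DirichletSelberg.IsTwoGenerated Γ ∧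
          (DirichletSelberg.TwoGenType1 Γ ∨ DirichletSelberg.TwoGenType3 Γ)) →
      ∀ X : DirichletSelberg.SymSpace 3,
        DirichletSelberg.FinitelySided (DirichletSelberg.DS X Γ)) ∧
    ((IsCyclic Γ ∧
          (DirichletSelberg.CyclicType2 Γ ∨ DirichletSelberg.CyclicType3' Γ)) ∨
        (DirichletSelberg.IsTwoGenerated Γ ∧
          (DirichletSelberg.TwoGenType1' Γ ∨ DirichletSelberg.TwoGenType2 Γ ∨
            DirichletSelberg.TwoGenType4 Γ)) →
      ∃ U : Set (DirichletSelberg.SymSpace 3),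
        Dense U ∧ DirichletSelberg.IsZariskiOpen U ∧
          ∀ X ∈ U, DirichletSelberg.InfinitelySided (DirichletSelberg.DS X Γ)) := by
  constructor
  · rintro (⟨-, h⟩ | ⟨⟨-, hcyc⟩, h⟩) X
    · exact DirichletSelberg.finitelySided_of_cyclic h X
    · exact DirichletSelberg.finitelySided_of_twoGenerated hcyc h X
  · rintro (⟨-, h⟩ | ⟨⟨-, hcyc⟩, h⟩)
    · exact DirichletSelberg.exists_infinitelySided_of_cyclic h
    · exact DirichletSelberg.exists_infinitelySided_of_twoGenerated hcyc h
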